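/- **Completeness.** *Setting.* Let $L=(L_{yes},L_{no})$ be a promise problem in $\mathbf{QMA}$ with a uniform family of polynomial-size verification circuits $V_{L,n}$ which take an instance $x\in\{0,1\}^n$ and an $m(n)$-qubit witness, output one bit, and have negligible error $\mu_L$: for $x\in L_{yes}$ some witness is accepted with probability at least $1-\mu_L(|x|)$, and for $x\in L_{no}$ every witness is accepted with probability at most $\mu_L(|x|)$. Let $\mathcal R_L(x)$ be the set of ($m(|x|)$-qubit, possibly mixed) states $\mathbf w$ that $V_L(x,\cdot)$ accepts with probability at least $1-\mu_L(|x|)$. Let $\mathsf{QRE}$ be an efficient quantum randomized encoding scheme with perfect correctness of the following form. For every circuit $F$ with quantum input $\mathbf q$ and classical input $c\in\{0,1\}^k$, every security parameter and every random string $r$, there is a unitary circuit $U_r$, whose description is computable in classical polynomial time from the (unary) security parameter, $F$ and $r$, with $U_r(\mathbf q,0)=(\hat{\mathbf F}_0,(\mathsf{lab}_{i,b})_{i\in[k],b\in\{0,1\}},0)$, where the labels $\mathsf{lab}_{i,b}=\mathsf{lab}_{i,b}(r)$ are classical strings of equal length; and a decoder (a quantum operation) maps $(\hat{\mathbf F}_0,(\mathsf{lab}_{i,c_i})_{i\in[k]})$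 to $F(\mathbf q,c)$, for all $\mathbf q$, $c$ and $r$. Let $\mathsf{Com}(1^\lambda,\cdot\,;\cdot)$ be a polynomial-time non-interactive commitment scheme. (Privacy of $\mathsf{QRE}$ and binding and hiding of $\mathsf{Com}$ are not needed.) For $n\in\mathbb N$, $m=m(n)$, let $F$ be the circuit that on classical input $(x,u,v)\in\{0,1\}^{n+m+m}$ and an $m$-qubit input $\tilde{\mathbf w}$ computes $\mathbf w=(X^{u_1}Z^{v_1}\otimes\cdots\otimes X^{u_m}Z^{v_m})(\tilde{\mathbf w})$ and outputs $V_{L,n}(x,\mathbf w)$. *The protocol* (security parameter $n$): 1. The prover, given $n$, prepares $m$ EPR pairs $(\mathbf e_1,\mathbf e_2)$, samples a uniform $r$, applies $U_r$ (for $F$) to $(\mathbf e_2,0)$ to obtain $(\hat{\mathbf F}_0,(\mathsf{lab}_{i,b})_{i,b})$, samples uniform $s_0,(s_{i,b})$, and sends $\hat{\mathbf F}_0$, $c_0=\mathsf{Com}(1^n,r;s_0)$ and $c_{i,b}=\mathsf{Com}(1^n,\mathsf{lab}_{i,b};s_{i,b})$. 2. The verifier sends a uniform bit $b$. 3. The prover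 now gets $x\in\{0,1\}^n$ and $\mathbf w$. If $b=0$ it sends $r,s_0,(\mathsf{lab}_{i,b'},s_{i,b'})_{i,b'}$. If $b=1$ it teleports $\mathbf w$ into $\mathbf e_1$ by a Bell measurement with outcome $(u,v)$ (leaving $X^{u_1}Z^{v_1}\otimes\cdots\otimes X^{u_m}Z^{v_m}(\mathbf w)$ on the other halves), and sends $(z_i,\mathsf{lab}_{i,z_i},s_{i,z_i})_i$ for $z=(x,u,v)$. 4. If $b=0$, the verifier checks all commitments, applies $U_r^{-1}$ to $(\hat{\mathbf F}_0,(\mathsf{lab}_{i,b'})_{i,b'},0)$ and accepts iff all qubits other than those of $\mathbf e_2$ are found to be zero. If $b=1$, it checks that $z=(x,u,v)$ for the instance $x$ and some $u,v$, and the opened commitments, decodes $(\hat{\mathbf F}_0,(\mathsf{lab}_{i,z_i})_i)$, and accepts iff the measured output bit is $1$. *Claim.* There exists a negligible function $\mu$ such that for all $x\in L_{yes}$ and $\mathbf w\in\mathcal R_L(x)$ the honest prover runs in polynomial time given $(x,\mathbf w)$ and is accepted by the verifier with probability at least $1-\mu(|x|)$. Here polynomial time means that one quantum program (independent of $x$,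 $\mathbf w$ and $n$, with the order of inputs above) acts exactly as the honest prover and makes at most $p(|x|)$ steps in every branch of its execution, for a fixed polynomial $p$. -/

import Mathlib

open scoped Matrix ComplexOrder

namespace ZKQMA

/-! ### Data, programs and running time

Classical data are binary trees. Programs are structured imperative programs over variables
that hold trees; they may also apply gates to qubits and measure qubits. A qubit is addressed
in unary, by the length of the list held by a variable. Writing a value costs one step plus the
size of the value, every other instruction and every test costs one step. -/

inductive Data
  | nil
  | cons (a b : Data)
  deriving DecidableEq

/-- Number of nodes. -/
def Data.size : Data → ℕ
  | .nil => 1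
  | .cons a b => a.size + b.size + 1

/-- Length of a tree read as a list. -/
def Data.len : Data → ℕ
  | .nil => 0
  | .cons _ b => b.len + 1

def Data.hd : Data → Data
  | .nil => .nil
  | .cons a _ => a

def Data.tl : Data → Data
  | .nil => .nil
  | .cons _ b => b

/-- Encoding of mathematical objects as data. Natural numbers are written in unary. -/
class ToData (α : Type) where
  enc : α → Data

open ToData (enc)

instance : ToData Data := ⟨id⟩

instance : ToData Bool := ⟨fun b => if b then .cons .nil .nil else .nil⟩

def encNat : ℕ → Data
  | 0 => .nil
  | n + 1 => .cons .nil (encNat n)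

instance : ToData ℕ := ⟨encNat⟩

instance (n : ℕ) : ToData (Fin n) := ⟨fun i => enc (i : ℕ)⟩

instance {α β : Type} [ToData α] [ToData β] : ToData (α × β) := ⟨fun p => .cons (enc p.1) (enc p.2)⟩

def encList {α : Type} [ToData α] : List α → Data
  | [] => .nil
  | a :: l => .cons (enc a) (encList l)

instance {α : Type} [ToData α] : ToData (List α) := ⟨encList⟩

/-- A function on `Fin n` is written as the list of its values. -/
instance {α : Type} [ToData α] (n : ℕ) : ToData (Fin n → α) := ⟨fun f => enc (List.ofFn f)⟩

instance {α : Type} [ToData α] : ToData (Bool → α) := ⟨fun f => enc (f false, f true)⟩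

/-- Hadamard, phase, `T` and controlled-not gates (control first) on qubits named by `α`.
The first, second and fourth generate the Clifford group. -/
inductive Gate (α : Type)
  | H (i : α)
  | S (i : α)
  | T (i : α)
  | CX (i j : α)

def Gate.map {α β : Type} (f : α → β) : Gate α → Gate β
  | .H i => .H (f i)
  | .S i => .S (f i)
  | .T i => .T (f i)
  | .CX i j => .CX (f i) (f j)

/-- A controlled-not has two different qubits. -/
def Gate.WF {α : Type} : Gate α → Prop
  | .CX i j => i ≠ j
  | _ => True

instance {α : Type} [ToData α] : ToData (Gate α) := ⟨fun g =>
  match g with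
  | .H i => enc ((0 : ℕ), i)
  | .S i => enc ((1 : ℕ), i)
  | .T i => enc ((2 : ℕ), i)
  | .CX i j => enc ((3 : ℕ), i, j)⟩

/-- The two quantum registers of a program: its memory, and the register of a quantum input. -/
inductive QReg
  | mem
  | wit

/-- Address of a qubit. -/
abbrev QAddr := QReg × ℕ

/-- Right-hand sides of assignments; the arguments are variables. -/
inductive Expr
  | nil
  | var (y : ℕ)
  | cons (y z : ℕ)
  | hd (y : ℕ)
  | tl (y : ℕ)

/-- Programs. `loop x c` repeats `c` while `x` is not `nil`; `ite x c d` runs `c` if `x` is not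
`nil`, and `d` otherwise; `call x c y` runs the subroutine `c` on the argument `y` with fresh
variables, and stores its result in `x`; `meas q x` measures a qubit in the computational basis
and stores the outcome in `x`. In `gate` and `meas` a qubit is given by its register and the
variable that holds its index. -/
inductive Cmd
  | assign (x : ℕ) (e : Expr)
  | seq (c d : Cmd)
  | ite (x : ℕ) (c d : Cmd)
  | loop (x : ℕ) (c : Cmd)
  | call (x : ℕ) (c : Cmd) (y : ℕ)
  | gate (g : Gate (QReg × ℕ))
  | meas (q : QReg × ℕ) (x : ℕ)

abbrev Store := ℕ → Data

/-- Variable `0` holds the input, all other variables are empty. -/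
def initStore (d : Data) : Store := Function.update (fun _ => Data.nil) 0 d

def Expr.eval (σ : Store) : Expr → Data
  | .nil => .nil
  | .var y => σ y
  | .cons y z => .cons (σ y) (σ z)
  | .hd y => (σ y).hd
  | .tl y => (σ y).tl

/-- Elementary actions on qubits: a gate, or a measurement with the given outcome. -/
inductive QOp
  | gate (g : Gate QAddr)
  | proj (q : QAddr) (b : Bool)

/-- The end of one branch of an execution: final variables, the actions that were performed on
the qubits (in order of time), and the number of steps. -/
structure Branch where
  store : Store
  trace : List QOp
  time : ℕ

/-- `b` followed by `b'`. -/
def Branch.andThen (b b' : Branch) : Branch := ⟨b'.store, b.trace ++ b'.trace, b.time + b'.time⟩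

def Branch.tick (b : Branch) : Branch := ⟨b.store, b.trace, b.time + 1⟩

def qaddr (σ : Store) (q : QReg × ℕ) : QAddr := (q.1, (σ q.2).len)

/-- `Exec c σ bs`: every branch of the execution of `c` from `σ` halts, and `bs` is the list of
all branches. An execution branches at measurements only. -/
inductive Exec : Cmd → Store → List Branch → Prop
  | assign (x : ℕ) (e : Expr) (σ : Store) :
      Exec (.assign x e) σ [⟨Function.update σ x (e.eval σ), [], 1 + (e.eval σ).size⟩]
  | gate (g : Gate (QReg × ℕ)) (σ : Store) :
      Exec (.gate g) σ [⟨σ, [.gate (g.map (qaddr σ))], 1⟩]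
  | meas (q : QReg × ℕ) (x : ℕ) (σ : Store) :
      Exec (.meas q x) σ
        [⟨Function.update σ x (enc false), [.proj (qaddr σ q) false], 1⟩,
         ⟨Function.update σ x (enc true), [.proj (qaddr σ q) true], 1⟩]
  | seq (c d : Cmd) (σ : Store) (bs : List Branch) (f : Branch → List Branch) :
      Exec c σ bs → (∀ b ∈ bs, Exec d b.store (f b)) →
      Exec (.seq c d) σ (bs.flatMap fun b => (f b).map b.andThen)
  | iteTrue (x : ℕ) (c d : Cmd) (σ : Store) (bs : List Branch) :
      σ x ≠ .nil → Exec c σ bs → Exec (.ite x c d) σ (bs.map Branch.tick)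
  | iteFalse (x : ℕ) (c d : Cmd) (σ : Store) (bs : List Branch) :
      σ x = .nil → Exec d σ bs → Exec (.ite x c d) σ (bs.map Branch.tick)
  | loopDone (x : ℕ) (c : Cmd) (σ : Store) :
      σ x = .nil → Exec (.loop x c) σ [⟨σ, [], 1⟩]
  | loopStep (x : ℕ) (c : Cmd) (σ : Store) (bs : List Branch) :
      σ x ≠ .nil → Exec (.seq c (.loop x c)) σ bs → Exec (.loop x c) σ (bs.map Branch.tick)
  | call (x : ℕ) (c : Cmd) (y : ℕ) (σ : Store) (bs : List Branch) :
      Exec c (initStore (σ y)) bs →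
      Exec (.call x c y) σ (bs.map fun b =>
        ⟨Function.update σ x (b.store 0), b.trace,
          b.time + 1 + (σ y).size + (b.store 0).size⟩)

/-- `f` is computable on `s` by a deterministic classical program (one branch, no action on
qubits) in time polynomial in the size of the input. -/
def PolyTimeOn {α : Type} [ToData α] (s : Set α) (f : α → Data) : Prop :=
  ∃ (c : Cmd) (p : Polynomial ℕ), ∀ a ∈ s, ∃ (σ : Store) (t : ℕ),
    Exec c (initStore (enc a)) [⟨σ, [], t⟩] ∧ σ 0 = f a ∧ t ≤ p.eval (enc a).size

/-! ### Qubits, operations, circuits -/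

noncomputable section

/-- Operators from the qubits `ι` to the qubits `κ`, in the computational basis. -/
abbrev Op (κ ι : Type) := Matrix (κ → Bool) (ι → Bool) ℂ

def IsDensity {ι : Type} [Fintype ι] [DecidableEq ι] (ρ : Op ι ι) : Prop :=
  ρ.PosSemidef ∧ ρ.trace = 1

/-- The single-qubit operator `u` on qubit `i`. -/
def onQubit {ι : Type} [Fintype ι] [DecidableEq ι] (u : Matrix Bool Bool ℂ) (i : ι) : Op ι ι :=
  Matrix.of fun y y' => if ∀ k, k ≠ i → y k = y' k then u (y i) (y' i) else 0

/-- The unitary of a gate. The degenerate `CX i i` does nothing. -/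
def Gate.mat {ι : Type} [Fintype ι] [DecidableEq ι] : Gate ι → Op ι ι
  | .H i => onQubit (Matrix.of fun a b => (if a && b then -1 else 1) / (Real.sqrt 2 : ℂ)) i
  | .S i => onQubit (Matrix.diagonal fun a => if a then Complex.I else 1) i
  | .T i => onQubit (Matrix.diagonal fun a =>
      if a then Complex.exp (Real.pi / 4 * Complex.I) else 1) i
  | .CX i j => if i = j then 1 else
      Matrix.of fun y y' => if y = Function.update y' j (xor (y' j) (y' i)) then 1 else 0

/-- The unitary of a sequence of gates, the first gate of the list being applied first. -/
def gatesMat {ι : Type} [Fintype ι] [DecidableEq ι] (gs : List (Gate ι)) : Op ι ι :=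
  gs.foldl (fun U g => g.mat * U) 1

/-- Reduced state on the qubits `f 0, f 1, …` (all other qubits are traced out). -/
def reduce {ι : Type} [Fintype ι] [DecidableEq ι] {k : ℕ} (f : Fin k → ι) (M : Op ι ι) :
    Op (Fin k) (Fin k) := Matrix.of fun a a' =>
  ∑ y : ι → Bool, ∑ y' : ι → Bool,
    if y ∘ f = a ∧ y' ∘ f = a' ∧ ∀ i, i ∉ Set.range f → y i = y' i then M y y' else 0

/-- Quantum operations (completely positive and trace preserving), in Kraus form. -/
structure Channel (ι κ : Type) [Fintype ι] [Fintype κ] [DecidableEq ι] [DecidableEq κ] where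
  num : ℕ
  K : Fin num → Op κ ι
  tp : ∑ a, (K a)ᴴ * K a = 1

def Channel.apply {ι κ : Type} [Fintype ι] [Fintype κ] [DecidableEq ι] [DecidableEq κ]
    (Φ : Channel ι κ) (ρ : Op ι ι) : Op κ κ :=
  ∑ a, Φ.K a * ρ * (Φ.K a)ᴴ

/-- A general quantum circuit with `qin` quantum inputs, `cin` classical inputs and `anc` zero
qubits, on wires numbered in this order. At the end the wires in the list `out` are output and
all others are discarded. -/
structure QCircuit where
  qin : ℕ
  cin : ℕ
  anc : ℕ
  gates : List (Gate (Fin (qin + cin + anc)))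
  out : List (Fin (qin + cin + anc))

structure QCircuit.WF (F : QCircuit) : Prop where
  gates : ∀ g ∈ F.gates, g.WF
  out : F.out.Nodup

instance : ToData QCircuit := ⟨fun F => enc (F.qin, F.cin, F.anc, F.gates, F.out)⟩

/-- The isometry that adjoins the classical input `c` and the zero qubits. -/
def QCircuit.inputIso (F : QCircuit) (c : Fin F.cin → Bool) :
    Op (Fin (F.qin + F.cin + F.anc)) (Fin F.qin) := Matrix.of fun y z =>
  if y = Fin.append (Fin.append z c) (fun _ => false) then 1 else 0

/-- The operation computed by the circuit on quantum input `ρ` and classical input `c`. -/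
def QCircuit.eval (F : QCircuit) (c : Fin F.cin → Bool) (ρ : Op (Fin F.qin) (Fin F.qin)) :
    Op (Fin F.out.length) (Fin F.out.length) :=
  reduce F.out.get
    (gatesMat F.gates * (F.inputIso c * ρ * (F.inputIso c)ᴴ) * (gatesMat F.gates)ᴴ)

/-! ### Building blocks -/

/-- `μ` vanishes faster than every inverse polynomial. -/
def Negligible (μ : ℕ → ℝ) : Prop :=
  Asymptotics.SuperpolynomialDecay Filter.atTop (fun n : ℕ => (n : ℝ)) μ

/-- The string `x` as the classical input of a circuit with `k` classical inputs. -/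
def strInput (x : List Bool) (k : ℕ) : Fin k → Bool := fun i => x.getD i false

/-- The probability that a measurement of the output of `F` yields (all) ones. -/
def QCircuit.acceptProb (F : QCircuit) (x : List Bool) (w : Op (Fin F.qin) (Fin F.qin)) : ℝ :=
  (F.eval (strInput x F.cin) w (fun _ => true) (fun _ => true)).re

/-- A `QMA` promise problem with a uniform family of polynomial-size verification circuits
whose error is negligible. The circuit `circ n` takes an instance of `n` bits and a quantum
witness of `(circ n).qin` qubits, and outputs one qubit. -/
structure QMAProblem where
  yes : Set (List Bool)
  no : Set (List Bool)
  disj : Disjoint yes no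
  circ : ℕ → QCircuit
  wf : ∀ n, (circ n).WF
  cin_eq : ∀ n, (circ n).cin = n
  out_one : ∀ n, (circ n).out.length = 1
  uniform : PolyTimeOn Set.univ fun n : ℕ => enc (circ n)
  err : ℕ → ℝ
  err_negl : Negligible err
  complete : ∀ x ∈ yes, ∃ w, IsDensity w ∧ 1 - err x.length ≤ (circ x.length).acceptProb x w
  sound : ∀ x ∈ no, ∀ w, IsDensity w → (circ x.length).acceptProb x w ≤ err x.length

/-- Witness length. -/
abbrev QMAProblem.m (L : QMAProblem) (n : ℕ) : ℕ := (L.circ n).qin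

/-- The good witnesses for `x`. -/
def QMAProblem.witnesses (L : QMAProblem) (x : List Bool) :
    Set (Op (Fin (L.m x.length)) (Fin (L.m x.length))) :=
  {w | IsDensity w ∧ 1 - L.err x.length ≤ (L.circ x.length).acceptProb x w}

/-- `(z, 0)`: the basis state `z` followed by zeroes, on `N` qubits. -/
def padZero {q : ℕ} (N : ℕ) (z : Fin q → Bool) : Fin N → Bool :=
  fun j => if h : (j : ℕ) < q then z ⟨j, h⟩ else false

/-- `(y, (lab_{i,b})_{i,b}, 0)` on `N` qubits; the labels come in the order
`lab_{0,0}, lab_{0,1}, lab_{1,0}, …`. -/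
def withLabels {k₀ k κ : ℕ} (N : ℕ) (y : Fin k₀ → Bool) (lab : Fin k → Bool → Fin κ → Bool) :
    Fin N → Bool :=
  fun j => if h : (j : ℕ) < k₀ then y ⟨j, h⟩ else
    (List.ofFn fun i => List.ofFn (lab i false) ++ List.ofFn (lab i true)).flatten.getD
      (j - k₀) false

/-- The isometry `y ↦ (y, labels, 0)`. -/
def labelIso {k₀ k κ : ℕ} (N : ℕ) (lab : Fin k → Bool → Fin κ → Bool) :
    Op (Fin N) (Fin k₀) := Matrix.of fun y y₀ => if y = withLabels N y₀ lab then 1 else 0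

/-- The isometry `z ↦ (z, 0)`. -/
def zeroIso (q N : ℕ) : Op (Fin N) (Fin q) :=
  Matrix.of fun y z => if y = padZero N z then 1 else 0

/-- A quantum randomized encoding scheme for circuits `F` with quantum input `q` and classical
input `c`, at security parameter `sec`. The encoder is given by unitary circuits `U`, one for
each random string `r`, with
`U_r (q, 0) = (F̂₀, (lab_{i,b}(r))_{i,b}, 0)`,
such that `(F̂₀, (lab_{i,c_i}(r))_i)` is the encoding of `F(q, c)`.
Efficiency of the encoder and perfect correctness of the decoder are required. Privacy is not:
what is said below about such schemes holds for the private ones in particular. The decoder may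
depend on all of `F`, in particular on its topology only. -/
structure QREScheme where
  /-- number of random bits -/
  rlen : ℕ → QCircuit → ℕ
  /-- number of qubits of `F̂₀` -/
  hatLen : ℕ → QCircuit → ℕ
  /-- length of the labels -/
  labLen : ℕ → QCircuit → ℕ
  /-- number of qubits of `U_r` -/
  width : ℕ → QCircuit → ℕ
  U : (sec : ℕ) → (F : QCircuit) → List Bool → List (Gate (Fin (width sec F)))
  lab : (sec : ℕ) → (F : QCircuit) → List Bool →
    Fin F.cin → Bool → Fin (labLen sec F) → Bool
  /-- the decoder, on given labels -/
  dec : (sec : ℕ) → (F : QCircuit) → (Fin F.cin → Fin (labLen sec F) → Bool) →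
    Channel (Fin (hatLen sec F)) (Fin F.out.length)
  width_in : ∀ sec F, F.WF → F.qin ≤ width sec F
  width_out : ∀ sec F, F.WF → hatLen sec F + 2 * F.cin * labLen sec F ≤ width sec F
  params_polyTime : PolyTimeOn {a : ℕ × QCircuit | a.2.WF} fun a =>
    enc (rlen a.1 a.2, hatLen a.1 a.2, labLen a.1 a.2, width a.1 a.2)
  U_polyTime : PolyTimeOn
    {a : ℕ × QCircuit × List Bool | a.2.1.WF ∧ a.2.2.length = rlen a.1 a.2.1} fun a =>
      enc (U a.1 a.2.1 a.2.2)
  /-- On input `(q, 0)` the output consists of `F̂₀`, the labels, and zeroes. -/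
  structured : ∀ sec F, F.WF → ∀ r : List Bool, r.length = rlen sec F →
    ∀ (z : Fin F.qin → Bool) (y : Fin (width sec F) → Bool),
      gatesMat (U sec F r) y (padZero (width sec F) z) ≠ 0 →
      ∃ y₀ : Fin (hatLen sec F) → Bool, y = withLabels (width sec F) y₀ (lab sec F r)
  /-- Perfect correctness. This is an identity of linear maps, so it also holds in the presence
  of quantum side information. -/
  correct : ∀ sec F, F.WF → ∀ r : List Bool, r.length = rlen sec F →
    ∀ (c : Fin F.cin → Bool) (q : Op (Fin F.qin) (Fin F.qin)),
      let V : Op (Fin (hatLen sec F)) (Fin F.qin) :=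
        (labelIso (width sec F) (lab sec F r))ᴴ * gatesMat (U sec F r) *
          zeroIso F.qin (width sec F)
      (dec sec F fun i => lab sec F r i (c i)).apply (V * q * Vᴴ) = F.eval c q

/-- The operator that maps a quantum input `q` to the quantum part `F̂₀` of the encoding. -/
def QREScheme.hat (Q : QREScheme) (sec : ℕ) (F : QCircuit) (r : List Bool) :
    Op (Fin (Q.hatLen sec F)) (Fin F.qin) :=
  (labelIso (Q.width sec F) (Q.lab sec F r))ᴴ * gatesMat (Q.U sec F r) *
    zeroIso F.qin (Q.width sec F)

/-- The syntax of a non-interactive commitment scheme: a polynomial-time function of the security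
parameter, the message and a random string, whose length depends on the first two (and the length
only of the message). Binding and hiding are not required: what is said below about such schemes
holds for the binding and hiding ones in particular. -/
structure CommitScheme where
  rlen : ℕ → ℕ → ℕ
  com : ℕ → List Bool → List Bool → List Bool
  rlen_polyTime : PolyTimeOn Set.univ fun a : ℕ × ℕ => enc (rlen a.1 a.2)
  com_polyTime : PolyTimeOn
    {a : ℕ × List Bool × List Bool | a.2.2.length = rlen a.1 a.2.1.length} fun a =>
      enc (com a.1 a.2.1 a.2.2)

/-! ### The protocol -/

/-- The renaming of the wires of a circuit `V` that makes room for `2 * V.qin` further classical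
inputs after the classical inputs of `V`. -/
def shiftWire (V : QCircuit) (i : Fin (V.qin + V.cin + V.anc)) :
    Fin (V.qin + (V.cin + 2 * V.qin) + V.anc) :=
  if (i : ℕ) < V.qin + V.cin then ⟨i, by omega⟩ else ⟨i + 2 * V.qin, by omega⟩

/-- The circuit that takes classical inputs `x, u, v` and a quantum input `w`, applies
`Z ^ v i` and then `X ^ u i` to each qubit `i` of `w`, and runs `V` on `x` and the result. -/
def padCircuit (V : QCircuit) : QCircuit where
  qin := V.qin
  cin := V.cin + 2 * V.qin
  anc := V.anc
  gates :=
    ((List.finRange V.qin).flatMap fun (i : Fin V.qin) =>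
      let w : Fin (V.qin + (V.cin + 2 * V.qin) + V.anc) := ⟨i, by have := i.2; omega⟩
      let u : Fin (V.qin + (V.cin + 2 * V.qin) + V.anc) := 
        ⟨V.qin + V.cin + i, by have := i.2; omega⟩
      let v : Fin (V.qin + (V.cin + 2 * V.qin) + V.anc) := 
        ⟨V.qin + V.cin + V.qin + i, by have := i.2; omega⟩
      [Gate.H w, Gate.CX v w, Gate.H w, Gate.CX u w]) ++
    V.gates.map (Gate.map (shiftWire V))
  out := V.out.map (shiftWire V)

section Protocol

/-- The circuit that is encoded in the protocol for instances of length `n`. -/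
abbrev protF (L : QMAProblem) (n : ℕ) : QCircuit := padCircuit (L.circ n)

/-- The random strings of the prover: `r`, `s₀`, and `s_{i,b}`. -/
abbrev Coins (L : QMAProblem) (Q : QREScheme) (C : CommitScheme) (n : ℕ) : Type :=
  (Fin (Q.rlen n (protF L n)) → Bool) ×
  (Fin (C.rlen n (Q.rlen n (protF L n))) → Bool) ×
  (Fin (protF L n).cin → Bool → Fin (C.rlen n (Q.labLen n (protF L n))) → Bool)

/-- The classical part of the first message: commitments `c₀` and `c_{i,b}`. -/
abbrev FirstMsg (L : QMAProblem) (n : ℕ) : Type :=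
  List Bool × (Fin (protF L n).cin → Bool → List Bool)

/-- The third message. `openAll` opens all commitments, with `r`, `s₀`, `lab_{i,b}`, `s_{i,b}`;
`openSome` opens those selected by `z`, with `z_i`, `lab_{i,z_i}`, `s_{i,z_i}`. -/
inductive Response (L : QMAProblem) (Q : QREScheme) (n : ℕ)
  | openAll (r : Fin (Q.rlen n (protF L n)) → Bool) (s₀ : List Bool)
      (lab : Fin (protF L n).cin → Bool → Fin (Q.labLen n (protF L n)) → Bool)
      (s : Fin (protF L n).cin → Bool → List Bool)
  | openSome (z : Fin (protF L n).cin → Bool)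
      (lab : Fin (protF L n).cin → Fin (Q.labLen n (protF L n)) → Bool)
      (s : Fin (protF L n).cin → List Bool)

instance (L : QMAProblem) (Q : QREScheme) (n : ℕ) : ToData (Response L Q n) := ⟨fun a =>
  match a with
  | .openAll r s₀ lab s => enc ((r, s₀), fun i b => (lab i b, s i b))
  | .openSome z lab s => enc fun i => (z i, lab i, s i)⟩

/-- The concatenation `z = (x, u, v)`. -/
def concatInput (L : QMAProblem) (n : ℕ) (x : List Bool) (u v : Fin (L.m n) → Bool) :
    Fin (protF L n).cin → Bool :=
  strInput (x ++ List.ofFn u ++ List.ofFn v) _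

/-- The commitments that the prover sends. -/
def firstMsg (L : QMAProblem) (Q : QREScheme) (C : CommitScheme) (n : ℕ)
    (ω : Coins L Q C n) : FirstMsg L n :=
  (C.com n (List.ofFn ω.1) (List.ofFn ω.2.1),
   fun i b => C.com n (List.ofFn (Q.lab n (protF L n) (List.ofFn ω.1) i b))
     (List.ofFn (ω.2.2 i b)))

/-- The joint state of the first halves `e₁` of the EPR pairs and of `F̂₀`, after the encoder
has been applied to the second halves: `2 ^ (-m/2) ∑_e |e⟩ ⊗ F̂₀|e⟩`, in coordinates. -/
def sharedState (L : QMAProblem) (Q : QREScheme) (n : ℕ)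
    (r : Fin (Q.rlen n (protF L n)) → Bool) (e : Fin (L.m n) → Bool)
    (y : Fin (Q.hatLen n (protF L n)) → Bool) : ℂ :=
  (Real.sqrt (2 ^ L.m n) : ℂ)⁻¹ * Q.hat n (protF L n) (List.ofFn r) y e

/-- Coordinates of the Bell basis of two registers of `m` qubits, the state with outcome `(u, v)`
being `2 ^ (-m/2) ∑_a (-1) ^ (v ⬝ a) |a⟩ ⊗ |a ⊕ u⟩`. -/
def bell {m : ℕ} (u v a e : Fin m → Bool) : ℂ :=
  (Real.sqrt (2 ^ m) : ℂ)⁻¹ *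
    if e = (fun i => xor (a i) (u i)) then ∏ i, (if v i && a i then -1 else 1) else 0

/-- The operator on `F̂₀` of the teleportation of a witness into `e₁`, with outcome `(u, v)`:
the projection of witness and `e₁` to the Bell state, as a map from the witness to `F̂₀`. -/
def teleport (L : QMAProblem) (Q : QREScheme) (n : ℕ)
    (r : Fin (Q.rlen n (protF L n)) → Bool) (u v : Fin (L.m n) → Bool) :
    Op (Fin (Q.hatLen n (protF L n))) (Fin (L.m n)) :=
  Matrix.of fun y a => ∑ e, (starRingEnd ℂ) (bell u v a e) * sharedState L Q n r e y

/-- A possible transcript without the challenge: the classical part of the first message, the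
third message, and the state of `F̂₀`, multiplied by the probability. -/
abbrev Transcript (L : QMAProblem) (Q : QREScheme) (n : ℕ) : Type :=
  FirstMsg L n × Response L Q n ×
    Op (Fin (Q.hatLen n (protF L n))) (Fin (Q.hatLen n (protF L n)))

/-- The honest prover on `x`, `w` and challenge `ch` (`false` stands for `0`): all possible
transcripts, with multiplicity. -/
def honest (L : QMAProblem) (Q : QREScheme) (C : CommitScheme) (x : List Bool)
    (w : Op (Fin (L.m x.length)) (Fin (L.m x.length))) :
    Bool → Multiset (Transcript L Q x.length)
  | false => (Finset.univ : Finset (Coins L Q C x.length)).val.map fun ω =>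
      (firstMsg L Q C _ ω,
       .openAll ω.1 (List.ofFn ω.2.1) (Q.lab _ _ (List.ofFn ω.1))
         (fun i b => List.ofFn (ω.2.2 i b)),
       (Fintype.card (Coins L Q C x.length) : ℂ)⁻¹ • Matrix.of fun y y' =>
         ∑ e, sharedState L Q _ ω.1 e y * (starRingEnd ℂ) (sharedState L Q _ ω.1 e y'))
  | true => (Finset.univ : Finset (Coins L Q C x.length ×
        (Fin (L.m x.length) → Bool) × (Fin (L.m x.length) → Bool))).val.map fun ωuv =>
      let ω := ωuv.1
      let z := concatInput L x.length x ωuv.2.1 ωuv.2.2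
      let K := teleport L Q x.length ω.1 ωuv.2.1 ωuv.2.2
      (firstMsg L Q C _ ω,
       .openSome z (fun i => Q.lab _ _ (List.ofFn ω.1) i (z i))
         (fun i => List.ofFn (ω.2.2 i (z i))),
       (Fintype.card (Coins L Q C x.length) : ℂ)⁻¹ • (K * w * Kᴴ))

open Classical in
/-- The verifier: probability of acceptance on a given transcript. -/
def verify (L : QMAProblem) (Q : QREScheme) (C : CommitScheme) (x : List Bool) (ch : Bool)
    (t : Transcript L Q x.length) : ℝ :=
  let n := x.length
  let F := protF L n
  match ch, t with
  | false, (c, .openAll r s₀ lab s, ρ) =>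
      if C.com n (List.ofFn r) s₀ = c.1 ∧
          ∀ i b, C.com n (List.ofFn (lab i b)) (s i b) = c.2 i b then
        -- apply the inverse of `U_r` to `F̂₀`, the labels and zeroes; project on zero ancillas
        let U := gatesMat (Q.U n F (List.ofFn r))
        let E : Op (Fin (Q.width n F)) (Fin (Q.hatLen n F)) := labelIso (Q.width n F) lab
        let A := (zeroIso F.qin (Q.width n F))ᴴ * Uᴴ * E
        (A * ρ * Aᴴ).trace.re
      else 0
  | true, (c, .openSome z lab s, ρ) =>
      if (∃ u v, z = concatInput L n x u v) ∧
          ∀ i, C.com n (List.ofFn (lab i)) (s i) = c.2 i (z i) then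
        ((Q.dec n F lab).apply ρ (fun _ => true) (fun _ => true)).re
      else 0
  | _, _ => 0

/-- The probability that the verifier accepts the honest prover, for a uniform challenge. -/
def acceptProb (L : QMAProblem) (Q : QREScheme) (C : CommitScheme) (x : List Bool)
    (w : Op (Fin (L.m x.length)) (Fin (L.m x.length))) : ℝ :=
  (((honest L Q C x w false).map (verify L Q C x false)).sum +
    ((honest L Q C x w true).map (verify L Q C x true)).sum) / 2

/-! ### Provers as programs -/

/-- A prover as a quantum program. `first` gets the instance length `n` in unary and computes the
first message; `second` continues with the variables and qubits of `first`, on the challenge and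
the instance in variable `0` and the witness in the register `wit`, and computes the third message.
Classical messages are returned in variable `0`. The memory consists of the qubits of the first
message, followed by `priv n` private qubits; all of them are initially zero. -/
structure Prover where
  first : Cmd
  second : Cmd
  priv : ℕ → ℕ

/-- Qubits: of the first message, private, and of the witness. -/
abbrev Qubits (k₀ p m : ℕ) : Type := Fin k₀ ⊕ Fin p ⊕ Fin m

/-- Addresses that the first program may use: message and private qubits. -/
def addrFirst (k₀ p m : ℕ) : QAddr → Option (Qubits k₀ p m)
  | (.mem, i) => if h : i < k₀ then some (.inl ⟨i, h⟩)
      else if h' : i - k₀ < p then some (.inr (.inl ⟨i - k₀, h'⟩)) else none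
  | (.wit, _) => none

/-- Addresses that the second program may use: private qubits and the witness. -/
def addrSecond (k₀ p m : ℕ) : QAddr → Option (Qubits k₀ p m)
  | (.mem, i) => if i < k₀ then none
      else if h' : i - k₀ < p then some (.inr (.inl ⟨i - k₀, h'⟩)) else none
  | (.wit, i) => if h : i < m then some (.inr (.inr ⟨i, h⟩)) else none

def Gate.resolve {α ι : Type} (a : α → Option ι) : Gate α → Option (Gate ι)
  | .H i => (a i).map .H
  | .S i => (a i).map .S
  | .T i => (a i).map .T
  | .CX i j => (a i).bind fun i' => (a j).map fun j' => .CX i' j'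

/-- The operator of an action. An action on a forbidden address is an error, which destroys the
state (such a program loses probability). -/
def QOp.mat {ι : Type} [Fintype ι] [DecidableEq ι] (a : QAddr → Option ι) : QOp → Op ι ι
  | .gate g => match g.resolve a with
    | some g' => g'.mat
    | none => 0
  | .proj q b => match a q with
    | some i => Matrix.diagonal fun y => if y i = b then 1 else 0
    | none => 0

def traceMat {ι : Type} [Fintype ι] [DecidableEq ι] (a : QAddr → Option ι) (l : List QOp) :
    Op ι ι :=
  l.foldl (fun M o => o.mat a * M) 1

/-- The isometry that adjoins zero memory qubits to the witness. -/
def startIso (k₀ p m : ℕ) : Op (Qubits k₀ p m) (Fin m) := Matrix.of fun y z =>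
  if (∀ i, y (.inl i) = false) ∧ (∀ i, y (.inr (.inl i)) = false) ∧
    (∀ i, y (.inr (.inr i)) = z i) then 1 else 0

/-- The state of the message qubits, multiplied by the probability, at the end of the branch
`b₁` of the first and `b₂` of the second program. -/
def branchState (k₀ p : ℕ) {m : ℕ} (w : Op (Fin m) (Fin m)) (b₁ b₂ : Branch) :
    Op (Fin k₀) (Fin k₀) :=
  let K : Op (Qubits k₀ p m) (Fin m) :=
    traceMat (addrSecond k₀ p m) b₂.trace * traceMat (addrFirst k₀ p m) b₁.trace *
      startIso k₀ p m
  reduce (fun i => .inl i) (K * w * Kᴴ)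

open Classical in
/-- The prover program `P`, on common input `x` and witness `w`, makes at most `T` steps in every
branch, and acts exactly as the honest prover: for each challenge `ch`, the joint state of its
classical messages (`d₁` and `d₂`) and of the quantum part of its first message is the one of
the honest prover. -/
def Prover.IsHonestInTime (P : Prover) (L : QMAProblem) (Q : QREScheme) (C : CommitScheme)
    (T : ℕ) (x : List Bool) (w : Op (Fin (L.m x.length)) (Fin (L.m x.length))) : Prop :=
  ∀ ch : Bool, ∃ (bs : List Branch) (f : Branch → List Branch),
    Exec P.first (initStore (enc x.length)) bs ∧
    (∀ b₁ ∈ bs, Exec P.second (Function.update b₁.store 0 (enc (ch, x))) (f b₁)) ∧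
    (∀ b₁ ∈ bs, ∀ b₂ ∈ f b₁, b₁.time + b₂.time ≤ T) ∧
    ∀ d₁ d₂ : Data,
      (bs.map fun b₁ => ((f b₁).map fun b₂ =>
        if b₁.store 0 = d₁ ∧ b₂.store 0 = d₂ then
          branchState (Q.hatLen x.length (protF L x.length)) (P.priv x.length) w b₁ b₂
        else 0).sum).sum =
      ((honest L Q C x w ch).map fun t =>
        if enc t.1 = d₁ ∧ enc t.2.1 = d₂ then t.2.2 else 0).sum

end Protocol

end

end ZKQMA

namespace ZKQMA
open ToData (enc)

/-! ### Executions -/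

/-! The honest prover is accepted with probability exactly `(1 + a) / 2`, where `a` is the
probability that the verification circuit accepts the witness (`acceptProb_eq`). Half of the error
of the problem is therefore a suitable `μ`.

On challenge 0 the verifier undoes a unitary. By `structured`, `U_r` maps `(q, 0)` to `F̂₀`, fixed
labels and zeroes, so adjoining the labels to `F̂₀` recovers the whole output (`labelOp_mul_hatOp`),
and the inverse of `U_r` returns the ancillas to zero with certainty (`decode_sharedState`). On
challenge 1, projecting the witness and `e₁` to the Bell state `(u, v)` acts as `2^(-m)` times the
encoder after `X^u Z^v` (`teleport_eq`). Perfect correctness turns the decoder into the padded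
circuit on the encrypted witness, and the Pauli gates of that circuit cancel the pad up to the sign
`(-1)^(u·v)`, which disappears from a density matrix (`padCircuit_eval`). The `4^m` outcomes enter
with equal weights that sum to one.

Most of the work shows that this prover is a program. An execution is abstracted to the list of its
branches, each with a value and a trace of qubit actions (`Eff`, `Runs`). Polynomial time is handled
by the calculus `Computes`, closed under composition, case distinction and folds whose accumulator
stays polynomially bounded. Coins come from Hadamard gates and measurements on one scratch qubit
that is reset each time. The labels are obtained by measuring the label wires, which needs only the
gates of `U_r`; a wrong reading has amplitude zero.

For the quantum state, each block of actions is evaluated on state vectors that start from a basis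
state of the witness. Every coin contributes the scalar `1/√2`, the EPR pairs feed the encoder with
the identity (`actOn_eprVec`), and the Bell measurement reproduces the teleportation operator
(`bellTrace_mulVec`). Tracing out everything except `F̂₀` gives the weighted states of the honest
transcripts (`reduce_openAll`, `reduce_openSome`), and summing over branches gives
`exists_isHonestInTime`. -/

theorem Data.one_le_size (d : Data) : 1 ≤ d.size := by
  cases d <;> simp [Data.size]

theorem Data.hd_size_le (d : Data) : d.hd.size ≤ d.size := by
  cases d <;> simp [Data.size, Data.hd]; omega

theorem Data.tl_size_le (d : Data) : d.tl.size ≤ d.size := by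
  cases d <;> simp [Data.size, Data.tl]; omega

theorem initStore_zero (d : Data) : initStore d 0 = d := by simp [initStore]

theorem initStore_of_ne (d : Data) {i : ℕ} (h : i ≠ 0) : initStore d i = Data.nil := by
  simp [initStore, h]

/-- The values held by the variables grow at most linearly with the running time. -/
theorem Exec.size_le {c : Cmd} {σ : Store} {bs : List Branch} (h : Exec c σ bs) :
    ∀ M, (∀ y, (σ y).size ≤ M) → ∀ b ∈ bs, ∀ x, (b.store x).size ≤ M + 3 * b.time := by
  induction h with
  | assign x e σ =>
    intro M hM b hb y
    simp only [List.mem_singleton] at hb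
    subst hb
    by_cases hy : y = x
    · subst hy; simp; omega
    · simp only [Function.update_of_ne hy]; have := hM y; omega
  | gate g σ =>
    intro M hM b hb y
    simp only [List.mem_singleton] at hb
    subst hb
    have := hM y
    simp only; omega
  -- The outcome `true` has size 3 and is written in a single step; this is the source of the factor
  -- 3.
  | meas q x σ =>
    intro M hM b hb y
    simp only [List.mem_cons, List.not_mem_nil, or_false] at hb
    rcases hb with rfl | rfl <;>
    · by_cases hy : y = x
      · subst hy; simp [enc, Data.size]
      · simp only [Function.update_of_ne hy]; have := hM y; omega
  | seq c d σ bs f _ _ ih₁ ih₂ =>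
    intro M hM b hb y
    simp only [List.mem_flatMap, List.mem_map] at hb
    obtain ⟨b₁, hb₁, b₂, hb₂, rfl⟩ := hb
    have := ih₂ b₁ hb₁ _ (ih₁ M hM b₁ hb₁) b₂ hb₂ y
    simp only [Branch.andThen]; omega
  | iteTrue x c d σ bs _ _ ih =>
    intro M hM b hb y
    simp only [List.mem_map] at hb
    obtain ⟨b₁, hb₁, rfl⟩ := hb
    have := ih M hM b₁ hb₁ y
    simp only [Branch.tick]; omega
  | iteFalse x c d σ bs _ _ ih =>
    intro M hM b hb y
    simp only [List.mem_map] at hb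
    obtain ⟨b₁, hb₁, rfl⟩ := hb
    have := ih M hM b₁ hb₁ y
    simp only [Branch.tick]; omega
  | loopDone x c σ _ =>
    intro M hM b hb y
    simp only [List.mem_singleton] at hb
    subst hb
    have := hM y
    simp only; omega
  | loopStep x c σ bs _ _ ih =>
    intro M hM b hb y
    simp only [List.mem_map] at hb
    obtain ⟨b₁, hb₁, rfl⟩ := hb
    have := ih M hM b₁ hb₁ y
    simp only [Branch.tick]; omega
  | call x c y σ bs _ _ =>
    intro M hM b hb z
    simp only [List.mem_map] at hb
    obtain ⟨b₁, hb₁, rfl⟩ := hb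
    by_cases hz : z = x
    · subst hz; simp; omega
    · simp only [Function.update_of_ne hz]; have := hM z; omega

/-- Executions are unique. -/
theorem Exec.unique {c : Cmd} {σ : Store} {bs bs' : List Branch} (h : Exec c σ bs)
    (h' : Exec c σ bs') : bs = bs' := by
  induction h generalizing bs' with
  | assign x e σ => cases h'; rfl
  | gate g σ => cases h'; rfl
  | meas q x σ => cases h'; rfl
  | seq c d σ bs f _ _ ih₁ ih₂ =>
    cases h' with
    | seq _ _ _ bs₁ f₁ h₁ h₂ =>
      obtain rfl := ih₁ h₁
      simp only [List.flatMap]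
      congr 1
      apply List.map_congr_left
      intro b hb
      rw [ih₂ b hb (h₂ b hb)]
  | iteTrue x c d σ bs hx _ ih =>
    cases h' with
    | iteTrue _ _ _ _ _ _ h₁ => rw [ih h₁]
    | iteFalse _ _ _ _ _ hx' _ => exact absurd hx' hx
  | iteFalse x c d σ bs hx _ ih =>
    cases h' with
    | iteTrue _ _ _ _ _ hx' _ => exact absurd hx hx'
    | iteFalse _ _ _ _ _ _ h₁ => rw [ih h₁]
  | loopDone x c σ hx =>
    cases h' with
    | loopDone => rfl
    | loopStep _ _ _ _ hx' => exact absurd hx hx'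
  | loopStep x c σ bs hx _ ih =>
    cases h' with
    | loopDone _ _ _ hx' => exact absurd hx' hx
    | loopStep _ _ _ _ _ h₁ => rw [ih h₁]
  | call x c y σ bs _ ih =>
    cases h' with
    | call _ _ _ _ _ h₁ => rw [ih h₁]

/-! ### Effects -/

/-- The results of a computation that branches at measurements: the value and the actions on qubits
of each branch. -/
abbrev Eff (β : Type) : Type := List (β × List QOp)

namespace Eff

variable {α β γ δ : Type}

def pure (b : β) : Eff β := [(b, [])]

def bind (l : Eff β) (k : β → Eff γ) : Eff γ :=
  l.flatMap fun o => (k o.1).map fun o' => (o'.1, o.2 ++ o'.2)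

def vmap (f : β → γ) (l : Eff β) : Eff γ := List.map (fun o => (f o.1, o.2)) l

/-- Together with associativity this makes `Eff` a monad, so that a specification can be rearranged
to match the nesting produced by the rules for programs. -/
theorem pure_bind (b : β) (k : β → Eff γ) : bind (pure b) k = k b := by
  simp [bind, pure]

theorem bind_assoc (l : Eff β) (k : β → Eff γ) (k' : γ → Eff δ) :
    bind (bind l k) k' = bind l fun b => bind (k b) k' := by
  simp only [bind, List.flatMap_assoc, List.flatMap_map, List.map_flatMap, List.map_map]
  congr! 5
  simp [Function.comp_def]

theorem vmap_eq_bind (f : β → γ) (l : Eff β) : vmap f l = bind l fun b => pure (f b) := by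
  simp only [vmap, bind, pure, List.map_cons, List.map_nil, List.append_nil]
  induction l <;> simp_all

theorem vmap_bind (f : γ → δ) (l : Eff β) (k : β → Eff γ) :
    vmap f (bind l k) = bind l fun b => vmap f (k b) := by
  simp only [vmap_eq_bind, bind_assoc]

theorem bind_vmap (f : β → γ) (l : Eff β) (k : γ → Eff δ) :
    bind (vmap f l) k = bind l fun b => k (f b) := by
  simp only [vmap_eq_bind, bind_assoc, pure_bind]

theorem vmap_vmap (f : β → γ) (g : γ → δ) (l : Eff β) :
    vmap g (vmap f l) = vmap (fun b => g (f b)) l := by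
  simp [vmap, Function.comp_def]

theorem vmap_pure (f : β → γ) (b : β) : vmap f (pure b) = pure (f b) := rfl

theorem mem_bind {l : Eff β} {k : β → Eff γ} {o : γ × List QOp} :
    o ∈ bind l k ↔ ∃ o₁ ∈ l, ∃ o₂ ∈ k o₁.1, o = (o₂.1, o₁.2 ++ o₂.2) := by
  simp only [bind, List.mem_flatMap, List.mem_map, eq_comm]

theorem mem_pure {b : β} {o : β × List QOp} : o ∈ pure b ↔ o = (b, []) := by
  simp [pure]

theorem mem_vmap {f : β → γ} {l : Eff β} {o : γ × List QOp} :
    o ∈ vmap f l ↔ ∃ o₁ ∈ l, o = (f o₁.1, o₁.2) := by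
  simp only [vmap, List.mem_map, eq_comm]

/-- Thread a state through a list. -/
def fold (step : γ → β → Eff γ) : List β → γ → Eff γ
  | [], z => pure z
  | b :: l, z => bind (step z b) (fold step l)

/-- Run a computation on each element of a list and collect the results. -/
def traverse (f : β → Eff γ) : List β → Eff (List γ)
  | [] => pure []
  | b :: l => bind (f b) fun c => vmap (c :: ·) (traverse f l)

/-- A loop can only extend its accumulator at the front, hence the reversal. This is how `traverse`
is implemented by a program. -/
theorem fold_cons_eq_traverse (f : β → Eff γ) (l : List β) (acc : List γ) :
    fold (fun acc b => vmap (· :: acc) (f b)) l acc =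
      vmap (fun cs => cs.reverse ++ acc) (traverse f l) := by
  induction l generalizing acc with
  | nil => simp [fold, traverse, pure, vmap]
  | cons b l ih =>
    simp only [fold, traverse, bind_vmap, vmap_bind, ih, vmap_vmap]
    simp

theorem fold_pure (step : γ → β → γ) (l : List β) (z : γ) :
    fold (fun z b => pure (step z b)) l z = pure (l.foldl step z) := by
  induction l generalizing z with
  | nil => rfl
  | cons b l ih => simp [fold, pure_bind, ih]

theorem traverse_pure (f : β → γ) (l : List β) :
    traverse (fun b => pure (f b)) l = pure (l.map f) := by
  induction l with
  | nil => rfl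
  | cons b l ih => simp [traverse, pure_bind, ih, vmap_pure]

theorem length_of_mem_traverse {f : β → Eff γ} {l : List β} {o : List γ × List QOp}
    (h : o ∈ traverse f l) : o.1.length = l.length := by
  induction l generalizing o with
  | nil => simp [traverse, mem_pure] at h; simp [h]
  | cons b l ih =>
    simp only [traverse, mem_bind, mem_vmap] at h
    obtain ⟨o₁, _, o₂, ⟨o₃, h₃, rfl⟩, rfl⟩ := h
    simp [ih h₃]

end Eff

/-! ### Rules for executions -/

section Rules

variable {α β γ δ : Type}

/-- Every branch of the execution of `c` from `σ` halts within `T` steps; the branches are those of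
`out`, up to the view `v` of the final store. -/
def Runs (v : Store → δ) (c : Cmd) (σ : Store) (T : ℕ) (out : Eff δ) : Prop :=
  ∃ bs, Exec c σ bs ∧ bs.map (fun b => (v b.store, b.trace)) = out ∧ ∀ b ∈ bs, b.time ≤ T

theorem Runs.view {v : Store → δ} {c : Cmd} {σ : Store} {T : ℕ} {out : Eff Store}
    (h : Runs id c σ T out) : Runs v c σ T (Eff.vmap v out) := by
  obtain ⟨bs, h₁, rfl, h₃⟩ := h
  exact ⟨bs, h₁, by simp [Eff.vmap], h₃⟩

theorem Runs.mono {v : Store → δ} {c : Cmd} {σ : Store} {T T' : ℕ} {out : Eff δ}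
    (h : Runs v c σ T out) (hT : T ≤ T') : Runs v c σ T' out := by
  obtain ⟨bs, h₁, h₂, h₃⟩ := h
  exact ⟨bs, h₁, h₂, fun b hb => (h₃ b hb).trans hT⟩

theorem Runs.assign (x : ℕ) (e : Expr) (σ : Store) :
    Runs id (.assign x e) σ (1 + (e.eval σ).size)
      (Eff.pure (Function.update σ x (e.eval σ))) :=
  ⟨_, .assign x e σ, by simp [Eff.pure], by simp⟩

theorem Runs.gate (g : Gate (QReg × ℕ)) (σ : Store) :
    Runs id (.gate g) σ 1 [(σ, [.gate (g.map (qaddr σ))])] :=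
  ⟨_, .gate g σ, by simp, by simp⟩

theorem Runs.meas (q : QReg × ℕ) (x : ℕ) (σ : Store) :
    Runs id (.meas q x) σ 1
      [(Function.update σ x (enc false), [.proj (qaddr σ q) false]),
       (Function.update σ x (enc true), [.proj (qaddr σ q) true])] :=
  ⟨_, .meas q x σ, by simp, by simp⟩

/-- The intermediate store is allowed to be a function `g` of an abstract value, so that the
continuation is specified on values and not on stores. -/
theorem Runs.seq {v : Store → δ} {c d : Cmd} {σ : Store} {T T' : ℕ} {out : Eff β}
    {g : β → Store} {k : β → Eff δ} (h : Runs id c σ T (Eff.vmap g out))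
    (h' : ∀ o ∈ out, Runs v d (g o.1) T' (k o.1)) :
    Runs v (.seq c d) σ (T + T') (Eff.bind out k) := by
  classical
  obtain ⟨bs, h₁, h₂, h₃⟩ := h
  -- The rule for sequences wants a function on all branches; outside `bs` its value is immaterial.
  have hl : ∀ b : Branch, ∃ l, b ∈ bs → Exec d b.store l := by
    intro b
    by_cases hb : b ∈ bs
    · have : (b.store, b.trace) ∈ Eff.vmap g out := h₂ ▸ List.mem_map_of_mem hb
      obtain ⟨o, ho, h₄⟩ := Eff.mem_vmap.1 this
      obtain ⟨l, hl, -⟩ := h' o ho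
      simp only [Prod.mk.injEq] at h₄
      exact ⟨l, fun _ => h₄.1 ▸ hl⟩
    · exact ⟨[], fun h => absurd h hb⟩
  choose f hf using hl
  -- Uniqueness of executions identifies the chosen list with the one described by `k`, even if
  -- several values in `out` yield the same store.
  have key : ∀ b ∈ bs, ∀ o ∈ out, b.store = g o.1 →
      (f b).map (fun b => (v b.store, b.trace)) = k o.1 ∧ ∀ b' ∈ f b, b'.time ≤ T' := by
    intro b hb o ho hbo
    obtain ⟨l, hl, h₄⟩ := h' o ho
    obtain rfl := (hf b hb).unique (hbo ▸ hl)
    exact h₄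
  refine ⟨_, .seq c d σ bs f h₁ hf, ?_, ?_⟩
  · simp only [Eff.bind, List.map_flatMap, List.map_map]
    have : ∀ (bs : List Branch) (out : Eff β), (∀ b ∈ bs, ∀ o ∈ out, b.store = g o.1 →
        (f b).map (fun b => (v b.store, b.trace)) = k o.1) →
        bs.map (fun b => (b.store, b.trace)) = Eff.vmap g out →
        (bs.flatMap fun b => (f b).map ((fun b => (v b.store, b.trace)) ∘ b.andThen)) =
        out.flatMap fun o => (k o.1).map fun o' => (o'.1, o.2 ++ o'.2) := by
      intro bs
      induction bs with
      | nil => intro out _ h; cases out with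
        | nil => rfl
        | cons => simp [Eff.vmap] at h
      | cons b bs ih => intro out hk h; cases out with
        | nil => simp [Eff.vmap] at h
        | cons o out =>
          simp only [Eff.vmap, List.map_cons, List.cons.injEq, Prod.mk.injEq] at h
          simp only [List.flatMap_cons]
          rw [ih out (fun b hb o ho => hk b (by simp [hb]) o (by simp [ho])) h.2,
            ← hk b (by simp) o (by simp) h.1.1, ← h.1.2]
          simp [Function.comp_def, Branch.andThen]
    exact this bs out (fun b hb o ho hbo => (key b hb o ho hbo).1) h₂
  · intro b hb
    simp only [List.mem_flatMap, List.mem_map] at hb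
    obtain ⟨b₁, hb₁, b₂, hb₂, rfl⟩ := hb
    have : (b₁.store, b₁.trace) ∈ Eff.vmap g out := h₂ ▸ List.mem_map_of_mem hb₁
    obtain ⟨o, ho, h₄⟩ := Eff.mem_vmap.1 this
    simp only [Prod.mk.injEq] at h₄
    exact add_le_add (h₃ _ hb₁) ((key b₁ hb₁ o ho h₄.1).2 _ hb₂)

theorem Runs.ite {v : Store → δ} {x : ℕ} {c d : Cmd} {σ : Store} {T : ℕ} {out : Eff δ}
    (h : σ x ≠ .nil → Runs v c σ T out) (h' : σ x = .nil → Runs v d σ T out) :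
    Runs v (.ite x c d) σ (T + 1) out := by
  by_cases hx : σ x = .nil
  · obtain ⟨bs, h₁, h₂, h₃⟩ := h' hx
    refine ⟨_, .iteFalse x c d σ bs hx h₁, ?_, ?_⟩
    · simpa [Function.comp_def, Branch.tick] using h₂
    · simpa [Branch.tick] using h₃
  · obtain ⟨bs, h₁, h₂, h₃⟩ := h hx
    refine ⟨_, .iteTrue x c d σ bs hx h₁, ?_, ?_⟩
    · simpa [Function.comp_def, Branch.tick] using h₂
    · simpa [Branch.tick] using h₃

theorem Runs.loop_nil {x : ℕ} {c : Cmd} {σ : Store} (hx : σ x = .nil) :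
    Runs id (.loop x c) σ 1 (Eff.pure σ) :=
  ⟨_, .loopDone x c σ hx, by simp [Eff.pure], by simp⟩

theorem Runs.loop_step {v : Store → δ} {x : ℕ} {c : Cmd} {σ : Store} {T : ℕ} {out : Eff δ}
    (hx : σ x ≠ .nil) (h : Runs v (.seq c (.loop x c)) σ T out) :
    Runs v (.loop x c) σ (T + 1) out := by
  obtain ⟨bs, h₁, h₂, h₃⟩ := h
  refine ⟨_, .loopStep x c σ bs hx h₁, ?_, ?_⟩
  · simpa [Function.comp_def, Branch.tick] using h₂
  · simpa [Branch.tick] using h₃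

/-- The result of a program, which is held by variable `0`. -/
def result (σ : Store) : Data := σ 0

theorem Runs.size_le {c : Cmd} {d : Data} {T : ℕ} {out : Eff Data}
    (h : Runs result c (initStore d) T out) : ∀ o ∈ out, o.1.size ≤ d.size + 3 * T := by
  obtain ⟨bs, h₁, rfl, h₃⟩ := h
  intro o ho
  simp only [List.mem_map] at ho
  obtain ⟨b, hb, rfl⟩ := ho
  have := h₁.size_le d.size (fun y => by
    by_cases hy : y = 0
    · subst hy; simp [initStore]
    · rw [initStore_of_ne _ hy]; exact d.one_le_size) b hb 0
  have := h₃ b hb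
  simp only [result]; omega

/-- A call is charged for its argument and its result. The result has size at most that of the
argument plus `3 * T`, which explains `4 * T` and the factor 2. -/
theorem Runs.call {x y : ℕ} {c : Cmd} {σ : Store} {T : ℕ} {out : Eff Data}
    (h : Runs result c (initStore (σ y)) T out) :
    Runs id (.call x c y) σ (4 * T + 1 + 2 * (σ y).size)
      (Eff.vmap (Function.update σ x) out) := by
  have hs := h.size_le
  obtain ⟨bs, h₁, rfl, h₃⟩ := h
  refine ⟨_, .call x c y σ bs h₁, by simp [Eff.vmap, result, Function.comp_def], ?_⟩
  intro b hb
  simp only [List.mem_map] at hb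
  obtain ⟨b', hb', rfl⟩ := hb
  have h2 := hs _ (List.mem_map_of_mem hb')
  have := h₃ b' hb'
  simp only [result] at h2
  simp only; omega

theorem Runs.seq_pure {v : Store → δ} {c d : Cmd} {σ σ' : Store} {T T' : ℕ} {out : Eff δ}
    (h : Runs id c σ T (Eff.pure σ')) (h' : Runs v d σ' T' out) :
    Runs v (.seq c d) σ (T + T') out := by
  have := Runs.seq (out := Eff.pure σ') (g := id) (k := fun _ => out) h (fun o ho => by
    rw [Eff.mem_pure] at ho; subst ho; exact h')
  rwa [Eff.pure_bind] at this

end Rules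

/-! ### Polynomial bounds -/

theorem eval_mono_nat (p : Polynomial ℕ) {a b : ℕ} (h : a ≤ b) : p.eval a ≤ p.eval b := by
  simp only [Polynomial.eval_eq_sum, Polynomial.sum]
  gcongr

/-- `f` is bounded by a polynomial in the size of the encoding on `s`. -/
def PolyBdd {α : Type} [ToData α] (s : Set α) (f : α → ℕ) : Prop :=
  ∃ p : Polynomial ℕ, ∀ a ∈ s, f a ≤ p.eval (enc a).size

section PolyBdd

variable {α β : Type} [ToData α] [ToData β] {s : Set α} {f g : α → ℕ}

theorem PolyBdd.size : PolyBdd s fun a => (enc a).size := ⟨Polynomial.X, by simp⟩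

theorem PolyBdd.const (n : ℕ) : PolyBdd s fun _ => n := ⟨Polynomial.C n, by simp⟩

theorem PolyBdd.add (hf : PolyBdd s f) (hg : PolyBdd s g) : PolyBdd s fun a => f a + g a := by
  obtain ⟨p, hp⟩ := hf
  obtain ⟨q, hq⟩ := hg
  exact ⟨p + q, fun a ha => by simpa using add_le_add (hp a ha) (hq a ha)⟩

theorem PolyBdd.mul (hf : PolyBdd s f) (hg : PolyBdd s g) : PolyBdd s fun a => f a * g a := by
  obtain ⟨p, hp⟩ := hf
  obtain ⟨q, hq⟩ := hg
  exact ⟨p * q, fun a ha => by simpa using Nat.mul_le_mul (hp a ha) (hq a ha)⟩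

theorem PolyBdd.eval (hf : PolyBdd s f) (q : Polynomial ℕ) : PolyBdd s fun a => q.eval (f a) := by
  obtain ⟨p, hp⟩ := hf
  exact ⟨q.comp p, fun a ha => by
    rw [Polynomial.eval_comp]; exact eval_mono_nat q (hp a ha)⟩

end PolyBdd

/-! ### Computable functions with effects -/

/-- `f` is computed on `s` by a program in polynomial time. -/
def Computes {α β : Type} [ToData α] [ToData β] (s : Set α) (f : α → Eff β) : Prop :=
  ∃ (c : Cmd) (p : Polynomial ℕ), ∀ a ∈ s,
    Runs result c (initStore (enc a)) (p.eval (enc a).size) (Eff.vmap enc (f a))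

/-- `f` is computed on `s` by a deterministic program in polynomial time. -/
abbrev PT {α β : Type} [ToData α] [ToData β] (s : Set α) (f : α → β) : Prop :=
  Computes s fun a => Eff.pure (f a)

section Computes

variable {α β γ δ : Type} [ToData α] [ToData β] [ToData γ] [ToData δ]

theorem computes_of {s : Set α} {f : α → Eff β} (c : Cmd) {T : α → ℕ} (hT : PolyBdd s T)
    (h : ∀ a ∈ s, Runs result c (initStore (enc a)) (T a) (Eff.vmap enc (f a))) :
    Computes s f := by
  obtain ⟨p, hp⟩ := hT
  exact ⟨c, p, fun a ha => (h a ha).mono (hp a ha)⟩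

/-- A program cannot write more than its running time allows. This keeps the input of a subsequent
stage polynomial, and thus makes composition possible. -/
theorem Computes.size {s : Set α} {f : α → Eff β} (h : Computes s f) :
    ∃ p : Polynomial ℕ, ∀ a ∈ s, ∀ o ∈ f a, (enc o.1).size ≤ p.eval (enc a).size := by
  obtain ⟨c, p, h⟩ := h
  refine ⟨Polynomial.X + 3 * p, fun a ha o ho => ?_⟩
  have := (h a ha).size_le (enc o.1, o.2) (Eff.mem_vmap.2 ⟨o, ho, rfl⟩)
  simpa using this

theorem PolyBdd.of_size {s : Set α} {f : α → β} (h : PT s f) :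
    PolyBdd s fun a => (enc (f a)).size := by
  obtain ⟨p, hp⟩ := h.size
  exact ⟨p, fun a ha => hp a ha (f a, []) (by simp [Eff.pure])⟩

theorem pt_of_polyTimeOn {s : Set α} {f : α → β} (h : PolyTimeOn s fun a => enc (f a)) :
    PT s f := by
  obtain ⟨c, p, h⟩ := h
  refine ⟨c, p, fun a ha => ?_⟩
  obtain ⟨σ, t, h₁, h₂, h₃⟩ := h a ha
  exact ⟨_, h₁, by simp [Eff.vmap, Eff.pure, result, h₂], by simpa using h₃⟩

/-- A program sees encodings only, so even the type of the values may change. -/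
theorem Computes.congr {γ : Type} [ToData γ] {s : Set α} {f : α → Eff β} {g : α → Eff γ}
    (h : Computes s f) (hfg : ∀ a ∈ s, Eff.vmap enc (f a) = Eff.vmap enc (g a)) :
    Computes s g := by
  obtain ⟨c, p, h⟩ := h
  exact ⟨c, p, fun a ha => hfg a ha ▸ h a ha⟩

theorem Computes.congr' {s : Set α} {f g : α → Eff β}
    (h : Computes s f) (hfg : ∀ a ∈ s, f a = g a) : Computes s g :=
  h.congr fun a ha => by rw [hfg a ha]

theorem Computes.mono {s t : Set α} {f : α → Eff β} (h : Computes t f) (hst : s ⊆ t) :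
    Computes s f := by
  obtain ⟨c, p, h⟩ := h
  exact ⟨c, p, fun a ha => h a (hst ha)⟩

theorem PT.congr {γ : Type} [ToData γ] {s : Set α} {f : α → β} {g : α → γ}
    (h : PT s f) (hfg : ∀ a ∈ s, enc (f a) = enc (g a)) : PT s g :=
  Computes.congr h fun a ha => by simp [Eff.vmap_pure, hfg a ha]

theorem PT.id (s : Set α) : PT s fun a => a :=
  computes_of (.assign 0 (.var 0)) (T := fun a => 1 + (enc a).size)
    (.add (.const 1) .size) fun a _ => by
    have := (Runs.assign 0 (.var 0) (initStore (enc a))).view (v := result)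
    simpa [Eff.vmap_pure, result, Expr.eval, initStore_zero] using this

/-- A function that does not change the encoding. -/
theorem PT.of_enc_eq {s : Set α} {g : α → γ} (h : ∀ a ∈ s, enc a = enc (g a)) : PT s g :=
  (PT.id s).congr h

/-- A call of the program of a computable function. -/
theorem runs_call {s : Set α} {f : α → Eff β} {c : Cmd} {p : Polynomial ℕ}
    (h : ∀ a ∈ s, Runs result c (initStore (enc a)) (p.eval (enc a).size) (Eff.vmap enc (f a)))
    {a : α} (ha : a ∈ s) {σ : Store} {x y : ℕ} (hy : σ y = enc a) {N : ℕ}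
    (hN : (enc a).size ≤ N) :
    Runs id (.call x c y) σ (4 * p.eval N + 1 + 2 * N)
      (Eff.vmap (fun b => Function.update σ x (enc b)) (f a)) := by
  have h1 := Runs.call (x := x) (y := y) (σ := σ) (c := c) (by rw [hy]; exact h a ha)
  rw [Eff.vmap_vmap, hy] at h1
  have := eval_mono_nat p hN
  exact h1.mono (by omega)

theorem Computes.bind {s : Set α} {t : Set β} {f : α → Eff β} {k : β → Eff γ}
    (hf : Computes s f) (hk : Computes t k) (hst : ∀ a ∈ s, ∀ o ∈ f a, o.1 ∈ t) :
    Computes s fun a => Eff.bind (f a) k := by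
  obtain ⟨q, hq⟩ := hf.size
  obtain ⟨c, p, hf⟩ := hf
  obtain ⟨d, p', hk⟩ := hk
  refine computes_of (.seq (.call 0 c 0) (.call 0 d 0))
    (T := fun a => (4 * p.eval (enc a).size + 1 + 2 * (enc a).size) +
      (4 * p'.eval (q.eval (enc a).size) + 1 + 2 * (q.eval (enc a).size)))
    (.add (.add (.add (.mul (.const _) (.eval .size _)) (.const _)) (.mul (.const _) .size))
      (.add (.add (.mul (.const _) (.eval (.eval .size _) _)) (.const _))
        (.mul (.const _) (.eval .size _)))) fun a ha => ?_
  rw [Eff.vmap_bind]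
  refine Runs.seq (runs_call hf ha (initStore_zero _) le_rfl) fun o ho => ?_
  have := (runs_call (x := 0) hk (hst a ha o ho) (σ := Function.update (initStore (enc a)) 0 (enc o.1))
    (y := 0) (by simp) (hq a ha o ho)).view (v := result)
  simpa [Eff.vmap_vmap, result] using this

theorem PT.comp {s : Set α} {t : Set β} {f : α → β} {g : β → γ} (hg : PT t g) (hf : PT s f)
    (hst : ∀ a ∈ s, f a ∈ t) : PT s fun a => g (f a) := by
  have := Computes.bind hf hg (fun a ha o ho => by
    rw [Eff.mem_pure] at ho; subst ho; exact hst a ha)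
  simpa only [Eff.pure_bind] using this

theorem Computes.comp {s : Set α} {t : Set β} {f : α → β} {g : β → Eff γ} (hg : Computes t g)
    (hf : PT s f) (hst : ∀ a ∈ s, f a ∈ t) : Computes s fun a => g (f a) := by
  have := Computes.bind hf hg (fun a ha o ho => by
    rw [Eff.mem_pure] at ho; subst ho; exact hst a ha)
  simpa only [Eff.pure_bind] using this

theorem Computes.vmap {s : Set α} {t : Set β} {f : α → Eff β} {g : β → γ} (hf : Computes s f)
    (hg : PT t g) (hst : ∀ a ∈ s, ∀ o ∈ f a, o.1 ∈ t) :
    Computes s fun a => Eff.vmap g (f a) := by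
  simpa only [Eff.vmap_eq_bind] using Computes.bind hf hg hst

theorem Computes.prod {s : Set α} {f : α → Eff β} {g : α → Eff γ} (hf : Computes s f)
    (hg : Computes s g) :
    Computes s fun a => Eff.bind (f a) fun b => Eff.vmap (fun c => (b, c)) (g a) := by
  obtain ⟨q, hq⟩ := hf.size
  obtain ⟨q', hq'⟩ := hg.size
  obtain ⟨c, p, hf⟩ := hf
  obtain ⟨d, p', hg⟩ := hg
  -- Subroutines run on fresh variables, so variable `0` still holds the input at the second call.
  refine computes_of (.seq (.call 1 c 0) (.seq (.call 2 d 0) (.assign 0 (.cons 1 2))))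
    (T := fun a => (4 * p.eval (enc a).size + 1 + 2 * (enc a).size) +
      ((4 * p'.eval (enc a).size + 1 + 2 * (enc a).size) +
      (2 + q.eval (enc a).size + q'.eval (enc a).size)))
    (.add (.add (.add (.mul (.const _) (.eval .size _)) (.const _)) (.mul (.const _) .size))
      (.add (.add (.add (.mul (.const _) (.eval .size _)) (.const _)) (.mul (.const _) .size))
      (.add (.add (.const _) (.eval .size _)) (.eval .size _)))) fun a ha => ?_
  rw [Eff.vmap_bind]
  refine Runs.seq (runs_call hf ha (initStore_zero _) le_rfl) fun o ho => ?_
  rw [Eff.vmap_vmap, Eff.vmap_eq_bind]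
  refine Runs.seq (runs_call hg ha (by simp [initStore_zero]) le_rfl) fun o' ho' => ?_
  refine ((Runs.assign 0 (.cons 1 2) _).view (v := result)).mono ?_
  have := hq a ha o ho
  have := hq' a ha o' ho'
  simp only [Expr.eval, Data.size, Function.update_self, ne_eq, OfNat.one_ne_ofNat,
    not_false_eq_true, Function.update_of_ne]
  omega

theorem PT.prod {s : Set α} {f : α → β} {g : α → γ} (hf : PT s f) (hg : PT s g) :
    PT s fun a => (f a, g a) := by
  simpa only [Eff.pure_bind, Eff.vmap_pure] using Computes.prod hf hg

/-- Run a computation and keep its input. -/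
theorem Computes.keep {s : Set α} {f : α → Eff β} (hf : Computes s f) :
    Computes s fun a => Eff.vmap (fun b => (a, b)) (f a) := by
  simpa only [Eff.pure_bind] using Computes.prod (PT.id s) hf

/-- Run a computation, then a second one that also has access to the input of the first. -/
theorem Computes.bind_keep {s : Set α} {t : Set (α × β)} {f : α → Eff β} {k : α → β → Eff γ}
    (hf : Computes s f) (hk : Computes t fun p : α × β => k p.1 p.2)
    (hst : ∀ a ∈ s, ∀ o ∈ f a, (a, o.1) ∈ t) :
    Computes s fun a => Eff.bind (f a) (k a) := by
  have := Computes.bind hf.keep hk (fun a ha o ho => by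
    obtain ⟨o', ho', rfl⟩ := Eff.mem_vmap.1 ho
    exact hst a ha o' ho')
  simpa only [Eff.bind_vmap] using this

theorem PT.unary {s : Set α} {g : α → γ} (e : Expr) (he : ∀ a ∈ s,
    e.eval (initStore (enc a)) = enc (g a)) (hs : ∀ a ∈ s, (enc (g a)).size ≤ (enc a).size + 2) :
    PT s g :=
  computes_of (.assign 0 e) (T := fun a => 3 + (enc a).size)
    (.add (.const 3) .size) fun a ha => by
    have := (Runs.assign 0 e (initStore (enc a))).view (v := result)
    rw [he a ha] at this
    have hs := hs a ha
    have := this.mono (T' := 3 + (enc a).size) (by omega)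
    simpa [Eff.vmap_pure, result] using this

theorem PT.fst (s : Set (α × β)) : PT s fun a => a.1 :=
  PT.unary (.hd 0) (fun a _ => by simp [Expr.eval, initStore_zero, enc, Data.hd])
    fun a _ => by
      have : (enc a).size = (enc a.1).size + (enc a.2).size + 1 := rfl
      omega

theorem PT.snd (s : Set (α × β)) : PT s fun a => a.2 :=
  PT.unary (.tl 0) (fun a _ => by simp [Expr.eval, initStore_zero, enc, Data.tl])
    fun a _ => by
      have : (enc a).size = (enc a.1).size + (enc a.2).size + 1 := rfl
      omega

theorem PT.const (s : Set α) (b : β) : PT s fun _ => b := by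
  have h : ∀ d : Data, PT s fun _ => d := by
    intro d
    induction d with
    | nil =>
      refine PT.unary .nil (fun a _ => rfl) fun a _ => ?_
      change 1 ≤ _
      omega
    | cons d e hd he => exact (hd.prod he).congr fun a _ => rfl
  exact (h (enc b)).congr fun a _ => rfl

theorem Computes.ite {s : Set α} {b : α → Bool} {f g : α → Eff β} (hb : PT s b)
    (hf : Computes {a ∈ s | b a = true} f) (hg : Computes {a ∈ s | b a = false} g) :
    Computes s fun a => if b a then f a else g a := by
  obtain ⟨c, p, hb⟩ := hb
  obtain ⟨d, p', hf⟩ := hf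
  obtain ⟨e, q, hg⟩ := hg
  refine computes_of (.seq (.call 1 c 0) (.ite 1 (.call 0 d 0) (.call 0 e 0)))
    (T := fun a => (4 * p.eval (enc a).size + 1 + 2 * (enc a).size) +
      ((4 * (p' + q).eval (enc a).size + 1 + 2 * (enc a).size) + 1))
    (.add (.add (.add (.mul (.const _) (.eval .size _)) (.const _)) (.mul (.const _) .size))
      (.add (.add (.add (.mul (.const _) (.eval .size _)) (.const _)) (.mul (.const _) .size))
      (.const 1))) fun a ha => ?_
  refine Runs.seq_pure (runs_call (x := 1) hb ha (initStore_zero _) le_rfl) (Runs.ite ?_ ?_)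
  · intro h
    have h : b a = true := by
      by_contra h'
      simp [h', enc] at h
    rw [if_pos h]
    have := (runs_call (x := 0) hf (a := a) ⟨ha, h⟩
      (σ := Function.update (initStore (enc a)) 1 (enc (b a)))
      (y := 0) (by simp [initStore_zero]) le_rfl).view (v := result)
    simp only [Eff.vmap_vmap, result, Function.update_self] at this
    exact this.mono (by simp)
  · intro h
    have h : b a = false := by
      by_contra h'
      simp [h', enc] at h
    rw [h, if_neg (by simp)]
    have := (runs_call (x := 0) hg (a := a) ⟨ha, h⟩
      (σ := Function.update (initStore (enc a)) 1 (enc (b a)))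
      (y := 0) (by simp [initStore_zero]) le_rfl).view (v := result)
    simp only [Eff.vmap_vmap, result, Function.update_self] at this
    rw [← h]
    exact this.mono (by simp)

theorem PT.ite {s : Set α} {b : α → Bool} {f g : α → β} (hb : PT s b)
    (hf : PT {a ∈ s | b a = true} f) (hg : PT {a ∈ s | b a = false} g) :
    PT s fun a => if b a then f a else g a :=
  (Computes.ite hb hf hg).congr' fun a _ => by dsimp only; split <;> rfl

/-- The invariant `I` relates the input, the remaining list and the accumulator. It has to bound the
accumulator by a polynomial in the input alone: a bound for a single step would be iterated and
could grow exponentially. -/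
theorem Computes.fold {s : Set α} {l : α → List β} {z : α → γ} (hl : PT s l) (hz : PT s z)
    {step : α → γ → β → Eff γ} {t : Set (α × γ × β)}
    (hstep : Computes t fun p => step p.1 p.2.1 p.2.2) (I : α → List β → γ → Prop)
    (hI₀ : ∀ a ∈ s, I a (l a) (z a))
    (hIt : ∀ a ∈ s, ∀ b l' c, I a (b :: l') c → (a, c, b) ∈ t)
    (hI : ∀ a ∈ s, ∀ b l' c, I a (b :: l') c → ∀ o ∈ step a c b, I a l' o.1)
    (q : Polynomial ℕ)
    (hq : ∀ a ∈ s, ∀ l' c, I a l' c → (enc c).size ≤ q.eval (enc a).size) :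
    Computes s fun a => Eff.fold (step a) (l a) (z a) := by
  obtain ⟨ql, hql⟩ := PolyBdd.of_size hl
  obtain ⟨cl, pl, hl⟩ := hl
  obtain ⟨cz, pz, hz⟩ := hz
  obtain ⟨cs, p, hstep⟩ := hstep
  have hlen : ∀ l : List β, l.length ≤ (enc l).size := by
    intro l
    induction l with
    | nil => simp
    | cons b l ih =>
      have : (enc (b :: l)).size = (enc b).size + (enc l).size + 1 := rfl
      simp; omega
  -- Variable `2` holds the fixed input, `1` the remaining list, `0` the accumulator; the argument
  -- of the step is assembled in `3`.
  set body : Cmd := .seq (.assign 3 (.hd 1)) (.seq (.assign 1 (.tl 1)) (.seq (.assign 3 (.cons 0 3))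
    (.seq (.assign 3 (.cons 2 3)) (.call 0 cs 3)))) with hbody
  -- `L` bounds the remaining list, hence its head, and `N` bounds the encoded triple passed to the
  -- step. Each round then costs four assignments, one test and one call on data of size at most
  -- `N`.
  have main : ∀ a ∈ s, ∀ L, ∀ l' c, I a l' c → (enc l').size ≤ L →
      ∀ σ : Store, σ 2 = enc a → σ 1 = enc l' → σ 0 = enc c →
      ∀ N, N = (enc a).size + q.eval (enc a).size + L + 2 →
      Runs result (.loop 1 body) σ (1 + l'.length * (5 + 6 * N + (4 * p.eval N)))
        (Eff.vmap enc (Eff.fold (step a) l' c)) := by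
    intro a ha L l'
    induction l' with
    | nil =>
      intro c _ _ σ _ h1 h2 N _
      have := (Runs.loop_nil (c := body) (σ := σ) (x := 1) (by rw [h1]; rfl)).view
        (v := result)
      simpa [Eff.fold, Eff.vmap_pure, result, h2] using this
    | cons b l' ih =>
      intro c hIc hL σ h0 h1 h2 N hN
      have hs1 : (enc (b :: l')).size = (enc b).size + (enc l').size + 1 := rfl
      have hs2 := hq a ha _ c hIc
      have e1 : (Expr.hd 1).eval σ = enc b := by simp [Expr.eval, h1]; rfl
      have e2 : (Expr.tl 1).eval (Function.update σ 3 (enc b)) = enc l' := by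
        simp [Expr.eval, h1]; rfl
      have e3 : (Expr.cons 0 3).eval (Function.update (Function.update σ 3 (enc b)) 1 (enc l')) =
          enc (c, b) := by
        simp [Expr.eval, h2]; rfl
      have e4 : (Expr.cons 2 3).eval (Function.update (Function.update (Function.update σ 3 (enc b))
          1 (enc l')) 3 (enc (c, b))) = enc (a, c, b) := by
        simp [Expr.eval, h0]; rfl
      have hs3 : (enc (c, b)).size = (enc c).size + (enc b).size + 1 := rfl
      have hs4 : (enc (a, c, b)).size = (enc a).size + (enc (c, b)).size + 1 := rfl
      have r1 := Runs.assign 3 (.hd 1) σ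
      rw [e1] at r1
      have r2 := Runs.assign 1 (.tl 1) (Function.update σ 3 (enc b))
      rw [e2] at r2
      have r3 := Runs.assign 3 (.cons 0 3)
        (Function.update (Function.update σ 3 (enc b)) 1 (enc l'))
      rw [e3] at r3
      have r4 := Runs.assign 3 (.cons 2 3) (Function.update (Function.update
        (Function.update σ 3 (enc b)) 1 (enc l')) 3 (enc (c, b)))
      rw [e4] at r4
      have r5 := runs_call (x := 0) (y := 3) hstep (hIt a ha b l' c hIc)
        (σ := Function.update (Function.update (Function.update
          (Function.update σ 3 (enc b)) 1 (enc l')) 3 (enc (c, b))) 3 (enc (a, c, b))) (by simp)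
        (N := N) (by omega)
      have r := r1.seq_pure (r2.seq_pure (r3.seq_pure (r4.seq_pure r5)))
      rw [← hbody] at r
      simp only [Eff.fold, Eff.vmap_bind]
      refine (Runs.loop_step (by rw [h1]; simp [enc, encList]) (r.seq fun o ho => ih o.1
        (hI a ha b l' c hIc o ho) (by omega) _ (by simp [h0]) (by simp) (by simp) N hN)).mono ?_
      simp only [List.length_cons, add_mul, one_mul]
      omega
  refine computes_of (.seq (.assign 2 (.var 0)) (.seq (.call 1 cl 0) (.seq (.call 0 cz 0)
      (.loop 1 body))))
    (T := fun a => (1 + (enc a).size) + ((4 * pl.eval (enc a).size + 1 + 2 * (enc a).size) +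
      ((4 * pz.eval (enc a).size + 1 + 2 * (enc a).size) + (1 + ql.eval (enc a).size * (5 +
        6 * ((enc a).size + q.eval (enc a).size + ql.eval (enc a).size + 2) +
        (4 * p.eval ((enc a).size + q.eval (enc a).size + ql.eval (enc a).size + 2)))))))
    ?_ fun a ha => ?_
  · have hx : PolyBdd s fun a => (enc a).size := .size
    have hN : PolyBdd s fun a => (enc a).size + q.eval (enc a).size + ql.eval (enc a).size + 2 :=
      .add (.add (.add hx (hx.eval q)) (hx.eval ql)) (.const 2)
    exact .add (.add (.const 1) hx) (.add (.add (.add (.mul (.const 4) (hx.eval pl)) (.const 1))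
      (.mul (.const 2) hx)) (.add (.add (.add (.mul (.const 4) (hx.eval pz)) (.const 1))
      (.mul (.const 2) hx)) (.add (.const 1) (.mul (hx.eval ql) (.add (.add (.const 5)
      (.mul (.const 6) hN)) (.mul (.const 4) (hN.eval p)))))))
  have r1 := Runs.assign 2 (.var 0) (initStore (enc a))
  rw [show (Expr.var 0).eval (initStore (enc a)) = enc a from initStore_zero _] at r1
  refine r1.seq_pure ?_
  refine Runs.seq_pure (runs_call (x := 1) hl ha (by simp [initStore_zero]) le_rfl) ?_
  refine Runs.seq_pure (runs_call (x := 0) hz ha (by simp [initStore_zero]) le_rfl) ?_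
  refine (main a ha (ql.eval (enc a).size) (l a) (z a) (hI₀ a ha) (hql a ha) _ (by simp) (by simp)
    (by simp) _ rfl).mono ?_
  have := (hlen (l a)).trans (hql a ha)
  gcongr

end Computes

/-! ### A library of computable functions -/

/-- With this encoding a list of units is literally a unary numeral, and arithmetic becomes a matter
of list operations. -/
instance : ToData Unit := ⟨fun _ => .nil⟩

section Library

variable {α β γ δ : Type} [ToData α] [ToData β] [ToData γ] [ToData δ]

theorem enc_cons (a : α) (l : List α) : enc (a :: l) = .cons (enc a) (enc l) := rfl

theorem enc_pair (a : α) (b : β) : enc (a, b) = .cons (enc a) (enc b) := rfl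

theorem size_pair (a : α) (b : β) : (enc (a, b)).size = (enc a).size + (enc b).size + 1 := rfl

theorem size_cons (a : α) (l : List α) :
    (enc (a :: l)).size = (enc a).size + (enc l).size + 1 := rfl

theorem size_nil : (enc ([] : List α)).size = 1 := rfl

theorem enc_map_eq {f : α → β} (hf : ∀ a, enc (f a) = enc a) (l : List α) :
    enc (l.map f) = enc l := by
  induction l with
  | nil => rfl
  | cons a l ih => simp [enc_cons, hf, ih]

theorem size_append (l l' : List α) :
    (enc (l ++ l')).size + 1 = (enc l).size + (enc l').size := by
  induction l with
  | nil => simp [size_nil]; omega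
  | cons a l ih => simp only [List.cons_append, size_cons]; omega

theorem size_le_of_mem {a : α} {l : List α} (h : a ∈ l) : (enc a).size ≤ (enc l).size := by
  induction l with
  | nil => simp at h
  | cons b l ih =>
    rw [size_cons]
    rcases List.mem_cons.1 h with rfl | h
    · omega
    · have := ih h; omega

theorem size_list_le {l : List α} {B : ℕ} (h : ∀ a ∈ l, (enc a).size ≤ B) :
    (enc l).size ≤ 1 + l.length * (B + 1) := by
  induction l with
  | nil => simp [size_nil]
  | cons b l ih =>
    rw [size_cons, List.length_cons, add_mul]
    have := ih fun a ha => h a (by simp [ha])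
    have := h b (by simp)
    omega

theorem length_le_size (l : List α) : l.length ≤ (enc l).size := by
  induction l with
  | nil => simp
  | cons b l ih => rw [size_cons]; simp; omega

theorem enc_replicate_unit (n : ℕ) : enc (List.replicate n ()) = enc n := by
  induction n with
  | zero => rfl
  | succ n ih => rw [List.replicate_succ, enc_cons, ih]; rfl

theorem enc_map_unit {α : Type} (l : List α) : enc (l.map fun _ => ()) = enc l.length := by
  rw [List.map_const', enc_replicate_unit]

theorem size_nat (n : ℕ) : (enc n).size = 2 * n + 1 := by
  induction n with
  | zero => rfl
  | succ n ih =>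
    have : (enc (n + 1)).size = 1 + (enc n).size + 1 := rfl
    omega

theorem len_enc_nat (n : ℕ) : (enc n).len = n := by
  induction n with
  | zero => rfl
  | succ n ih =>
    have : (enc (n + 1)).len = (enc n).len + 1 := rfl
    omega

theorem PT.of_eq {s : Set α} {f g : α → β} (h : PT s f) (hfg : ∀ a ∈ s, f a = g a) : PT s g :=
  h.congr fun a ha => by rw [hfg a ha]

theorem PT.foldl {s : Set α} {l : α → List β} {z : α → γ} (hl : PT s l) (hz : PT s z)
    {step : α → γ → β → γ} {t : Set (α × γ × β)}
    (hstep : PT t fun p => step p.1 p.2.1 p.2.2) (I : α → List β → γ → Prop)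
    (hI₀ : ∀ a ∈ s, I a (l a) (z a))
    (hIt : ∀ a ∈ s, ∀ b l' c, I a (b :: l') c → (a, c, b) ∈ t)
    (hI : ∀ a ∈ s, ∀ b l' c, I a (b :: l') c → I a l' (step a c b))
    {B : α → ℕ} (hB : PolyBdd s B)
    (hq : ∀ a ∈ s, ∀ l' c, I a l' c → (enc c).size ≤ B a) :
    PT s fun a => (l a).foldl (step a) (z a) := by
  obtain ⟨q, hBq⟩ := hB
  have := Computes.fold hl hz (step := fun a c b => Eff.pure (step a c b)) hstep I hI₀ hIt
    (fun a ha b l' c h o ho => by rw [Eff.mem_pure] at ho; subst ho; exact hI a ha b l' c h) q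
    (fun a ha l' c h => (hq a ha l' c h).trans (hBq a ha))
  simpa only [Eff.fold_pure] using this

theorem PT.cons {s : Set α} {f : α → β} {g : α → List β} (hf : PT s f) (hg : PT s g) :
    PT s fun a => f a :: g a :=
  (hf.prod hg).congr fun _ _ => rfl

theorem PT.fst' {s : Set α} {f : α → β × γ} (hf : PT s f) : PT s fun a => (f a).1 :=
  (PT.fst Set.univ).comp hf fun _ _ => trivial

theorem PT.snd' {s : Set α} {f : α → β × γ} (hf : PT s f) : PT s fun a => (f a).2 :=
  (PT.snd Set.univ).comp hf fun _ _ => trivial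

/-- Elements only move from one list to the other, so the total size does not grow; this bounds the
accumulator. -/
theorem PT.reverse_append {s : Set α} {f g : α → List β} (hf : PT s f) (hg : PT s g) :
    PT s fun a => (f a).reverse ++ g a := by
  have := PT.foldl hf hg (step := fun _ z b => b :: z) (t := Set.univ)
    (PT.cons (PT.snd' (PT.snd _)) (PT.fst' (PT.snd _)))
    (fun a l' c => (enc c).size + (enc l').size ≤ (enc (f a)).size + (enc (g a)).size)
    (fun a _ => by omega) (fun _ _ _ _ _ _ => trivial)
    (fun a _ b l' c h => by rw [size_cons] at h ⊢; omega)
    ((PolyBdd.of_size hf).add (PolyBdd.of_size hg)) (fun a _ l' c h => by omega)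
  refine this.of_eq fun a _ => ?_
  generalize g a = z, f a = l
  induction l generalizing z with
  | nil => rfl
  | cons b l ih => simp [ih]

theorem PT.reverse {s : Set α} {f : α → List β} (hf : PT s f) : PT s fun a => (f a).reverse := by
  simpa using hf.reverse_append (PT.const s ([] : List β))

theorem PT.append {s : Set α} {f g : α → List β} (hf : PT s f) (hg : PT s g) :
    PT s fun a => f a ++ g a := by
  simpa using hf.reverse.reverse_append hg

/-- The results are independent of each other, so each has polynomial size in the input, and the
accumulator has at most as many entries as the list. -/
theorem Computes.traverse {s : Set α} {l : α → List β} (hl : PT s l) {f : α → β → Eff γ}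
    {t : Set (α × β)} (hf : Computes t fun p => f p.1 p.2) (hst : ∀ a ∈ s, ∀ b ∈ l a, (a, b) ∈ t) :
    Computes s fun a => Eff.traverse (f a) (l a) := by
  obtain ⟨q, hq⟩ := hf.size
  obtain ⟨ql, hql⟩ := PolyBdd.of_size hl
  have h1 : Computes {p : α × List γ × β | (p.1, p.2.2) ∈ t} fun p => f p.1 p.2.2 :=
    hf.comp ((PT.fst _).prod (PT.snd' (PT.snd _))) fun _ h => h
  have h2 : Computes {p : α × List γ × β | (p.1, p.2.2) ∈ t}
      fun p => Eff.vmap (· :: p.2.1) (f p.1 p.2.2) := by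
    have := h1.keep.vmap (t := Set.univ)
      (g := fun p : (α × List γ × β) × γ => p.2 :: p.1.2.1)
      (PT.cons (PT.snd _) (PT.fst' (PT.snd' (PT.fst _)))) (fun _ _ _ _ => trivial)
    simpa only [Eff.vmap_vmap] using this
  have := Computes.fold hl (PT.const s ([] : List γ))
    (step := fun a acc b => Eff.vmap (· :: acc) (f a b)) h2
    (fun a l' acc => (∀ b ∈ l', b ∈ l a) ∧ acc.length + l'.length ≤ (l a).length ∧
      ∀ c ∈ acc, (enc c).size ≤ q.eval ((enc a).size + ql.eval (enc a).size + 1))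
    (fun a _ => by simp) (fun a ha b l' c h => hst a ha b (h.1 b (by simp)))
    (fun a ha b l' c h o ho => by
      obtain ⟨o', ho', rfl⟩ := Eff.mem_vmap.1 ho
      refine ⟨fun b hb => h.1 b (by simp [hb]), ?_, ?_⟩
      · have := h.2.1; simp only [List.length_cons] at this ⊢; omega
      · intro d hd
        rcases List.mem_cons.1 hd with rfl | hd
        · have hb := h.1 b (by simp)
          refine (hq (a, b) (hst a ha b hb) _ ho').trans (eval_mono_nat q ?_)
          rw [size_pair]
          have := size_le_of_mem hb
          have : (enc (l a)).size ≤ _ := hql a ha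
          omega
        · exact h.2.2 d hd)
    -- At most `ql` results, each of the size that `q` allows for a pair of the input and a list
    -- element.
    (1 + ql * (q.comp (Polynomial.X + ql + 1) + 1))
    (fun a ha l' c h => by
      refine (size_list_le h.2.2).trans ?_
      have h1 := length_le_size (l a)
      have h2 : (enc (l a)).size ≤ _ := hql a ha
      have h3 := h.2.1
      have : c.length ≤ ql.eval (enc a).size := by omega
      simp only [Polynomial.eval_add, Polynomial.eval_one, Polynomial.eval_mul,
        Polynomial.eval_comp, Polynomial.eval_X]
      gcongr)
  have := this.vmap (t := Set.univ) (PT.id _).reverse (fun _ _ _ _ => trivial)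
  refine this.congr' fun a _ => ?_
  rw [Eff.fold_cons_eq_traverse, Eff.vmap_vmap]
  simp [Eff.vmap]

theorem PT.map {s : Set α} {l : α → List β} (hl : PT s l) {f : α → β → γ}
    {t : Set (α × β)} (hf : PT t fun p => f p.1 p.2) (hst : ∀ a ∈ s, ∀ b ∈ l a, (a, b) ∈ t) :
    PT s fun a => (l a).map (f a) := by
  have := Computes.traverse hl (f := fun a b => Eff.pure (f a b)) hf hst
  simpa only [Eff.traverse_pure] using this

theorem PT.flatten {s : Set α} {l : α → List (List β)} (hl : PT s l) :
    PT s fun a => (l a).flatten := by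
  have := PT.foldl hl (PT.const s ([] : List β)) (step := fun _ z b => z ++ b) (t := Set.univ)
    (PT.append (PT.fst' (PT.snd _)) (PT.snd' (PT.snd _)))
    (fun a l' c => (enc c).size + (enc l').size ≤ (enc (l a)).size + 1)
    (fun a _ => by rw [size_nil]; omega) (fun _ _ _ _ _ _ => trivial)
    (fun a _ b l' c h => by rw [size_cons] at h; have := size_append c b; omega)
    ((PolyBdd.of_size hl).add (.const 1)) (fun a _ l' c h => by omega)
  refine this.of_eq fun a _ => ?_
  suffices ∀ (l : List (List β)) z, l.foldl (fun z b => z ++ b) z = z ++ l.flatten by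
    simpa using this (l a) []
  intro l
  induction l with
  | nil => simp
  | cons b l ih => simp [ih]

theorem PT.units {s : Set α} {f : α → ℕ} (hf : PT s f) :
    PT s fun a => List.replicate (f a) () :=
  hf.congr fun _ _ => (enc_replicate_unit _).symm

theorem PT.length {s : Set α} {l : α → List β} (hl : PT s l) : PT s fun a => (l a).length :=
  (hl.map (f := fun _ _ => ()) (PT.const Set.univ ()) fun _ _ _ _ => trivial).congr
    fun _ _ => enc_map_unit _

theorem PT.add {s : Set α} {f g : α → ℕ} (hf : PT s f) (hg : PT s g) :
    PT s fun a => f a + g a :=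
  (hf.units.append hg.units).length.of_eq fun _ _ => by simp

theorem PT.replicate {s : Set α} {f : α → ℕ} {g : α → β} (hf : PT s f) (hg : PT s g) :
    PT s fun a => List.replicate (f a) (g a) :=
  (hf.units.map (f := fun a _ => g a) (t := {p | p.1 ∈ s}) (hg.comp (PT.fst _) fun _ h => h)
    fun _ h _ _ => h).of_eq fun _ _ => by simp

theorem PT.mul {s : Set α} {f g : α → ℕ} (hf : PT s f) (hg : PT s g) :
    PT s fun a => f a * g a :=
  (hf.replicate hg.units).flatten.length.of_eq fun _ _ => by simp

theorem PT.tail {s : Set α} {l : α → List β} (hl : PT s l) : PT s fun a => (l a).tail := by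
  refine PT.comp (t := Set.univ) (g := fun l : List β => l.tail) ?_ hl fun _ _ => trivial
  refine PT.unary (.tl 0) (fun l _ => ?_) fun l _ => ?_
  · cases l <;> rfl
  · cases l
    · simp
    · simp only [List.tail_cons, size_cons]; omega

/-- On the empty list the program returns `nil`, which need not encode the default; the default is
excluded by hypothesis. -/
theorem PT.headD {s : Set α} {l : α → List β} (hl : PT s l) (d : β) (h : ∀ a ∈ s, l a ≠ []) :
    PT s fun a => (l a).headD d := by
  refine PT.comp (t := {l | l ≠ []}) (g := fun l : List β => l.headD d) ?_ hl fun a ha => h a ha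
  refine PT.unary (.hd 0) (fun l hl => ?_) fun l hl => ?_
  · cases l
    · simp at hl
    · rfl
  · cases l
    · simp at hl
    · simp only [List.headD_cons, size_cons]; omega

theorem PT.drop {s : Set α} {l : α → List β} {k : α → ℕ} (hk : PT s k) (hl : PT s l) :
    PT s fun a => (l a).drop (k a) := by
  have := PT.foldl hk.units hl (step := fun _ z _ => z.tail) (t := Set.univ)
    (PT.tail (PT.fst' (PT.snd _)))
    (fun a l' c => (enc c).size ≤ (enc (l a)).size)
    (fun a _ => le_rfl) (fun _ _ _ _ _ _ => trivial)
    (fun a _ b l' c h => by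
      cases c
      · exact h
      · rw [size_cons] at h; simp only [List.tail_cons]; omega)
    (PolyBdd.of_size hl) (fun a _ l' c h => h)
  refine this.of_eq fun a _ => ?_
  generalize l a = l, k a = k
  induction k generalizing l with
  | zero => rfl
  | succ k ih => simp [List.replicate_succ, ih]

theorem PT.sub {s : Set α} {f g : α → ℕ} (hf : PT s f) (hg : PT s g) :
    PT s fun a => f a - g a :=
  (hg.drop hf.units).length.of_eq fun _ _ => by simp

theorem PT.take {s : Set α} {l : α → List β} {k : α → ℕ} (hk : PT s k) (hl : PT s l) :
    PT s fun a => (l a).take (k a) :=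
  ((hl.length.sub hk).drop hl.reverse).reverse.of_eq fun a _ => by
    by_cases h : k a ≤ (l a).length
    · rw [List.drop_reverse, List.reverse_reverse, Nat.sub_sub_self h]
    · rw [Nat.sub_eq_zero_of_le (by omega), List.drop_zero, List.reverse_reverse,
        List.take_of_length_le (by omega)]

theorem PT.getD {s : Set α} {l : α → List β} {k : α → ℕ} (hk : PT s k) (hl : PT s l) (d : β)
    (h : ∀ a ∈ s, k a < (l a).length) : PT s fun a => (l a).getD (k a) d :=
  ((hk.drop hl).headD d fun a ha => by
    have := h a ha
    intro h'
    have := congrArg List.length h'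
    simp at this; omega).of_eq fun a ha => by
    rw [List.headD_eq_head?_getD, List.head?_drop, List.getD_eq_getElem?_getD]

theorem PT.range {s : Set α} {k : α → ℕ} (hk : PT s k) : PT s fun a => List.range (k a) := by
  have h := PT.foldl hk.units (PT.const s ((0 : ℕ), ([] : List ℕ)))
    (step := fun _ z _ => (z.1 + 1, z.1 :: z.2)) (t := Set.univ)
    (PT.prod (PT.add (PT.fst' (PT.fst' (PT.snd _))) (PT.const _ 1))
      (PT.cons (PT.fst' (PT.fst' (PT.snd _))) (PT.snd' (PT.fst' (PT.snd _)))))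
    (fun a l' c => c.2 = (List.range c.1).reverse ∧ c.1 + l'.length = k a)
    (fun a _ => by simp) (fun _ _ _ _ _ _ => trivial)
    (fun a _ b l' c h => by
      refine ⟨?_, ?_⟩
      · simp [List.range_succ, h.1]
      · have := h.2; simp only [List.length_cons] at this; simp only; omega)
    (B := fun a => (enc (k a)).size + (1 + (enc (k a)).size * ((enc (k a)).size + 1)) + 1)
    (.add (.add (.of_size hk) (.add (.const 1) (.mul (.of_size hk) (.add (.of_size hk)
      (.const 1))))) (.const 1)) (fun a _ l' c h => by
      obtain ⟨c, d⟩ := c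
      obtain ⟨h1, h2⟩ := h
      simp only at h1 h2
      subst h1
      rw [size_pair]
      have h3 : (enc (List.range c).reverse).size ≤ 1 + (List.range c).reverse.length * (2 * k a + 1 + 1) :=
        size_list_le fun i hi => by rw [size_nat]; simp at hi; omega
      simp only [size_nat]
      refine add_le_add (add_le_add (by omega) (h3.trans ?_)) le_rfl
      gcongr
      simp; omega)
  refine h.snd'.reverse.of_eq fun a _ => ?_
  suffices ∀ k i, List.foldl (fun (z : ℕ × List ℕ) (_ : Unit) => (z.1 + 1, z.1 :: z.2))
      (i, (List.range i).reverse) (List.replicate k ()) = (i + k, (List.range (i + k)).reverse) by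
    have := this (k a) 0
    simp only [List.range_zero, List.reverse_nil, Nat.zero_add] at this
    simp [this]
  intro k
  induction k with
  | zero => simp
  | succ k ih =>
    intro i
    have := ih (i + 1)
    rw [List.range_succ] at this
    simp only [List.reverse_append, List.reverse_cons, List.reverse_nil, List.nil_append,
      List.cons_append] at this
    rw [List.replicate_succ, List.foldl_cons, this, add_right_comm, add_assoc i k 1]

theorem PT.nonempty {s : Set α} {l : α → List β} (hl : PT s l) :
    PT s fun a => !(l a).isEmpty := by
  refine PT.comp (t := Set.univ) (g := fun l : List β => !l.isEmpty) ?_ hl fun _ _ => trivial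
  refine computes_of (.ite 0 (.seq (.assign 0 .nil) (.assign 0 (.cons 0 0))) (.assign 0 .nil))
    (T := fun _ => 1 + 1 + (1 + 3) + 1) (.const _) fun l _ => Runs.ite (fun h => ?_) fun h => ?_
  · cases l with
    | nil => exact absurd rfl h
    | cons a l =>
      have := (Runs.assign 0 .nil (initStore (enc (a :: l)))).seq_pure
        (Runs.assign 0 (.cons 0 0) _).view (v := result)
      exact this
  · cases l with
    | nil =>
      exact ((Runs.assign 0 .nil (initStore (enc ([] : List β)))).view (v := result)).mono
        (by simp [Expr.eval, Data.size])
    | cons a l => exact absurd h (by rw [initStore_zero, enc_cons]; simp)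

theorem PT.lt {s : Set α} {f g : α → ℕ} (hf : PT s f) (hg : PT s g) :
    PT s fun a => decide (f a < g a) :=
  (hf.drop hg.units).nonempty.of_eq fun a _ => by
    by_cases h : f a < g a
    · simp [h]; omega
    · simp [h]; omega

end Library

/-! ### Actions on qubits -/

/-- A single action without result. -/
def act (o : QOp) : Eff Unit := [((), [o])]

/-- The measurement of a qubit. -/
def measure (q : QAddr) : Eff Bool := [(false, [.proj q false]), (true, [.proj q true])]

section Actions

variable {α β γ : Type} [ToData α] [ToData β] [ToData γ] {s : Set α}

theorem Computes.then {f : α → Eff β} {g : α → Eff γ} (hf : Computes s f) (hg : Computes s g) :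
    Computes s fun a => Eff.bind (f a) fun _ => g a :=
  hf.bind_keep (t := {p | p.1 ∈ s}) (k := fun a _ => g a) (hg.comp (PT.fst _) fun _ h => h)
    fun _ h _ _ => h

/-- Numbers are unary, so the variable that holds the input `i` already addresses qubit `i`.
Clearing it afterwards returns the encoding of the unit. -/
theorem computes_gate₁ (ρ : QReg) (G : {δ : Type} → δ → Gate δ)
    (hG : ∀ {δ ε : Type} (f : δ → ε) (i : δ), (G i).map f = G (f i)) :
    Computes Set.univ fun i : ℕ => act (.gate (G (ρ, i))) := by
  refine computes_of (.seq (.gate (G (ρ, 0))) (.assign 0 .nil)) (T := fun _ => 1 + 2) (.const _)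
    fun i _ => ?_
  have h := Runs.gate (G (ρ, 0)) (initStore (enc i))
  rw [hG, qaddr, initStore_zero, len_enc_nat] at h
  have h' := Runs.seq (out := act (.gate (G (ρ, i)))) (g := fun _ => initStore (enc i))
    (v := result) (T' := 2) (k := fun _ => Eff.pure .nil) h (d := .assign 0 .nil) fun o _ => by
      exact ((Runs.assign 0 .nil (initStore (enc i))).view (v := result))
  exact h'

theorem computes_H (ρ : QReg) {f : α → ℕ} (hf : PT s f) :
    Computes s fun a => act (.gate (.H (ρ, f a))) :=
  (computes_gate₁ ρ Gate.H fun _ _ => rfl).comp hf fun _ _ => trivial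

theorem computes_S (ρ : QReg) {f : α → ℕ} (hf : PT s f) :
    Computes s fun a => act (.gate (.S (ρ, f a))) :=
  (computes_gate₁ ρ Gate.S fun _ _ => rfl).comp hf fun _ _ => trivial

theorem computes_T (ρ : QReg) {f : α → ℕ} (hf : PT s f) :
    Computes s fun a => act (.gate (.T (ρ, f a))) :=
  (computes_gate₁ ρ Gate.T fun _ _ => rfl).comp hf fun _ _ => trivial

theorem computes_CX (ρ ρ' : QReg) {f g : α → ℕ} (hf : PT s f) (hg : PT s g) :
    Computes s fun a => act (.gate (.CX (ρ, f a) (ρ', g a))) := by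
  refine Computes.comp (t := Set.univ) (f := fun a => (f a, g a))
    (g := fun p : ℕ × ℕ => act (.gate (.CX (ρ, p.1) (ρ', p.2)))) ?_ (hf.prod hg) fun _ _ => trivial
  refine computes_of (.seq (.assign 1 (.hd 0)) (.seq (.assign 0 (.tl 0))
    (.seq (.gate (.CX (ρ, 1) (ρ', 0))) (.assign 0 .nil))))
    (T := fun p => 1 + (enc p.1).size + (1 + (enc p.2).size + (1 + 2)))
    (.add (.add (.const 1) (.of_size (PT.fst _))) (.add (.add (.const 1) (.of_size (PT.snd _)))
      (.const _))) fun p _ => ?_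
  obtain ⟨i, j⟩ := p
  have h1 := Runs.assign 1 (.hd 0) (initStore (enc (i, j)))
  rw [show (Expr.hd 0).eval (initStore (enc (i, j))) = enc i from rfl] at h1
  have h2 := Runs.assign 0 (.tl 0) (Function.update (initStore (enc (i, j))) 1 (enc i))
  rw [show (Expr.tl 0).eval _ = enc j from rfl] at h2
  refine h1.seq_pure (h2.seq_pure ?_)
  have h := Runs.gate (.CX (ρ, 1) (ρ', 0)) (Function.update (Function.update
    (initStore (enc (i, j))) 1 (enc i)) 0 (enc j))
  rw [Gate.map, qaddr, qaddr] at h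
  simp only [ne_eq, one_ne_zero, not_false_eq_true, Function.update_of_ne, Function.update_self,
    len_enc_nat] at h
  exact Runs.seq (out := act (.gate (.CX (ρ, i) (ρ', j)))) (g := fun _ => Function.update
    (Function.update (initStore (enc (i, j))) 1 (enc i)) 0 (enc j))
    (v := result) (T' := 2) (k := fun _ => Eff.pure .nil) h (d := .assign 0 .nil) fun o _ =>
      ((Runs.assign 0 .nil _).view (v := result))

theorem computes_measure (ρ : QReg) {f : α → ℕ} (hf : PT s f) :
    Computes s fun a => measure (ρ, f a) := by
  refine Computes.comp (t := Set.univ) (g := fun i : ℕ => measure (ρ, i)) ?_ hf fun _ _ => trivial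
  refine computes_of (.meas (ρ, 0) 0) (T := fun _ => 1) (.const _) fun i _ => ?_
  have h := (Runs.meas (ρ, 0) 0 (initStore (enc i))).view (v := result)
  rw [qaddr, initStore_zero, len_enc_nat] at h
  exact h

/-! ### Gates as data -/

/-- The number by which the kind of a gate is encoded. -/
def Gate.tag {δ : Type} : Gate δ → ℕ
  | .H _ => 0
  | .S _ => 1
  | .T _ => 2
  | .CX _ _ => 3

/-- The first qubit of a gate. -/
def Gate.fst {δ : Type} : Gate δ → δ
  | .H i => i
  | .S i => i
  | .T i => i
  | .CX i _ => i

/-- The last qubit of a gate. -/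
def Gate.snd {δ : Type} : Gate δ → δ
  | .H i => i
  | .S i => i
  | .T i => i
  | .CX _ j => j

theorem PT.gateH {f : α → ℕ} (hf : PT s f) : PT s fun a => Gate.H (f a) :=
  ((PT.const s 0).prod hf).congr fun _ _ => rfl

theorem PT.gateCX {f g : α → ℕ} (hf : PT s f) (hg : PT s g) : PT s fun a => Gate.CX (f a) (g a) :=
  ((PT.const s 3).prod (hf.prod hg)).congr fun _ _ => rfl

theorem PT.gateTag {g : α → Gate ℕ} (hg : PT s g) : PT s fun a => (g a).tag := by
  refine PT.comp (t := Set.univ) (g := fun g : Gate ℕ => g.tag) ?_ hg fun _ _ => trivial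
  refine PT.unary (.hd 0) (fun g _ => by cases g <;> rfl) fun g _ => ?_
  rw [show enc g.tag = (enc g).hd by cases g <;> rfl]
  exact (Data.hd_size_le _).trans (Nat.le_add_right _ 2)

theorem pt_gate_tl : PT Set.univ fun g : Gate ℕ => (enc g).tl :=
  PT.unary (.tl 0) (fun _ _ => rfl) fun g _ => (Data.tl_size_le (enc g)).trans (Nat.le_add_right _ 2)

theorem PT.gateFst {g : α → Gate ℕ} (hg : PT s g) : PT s fun a => (g a).fst := by
  refine PT.comp (t := Set.univ) (g := fun g : Gate ℕ => g.fst) ?_ hg fun _ _ => trivial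
  -- Only the tag of a controlled-not exceeds 2, and only then is the payload a pair of qubits.
  have h := PT.ite (PT.lt (PT.const Set.univ 2) (PT.gateTag (PT.id Set.univ)))
    (f := fun g : Gate ℕ => (enc g).tl.hd) (g := fun g : Gate ℕ => (enc g).tl)
    (PT.comp (g := Data.hd) (f := fun g : Gate ℕ => (enc g).tl) (t := Set.univ)
      (PT.unary (.hd 0) (fun d _ => rfl) fun d _ => (Data.hd_size_le d).trans (Nat.le_add_right _ 2))
      (pt_gate_tl.mono (Set.subset_univ _)) fun _ _ => trivial)
    (pt_gate_tl.mono (Set.subset_univ _))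
  exact h.congr fun g _ => by cases g <;> rfl

theorem PT.gateSnd {g : α → Gate ℕ} (hg : PT s g) : PT s fun a => (g a).snd := by
  refine PT.comp (t := Set.univ) (g := fun g : Gate ℕ => g.snd) ?_ hg fun _ _ => trivial
  have h := PT.ite (PT.lt (PT.const Set.univ 2) (PT.gateTag (PT.id Set.univ)))
    (f := fun g : Gate ℕ => (enc g).tl.tl) (g := fun g : Gate ℕ => (enc g).tl)
    (PT.comp (g := Data.tl) (f := fun g : Gate ℕ => (enc g).tl) (t := Set.univ)
      (PT.unary (.tl 0) (fun d _ => rfl) fun d _ => (Data.tl_size_le d).trans (Nat.le_add_right _ 2))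
      (pt_gate_tl.mono (Set.subset_univ _)) fun _ _ => trivial)
    (pt_gate_tl.mono (Set.subset_univ _))
  exact h.congr fun g _ => by cases g <;> rfl

theorem PT.gateMap {g : α → Gate ℕ} {f : α → ℕ → ℕ} (hg : PT s g)
    (hf : PT Set.univ fun p : α × ℕ => f p.1 p.2) : PT s fun a => (g a).map (f a) := by
  have h1 : PT s fun a => f a (g a).fst :=
    PT.comp (g := fun p : α × ℕ => f p.1 p.2) hf ((PT.id s).prod hg.gateFst) fun _ _ => trivial
  have h2 : PT s fun a => f a (g a).snd :=
    PT.comp (g := fun p : α × ℕ => f p.1 p.2) hf ((PT.id s).prod hg.gateSnd) fun _ _ => trivial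
  have h := PT.ite (PT.lt (PT.const s 2) hg.gateTag)
    (f := fun a => enc ((g a).tag, f a (g a).fst, f a (g a).snd))
    (g := fun a => enc ((g a).tag, f a (g a).fst))
    (((hg.gateTag.prod (h1.prod h2)).mono (Set.sep_subset _ _)).congr fun _ _ => rfl)
    (((hg.gateTag.prod h1).mono (Set.sep_subset _ _)).congr fun _ _ => rfl)
  exact h.congr fun a _ => by cases g a <;> rfl

/-- Apply a gate to the memory. -/
def applyGate (g : Gate ℕ) : Eff Unit := act (.gate (g.map fun i => (QReg.mem, i)))

theorem computes_applyGate : Computes Set.univ applyGate := by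
  have ht := PT.gateTag (PT.id (Set.univ : Set (Gate ℕ)))
  have hf := PT.gateFst (PT.id (Set.univ : Set (Gate ℕ)))
  have hs := PT.gateSnd (PT.id (Set.univ : Set (Gate ℕ)))
  have h := Computes.ite (PT.lt ht (PT.const _ 1)) ((computes_H .mem hf).mono (Set.subset_univ _))
    ((Computes.ite (PT.lt ht (PT.const _ 2)) ((computes_S .mem hf).mono (Set.subset_univ _))
    ((Computes.ite (PT.lt ht (PT.const _ 3)) ((computes_T .mem hf).mono (Set.subset_univ _))
    ((computes_CX .mem .mem hf hs).mono (Set.subset_univ _))).mono (Set.subset_univ _))).mono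
      (Set.subset_univ _))
  exact h.congr' fun g _ => by cases g <;> rfl

/-! ### Random bits -/

/-- A uniform bit, from a qubit that is initially zero, and zero again afterwards. -/
def sampleBit (i : ℕ) : Eff Bool :=
  [(false, [.gate (.H (.mem, i)), .proj (.mem, i) false]),
   (true, [.gate (.H (.mem, i)), .proj (.mem, i) true, .gate (.H (.mem, i)), .gate (.S (.mem, i)),
     .gate (.S (.mem, i)), .gate (.H (.mem, i))])]

theorem computes_sampleBit : Computes Set.univ sampleBit := by
  have h1 := computes_H .mem (PT.id Set.univ)
  have h2 := computes_measure .mem (PT.id Set.univ)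
  have hi := PT.fst (Set.univ : Set (ℕ × Bool))
  have h3 : Computes Set.univ fun p : ℕ × Bool => if p.2 then Eff.bind
      (act (.gate (.H (.mem, p.1)))) (fun _ => Eff.bind (act (.gate (.S (.mem, p.1)))) (fun _ =>
      Eff.bind (act (.gate (.S (.mem, p.1)))) fun _ => Eff.bind (act (.gate (.H (.mem, p.1))))
      fun _ => Eff.pure p.2)) else Eff.pure p.2 :=
    Computes.ite (PT.snd _) (((computes_H .mem hi).then ((computes_S .mem hi).then
      ((computes_S .mem hi).then ((computes_H .mem hi).then (PT.snd _))))).mono (Set.subset_univ _))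
      (PT.snd _)
  have := h1.then (h2.bind_keep (t := Set.univ) (k := fun i b => if b then Eff.bind
      (act (.gate (.H (.mem, i)))) (fun _ => Eff.bind (act (.gate (.S (.mem, i)))) (fun _ =>
      Eff.bind (act (.gate (.S (.mem, i)))) fun _ => Eff.bind (act (.gate (.H (.mem, i))))
      fun _ => Eff.pure b)) else Eff.pure b) h3 fun _ _ _ _ => trivial)
  exact this.congr' fun i _ => rfl

/-- `k` uniform bits. -/
def sampleBits (i k : ℕ) : Eff (List Bool) := Eff.traverse (fun _ => sampleBit i)
  (List.replicate k ())

theorem computes_sampleBits {f g : α → ℕ} (hf : PT s f) (hg : PT s g) :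
    Computes s fun a => sampleBits (f a) (g a) :=
  Computes.traverse hg.units (t := {p | p.1 ∈ s}) (f := fun a _ => sampleBit (f a))
    (computes_sampleBit.comp (hf.comp (PT.fst _) fun _ h => h) fun _ _ => trivial) fun _ h _ _ => h

/-! ### Circuits as data -/

/-- The circuit without the bounds on the wires. -/
def QCircuit.raw (F : QCircuit) : ℕ × ℕ × ℕ × List (Gate ℕ) × List ℕ :=
  (F.qin, F.cin, F.anc, F.gates.map (Gate.map Fin.val), F.out.map Fin.val)

theorem enc_gate_map {n : ℕ} (g : Gate (Fin n)) : enc (g.map Fin.val) = enc g := by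
  cases g <;> rfl

theorem QCircuit.enc_raw (F : QCircuit) : enc F.raw = enc F := by
  change enc _ = enc (F.qin, F.cin, F.anc, F.gates, F.out)
  simp only [QCircuit.raw, enc_pair]
  rw [enc_map_eq enc_gate_map, enc_map_eq (f := Fin.val) fun _ => rfl]

/-- The wire of `padCircuit` for a wire of a circuit with `q` quantum and `c` classical inputs. -/
def shiftNat (q c i : ℕ) : ℕ := if decide (i < q + c) then i else i + 2 * q

/-- The encryption of a qubit in `padCircuit`. -/
def padGates (q c i : ℕ) : List (Gate ℕ) :=
  [.H i, .CX (q + c + q + i) i, .H i, .CX (q + c + i) i]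

theorem map_flatMap' {α β γ : Type} (f : β → γ) (g : α → List β) (l : List α) :
    (l.flatMap g).map f = l.flatMap fun a => (g a).map f := List.map_flatMap ..

/-- Wires as plain numbers: in this form the padded circuit is assembled by list operations already
known to be computable. -/
theorem padCircuit_raw (V : QCircuit) : (padCircuit V).raw =
    (V.qin, V.cin + 2 * V.qin, V.anc,
      ((List.range V.qin).map (padGates V.qin V.cin)).flatten ++
        V.raw.2.2.2.1.map (Gate.map (shiftNat V.qin V.cin)),
      V.raw.2.2.2.2.map (shiftNat V.qin V.cin)) := by
  have hsh : ∀ i : Fin (V.qin + V.cin + V.anc), ((shiftWire V i : Fin _) : ℕ) =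
      shiftNat V.qin V.cin i := by
    intro i
    simp only [shiftWire, shiftNat, decide_eq_true_eq]
    split <;> rfl
  simp only [QCircuit.raw, padCircuit, List.map_append, List.map_map, Prod.mk.injEq, true_and]
  refine ⟨?_, ?_⟩
  · congr 1
    · rw [map_flatMap', ← List.map_coe_finRange_eq_range, List.map_map]
      rfl
    · apply List.map_congr_left
      intro g _
      cases g <;> simp [Gate.map, hsh]
  · apply List.map_congr_left
    intro i _
    simp [hsh]

theorem pt_padCircuit : PT Set.univ padCircuit := by
  have hr : PT Set.univ QCircuit.raw := PT.of_enc_eq fun F _ => F.enc_raw.symm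
  have hq : PT Set.univ fun V : QCircuit => V.qin := hr.fst'
  have hc : PT Set.univ fun V : QCircuit => V.cin := hr.snd'.fst'
  have hq2 : PT Set.univ fun V : QCircuit => 2 * V.qin := PT.mul (PT.const _ 2) hq
  have hsh : PT Set.univ fun p : QCircuit × ℕ => shiftNat p.1.qin p.1.cin p.2 := by
    have hq' := hq.comp (PT.fst (Set.univ : Set (QCircuit × ℕ))) fun _ _ => trivial
    have hc' := hc.comp (PT.fst (Set.univ : Set (QCircuit × ℕ))) fun _ _ => trivial
    exact PT.ite (PT.lt (PT.snd _) (hq'.add hc')) (PT.snd _)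
      (((PT.snd _).add ((PT.const _ 2).mul hq')).mono (Set.subset_univ _))
  have hpad : PT Set.univ fun p : QCircuit × ℕ => padGates p.1.qin p.1.cin p.2 := by
    have hq' := hq.comp (PT.fst (Set.univ : Set (QCircuit × ℕ))) fun _ _ => trivial
    have hc' := hc.comp (PT.fst (Set.univ : Set (QCircuit × ℕ))) fun _ _ => trivial
    have hi := PT.snd (Set.univ : Set (QCircuit × ℕ))
    exact hi.gateH.cons ((PT.gateCX (((hq'.add hc').add hq').add hi) hi).cons
      (hi.gateH.cons ((PT.gateCX ((hq'.add hc').add hi) hi).cons (PT.const _ []))))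
  have hg : PT Set.univ fun V : QCircuit => V.raw.2.2.2.1.map (Gate.map (shiftNat V.qin V.cin)) :=
    PT.map hr.snd'.snd'.snd'.fst' (f := fun V g => g.map (shiftNat V.qin V.cin)) (t := Set.univ)
      (PT.gateMap (f := fun (p : QCircuit × Gate ℕ) i => shiftNat p.1.qin p.1.cin i) (PT.snd _)
        (hsh.comp (f := fun p : (QCircuit × Gate ℕ) × ℕ => (p.1.1, p.2))
          ((PT.fst' (PT.fst _)).prod (PT.snd _)) fun _ _ => trivial)) fun _ _ _ _ => trivial
  have := hq.prod ((hc.add hq2).prod (hr.snd'.snd'.fst'.prod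
    (((PT.map hq.range (f := fun V i => padGates V.qin V.cin i) hpad
      fun _ _ _ _ => trivial).flatten.append hg).prod
    (PT.map hr.snd'.snd'.snd'.snd' (f := fun V i => shiftNat V.qin V.cin i) hsh
      fun _ _ _ _ => trivial))))
  exact this.congr fun V _ => by
    rw [← QCircuit.enc_raw, padCircuit_raw]; rfl

end Actions

/-! ### The programs of the prover -/

theorem shiftWire_injective (V : QCircuit) : Function.Injective (shiftWire V) := by
  intro i j h
  simp only [shiftWire] at h
  have hi := i.2
  have hj := j.2
  ext
  split_ifs at h with h1 h2 h2 <;> simp only [Fin.mk.injEq] at h <;> omega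

theorem padCircuit_wf {V : QCircuit} (hV : V.WF) : (padCircuit V).WF := by
  constructor
  · intro g hg
    rcases List.mem_append.1 hg with hg | hg
    · obtain ⟨i, -, hg⟩ := List.mem_flatMap.1 hg
      have hi := i.2
      rcases List.mem_cons.1 hg with rfl | hg
      · trivial
      rcases List.mem_cons.1 hg with rfl | hg
      · intro h
        have := congrArg Fin.val h
        change V.qin + V.cin + V.qin + (i : ℕ) = i at this
        omega
      rcases List.mem_cons.1 hg with rfl | hg
      · trivial
      rcases List.mem_singleton.1 hg with rfl
      intro h
      have := congrArg Fin.val h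
      change V.qin + V.cin + (i : ℕ) = i at this
      omega
    · obtain ⟨g, hg', rfl⟩ := List.mem_map.1 hg
      have := hV.gates g hg'
      cases g with
      | CX i j => exact fun h => this (shiftWire_injective V h)
      | _ => trivial
  · exact hV.out.map (shiftWire_injective V)

/-- The `j`-th block of length `l`. -/
def slice (l j : ℕ) (s : List Bool) : List Bool := (s.drop (j * l)).take l

theorem length_slice {l j : ℕ} {s : List Bool} (h : j * l + l ≤ s.length) :
    (slice l j s).length = l := by
  simp [slice]; omega

theorem PT.slice {α : Type} [ToData α] {s : Set α} {l j : α → ℕ} {f : α → List Bool}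
    (hl : PT s l) (hj : PT s j) (hf : PT s f) : PT s fun a => slice (l a) (j a) (f a) :=
  hl.take ((hj.mul hl).drop hf)

section Programs

variable (L : QMAProblem) (Q : QREScheme) (C : CommitScheme)

/-- Number of labels of each kind. -/
abbrev numLab (n : ℕ) : ℕ := (protF L n).cin
abbrev rLen (n : ℕ) : ℕ := Q.rlen n (protF L n)
abbrev hLen (n : ℕ) : ℕ := Q.hatLen n (protF L n)
abbrev lLen (n : ℕ) : ℕ := Q.labLen n (protF L n)
abbrev qWidth (n : ℕ) : ℕ := Q.width n (protF L n)
abbrev s₀Len (n : ℕ) : ℕ := C.rlen n (rLen L Q n)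
abbrev sLen (n : ℕ) : ℕ := C.rlen n (lLen L Q n)

theorem protF_wf (n : ℕ) : (protF L n).WF := padCircuit_wf (L.wf n)

theorem numLab_eq (n : ℕ) : numLab L n = n + 2 * L.m n := by
  change (L.circ n).cin + 2 * (L.circ n).qin = _
  rw [L.cin_eq]

theorem pt_protF : PT Set.univ fun n => protF L n :=
  pt_padCircuit.comp (pt_of_polyTimeOn L.uniform) fun _ _ => trivial

theorem pt_numLab : PT Set.univ (numLab L) :=
  PT.fst' (PT.snd' (PT.comp (PT.of_enc_eq (s := Set.univ) fun F _ => F.enc_raw.symm) (pt_protF L)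
    fun _ _ => trivial))

theorem pt_m : PT Set.univ fun n => L.m n :=
  PT.fst' (PT.comp (PT.of_enc_eq (s := Set.univ) fun F _ => F.enc_raw.symm) (pt_protF L)
    fun _ _ => trivial)

theorem pt_params : PT Set.univ fun n => (rLen L Q n, hLen L Q n, lLen L Q n, qWidth L Q n) :=
  PT.comp (pt_of_polyTimeOn (f := fun a : ℕ × QCircuit =>
      (Q.rlen a.1 a.2, Q.hatLen a.1 a.2, Q.labLen a.1 a.2, Q.width a.1 a.2)) Q.params_polyTime)
    ((PT.id _).prod (pt_protF L)) fun n _ => protF_wf L n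

theorem pt_rLen : PT Set.univ (rLen L Q) := (pt_params L Q).fst'
theorem pt_hLen : PT Set.univ (hLen L Q) := (pt_params L Q).snd'.fst'
theorem pt_lLen : PT Set.univ (lLen L Q) := (pt_params L Q).snd'.snd'.fst'
theorem pt_qWidth : PT Set.univ (qWidth L Q) := (pt_params L Q).snd'.snd'.snd'

theorem pt_s₀Len : PT Set.univ (s₀Len L Q C) :=
  PT.comp (pt_of_polyTimeOn (f := fun a : ℕ × ℕ => C.rlen a.1 a.2) C.rlen_polyTime)
    (f := fun n => (n, rLen L Q n)) ((PT.id _).prod (pt_rLen L Q)) fun _ _ => trivial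

theorem pt_sLen : PT Set.univ (sLen L Q C) :=
  PT.comp (pt_of_polyTimeOn (f := fun a : ℕ × ℕ => C.rlen a.1 a.2) C.rlen_polyTime)
    (f := fun n => (n, lLen L Q n)) ((PT.id _).prod (pt_lLen L Q)) fun _ _ => trivial

/-- The encoder, with numbers as wires. -/
def encoderGates (n : ℕ) (r : List Bool) : List (Gate ℕ) :=
  (Q.U n (protF L n) r).map (Gate.map Fin.val)

theorem pt_encoderGates : PT {a : ℕ × List Bool | a.2.length = rLen L Q a.1}
    fun a => encoderGates L Q a.1 a.2 := by
  have h := PT.comp (pt_of_polyTimeOn (f := fun a : ℕ × QCircuit × List Bool =>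
      enc (Q.U a.1 a.2.1 a.2.2)) Q.U_polyTime)
    (f := fun a : ℕ × List Bool => (a.1, protF L a.1, a.2))
    (s := {a : ℕ × List Bool | a.2.length = rLen L Q a.1})
    ((PT.fst _).prod (((pt_protF L).comp (PT.fst _) fun _ _ => trivial).prod (PT.snd _)))
    fun a ha => ⟨protF_wf L a.1, ha⟩
  exact h.congr fun a _ => (enc_map_eq enc_gate_map _).symm

/-! #### First message -/

/-- The qubit for the sampling of random bits. -/
abbrev scratch (n : ℕ) : ℕ := qWidth L Q n + L.m n

/-- The prover's coins, with `s_{i,b}` in one list. -/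
abbrev CoinBits : Type := List Bool × List Bool × List Bool

/-- Nested in the shape that `Computes.prod` produces. One scratch qubit suffices for all coins,
since `sampleBit` leaves it in the zero state. -/
def sampleCoins (n : ℕ) : Eff CoinBits :=
  (sampleBits (scratch L Q n) (rLen L Q n)).bind fun r =>
    ((sampleBits (scratch L Q n) (s₀Len L Q C n)).bind fun s₀ =>
      Eff.vmap (fun s => (s₀, s))
        (sampleBits (scratch L Q n) (2 * numLab L n * sLen L Q C n))).vmap fun s => (r, s)

/-- The coins have the right lengths. -/
def GoodCoins (n : ℕ) (ω : CoinBits) : Prop :=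
  ω.1.length = rLen L Q n ∧ ω.2.1.length = s₀Len L Q C n ∧
    ω.2.2.length = 2 * numLab L n * sLen L Q C n

theorem computes_sampleCoins : Computes Set.univ (sampleCoins L Q C) := by
  have hs : PT Set.univ (scratch L Q) := (pt_qWidth L Q).add (pt_m L)
  exact (computes_sampleBits hs (pt_rLen L Q)).prod ((computes_sampleBits hs (pt_s₀Len L Q C)).prod
    (computes_sampleBits hs (((PT.const _ 2).mul (pt_numLab L)).mul (pt_sLen L Q C))))

theorem length_of_mem_sampleBits {i k : ℕ} {o : List Bool × List QOp} (h : o ∈ sampleBits i k) :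
    o.1.length = k := by
  simpa using Eff.length_of_mem_traverse h

theorem goodCoins_of_mem {n : ℕ} {o : CoinBits × List QOp} (h : o ∈ sampleCoins L Q C n) :
    GoodCoins L Q C n o.1 := by
  obtain ⟨o₁, h₁, o₂, h₂, rfl⟩ := Eff.mem_bind.1 h
  obtain ⟨o₃, h₃, rfl⟩ := Eff.mem_vmap.1 h₂
  obtain ⟨o₄, h₄, o₅, h₅, rfl⟩ := Eff.mem_bind.1 h₃
  obtain ⟨o₆, h₆, rfl⟩ := Eff.mem_vmap.1 h₅
  exact ⟨length_of_mem_sampleBits h₁, length_of_mem_sampleBits h₄, length_of_mem_sampleBits h₆⟩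

/-- Turn the zero qubits `e₁`, `e₂` into EPR pairs. -/
def makeEPR (n : ℕ) : Eff (List Unit) :=
  Eff.traverse (fun i => (act (.gate (.H (.mem, qWidth L Q n + i)))).bind fun _ =>
    act (.gate (.CX (.mem, qWidth L Q n + i) (.mem, i)))) (List.range (L.m n))

/-- Apply the encoder to `e₂`. -/
def applyEncoder (n : ℕ) (r : List Bool) : Eff (List Unit) :=
  Eff.traverse applyGate (encoderGates L Q n r)

/-- Read the labels. -/
def readLabels (n : ℕ) : Eff (List Bool) :=
  Eff.traverse (fun i => measure (.mem, hLen L Q n + i))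
    (List.range (2 * numLab L n * lLen L Q n))

/-- The efficiency assumption on the encoder concerns the gates of `U_r`, not the function `Q.lab`.
The labels are therefore measured on the output wires; they are the same in every component of the
superposition, so the measurement disturbs nothing. -/
def prepare (n : ℕ) (r : List Bool) : Eff (List Bool) :=
  (makeEPR L Q n).bind fun _ => (applyEncoder L Q n r).bind fun _ => readLabels L Q n

theorem computes_prepare : Computes {a : ℕ × List Bool | a.2.length = rLen L Q a.1}
    fun a => prepare L Q a.1 a.2 := by
  have h1 : Computes Set.univ (makeEPR L Q) := by
    have hi := PT.snd (Set.univ : Set (ℕ × ℕ))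
    have hw : PT (Set.univ : Set (ℕ × ℕ)) fun p => qWidth L Q p.1 + p.2 :=
      ((pt_qWidth L Q).comp (PT.fst _) fun _ _ => trivial).add hi
    exact Computes.traverse (pt_m L).range (t := Set.univ)
      (f := fun n i => (act (.gate (.H (.mem, qWidth L Q n + i)))).bind fun _ =>
        act (.gate (.CX (.mem, qWidth L Q n + i) (.mem, i))))
      ((computes_H .mem hw).then (computes_CX .mem .mem hw hi)) fun _ _ _ _ => trivial
  have h2 : Computes {a : ℕ × List Bool | a.2.length = rLen L Q a.1}
      fun a => applyEncoder L Q a.1 a.2 :=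
    Computes.traverse (pt_encoderGates L Q) (t := Set.univ) (f := fun _ g => applyGate g)
      (computes_applyGate.comp (PT.snd _) fun _ _ => trivial) fun _ _ _ _ => trivial
  have h3 : Computes Set.univ (readLabels L Q) :=
    Computes.traverse (((PT.const _ 2).mul (pt_numLab L)).mul (pt_lLen L Q)).range (t := Set.univ)
      (f := fun n i => measure (.mem, hLen L Q n + i))
      (computes_measure .mem (((pt_hLen L Q).comp (PT.fst _) fun _ _ => trivial).add (PT.snd _)))
      fun _ _ _ _ => trivial
  exact (h1.comp (PT.fst _) fun _ _ => trivial).then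
    (h2.then (h3.comp (PT.fst _) fun _ _ => trivial))

theorem length_of_mem_prepare {n : ℕ} {r : List Bool} {o : List Bool × List QOp}
    (h : o ∈ prepare L Q n r) : o.1.length = 2 * numLab L n * lLen L Q n := by
  obtain ⟨o₁, -, o₂, h₂, rfl⟩ := Eff.mem_bind.1 h
  obtain ⟨o₃, -, o₄, h₄, rfl⟩ := Eff.mem_bind.1 h₂
  simpa using Eff.length_of_mem_traverse h₄

/-- The private classical data of the prover: instance length, coins, labels. -/
abbrev Private : Type := ℕ × CoinBits × List Bool

def GoodPrivate (st : Private) : Prop :=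
  GoodCoins L Q C st.1 st.2.1 ∧ st.2.2.length = 2 * numLab L st.1 * lLen L Q st.1

/-- The commitment to the `j`-th label. -/
def labelCom (st : Private) (j : ℕ) : List Bool :=
  C.com st.1 (slice (lLen L Q st.1) j st.2.2) (slice (sLen L Q C st.1) j st.2.1.2.2)

def commitments (st : Private) : List Bool × List (List Bool × List Bool) :=
  (C.com st.1 st.2.1.1 st.2.1.2.1, (List.range (numLab L st.1)).map fun i =>
    (labelCom L Q C st (2 * i), labelCom L Q C st (2 * i + 1)))

theorem block_le {j k l : ℕ} (h : j < k) : j * l + l ≤ k * l := by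
  rw [← Nat.succ_mul]; exact Nat.mul_le_mul_right l h

/-- The commitment is known to be computable only for random strings of the prescribed length; the
domain carries the lengths from which those of the slices follow. -/
theorem pt_labelCom : PT {p : Private × ℕ | GoodPrivate L Q C p.1 ∧ p.2 < 2 * numLab L p.1.1}
    fun p => labelCom L Q C p.1 p.2 := by
  have hn : PT {p : Private × ℕ | GoodPrivate L Q C p.1 ∧ p.2 < 2 * numLab L p.1.1}
    fun p => p.1.1 := PT.fst' (PT.fst _)
  refine PT.comp (pt_of_polyTimeOn (f := fun a : ℕ × List Bool × List Bool =>
      C.com a.1 a.2.1 a.2.2) C.com_polyTime)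
    (f := fun p : Private × ℕ => (p.1.1, slice (lLen L Q p.1.1) p.2 p.1.2.2,
      slice (sLen L Q C p.1.1) p.2 p.1.2.1.2.2))
    (hn.prod ((PT.slice ((pt_lLen L Q).comp hn fun _ _ => trivial) (PT.snd _)
      (PT.snd' (PT.snd' (PT.fst _)))).prod (PT.slice ((pt_sLen L Q C).comp hn fun _ _ => trivial)
      (PT.snd _) (PT.snd' (PT.snd' (PT.fst' (PT.snd' (PT.fst _)))))))) fun p hp => ?_
  have h1 : (slice (sLen L Q C p.1.1) p.2 p.1.2.1.2.2).length = sLen L Q C p.1.1 :=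
    length_slice (by rw [hp.1.1.2.2]; exact block_le hp.2)
  have h2 : (slice (lLen L Q p.1.1) p.2 p.1.2.2).length = lLen L Q p.1.1 :=
    length_slice (by rw [hp.1.2]; exact block_le hp.2)
  change (slice (sLen L Q C p.1.1) p.2 p.1.2.1.2.2).length =
    C.rlen p.1.1 (slice (lLen L Q p.1.1) p.2 p.1.2.2).length
  rw [h1, h2]

theorem pt_commitments : PT {st : Private | GoodPrivate L Q C st} (commitments L Q C) := by
  have hn : PT {st : Private | GoodPrivate L Q C st} fun st => st.1 := PT.fst _
  refine PT.prod ?_ (PT.map (((pt_numLab L).comp hn fun _ _ => trivial).range)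
    (f := fun st i => (labelCom L Q C st (2 * i), labelCom L Q C st (2 * i + 1)))
    (t := {p | GoodPrivate L Q C p.1 ∧ p.2 < numLab L p.1.1}) ?_ fun st hst i hi =>
      ⟨hst, List.mem_range.1 hi⟩)
  · refine PT.comp (pt_of_polyTimeOn (f := fun a : ℕ × List Bool × List Bool =>
      C.com a.1 a.2.1 a.2.2) C.com_polyTime)
      (f := fun st : Private => (st.1, st.2.1.1, st.2.1.2.1))
      (hn.prod ((PT.fst' (PT.fst' (PT.snd _))).prod (PT.fst' (PT.snd' (PT.fst' (PT.snd _))))))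
      fun st hst => ?_
    change st.2.1.2.1.length = C.rlen st.1 st.2.1.1.length
    rw [hst.1.1, hst.1.2.1]
  · have hi : PT {p : Private × ℕ | GoodPrivate L Q C p.1 ∧ p.2 < numLab L p.1.1}
      fun p => 2 * p.2 := (PT.const _ 2).mul (PT.snd _)
    refine PT.prod ((pt_labelCom L Q C).comp ((PT.fst _).prod hi) fun p hp => ⟨hp.1, ?_⟩)
      ((pt_labelCom L Q C).comp ((PT.fst _).prod (hi.add (PT.const _ 1))) fun p hp => ⟨hp.1, ?_⟩)
    · have := hp.2; dsimp only; omega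
    · have := hp.2; dsimp only; omega

/-- The first program of the prover: the message, and the data that the prover keeps. -/
def firstEff (n : ℕ) : Eff ((List Bool × List (List Bool × List Bool)) × Private) :=
  (sampleCoins L Q C n).bind fun ω => (prepare L Q n ω.1).vmap fun ℓ =>
    (commitments L Q C (n, ω, ℓ), (n, ω, ℓ))

theorem computes_firstEff : Computes Set.univ (firstEff L Q C) := by
  have h1 : Computes {p : ℕ × CoinBits | GoodCoins L Q C p.1 p.2} fun p => prepare L Q p.1 p.2.1 :=
    (computes_prepare L Q).comp (f := fun p : ℕ × CoinBits => (p.1, p.2.1))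
      ((PT.fst _).prod (PT.fst' (PT.snd _))) fun p hp => hp.1
  have hst : PT {q : (ℕ × CoinBits) × List Bool | GoodPrivate L Q C (q.1.1, q.1.2, q.2)}
      fun q => ((q.1.1, q.1.2, q.2) : Private) :=
    (PT.fst' (PT.fst _)).prod ((PT.snd' (PT.fst _)).prod (PT.snd _))
  have h2 : PT {q : (ℕ × CoinBits) × List Bool | GoodPrivate L Q C (q.1.1, q.1.2, q.2)}
      fun q => (commitments L Q C (q.1.1, q.1.2, q.2), ((q.1.1, q.1.2, q.2) : Private)) :=
    PT.prod (PT.comp (pt_commitments L Q C) hst fun _ h => h) hst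
  have h3 : Computes {p : ℕ × CoinBits | GoodCoins L Q C p.1 p.2} fun p =>
      (prepare L Q p.1 p.2.1).vmap fun ℓ =>
        (commitments L Q C (p.1, p.2, ℓ), ((p.1, p.2, ℓ) : Private)) := by
    refine (h1.keep.vmap h2 fun p hp o ho => ?_).congr' fun p _ => Eff.vmap_vmap _ _ _
    obtain ⟨o', ho', rfl⟩ := Eff.mem_vmap.1 ho
    exact ⟨hp, length_of_mem_prepare L Q ho'⟩
  have h4 := Computes.bind_keep (computes_sampleCoins L Q C)
    (t := {p : ℕ × CoinBits | GoodCoins L Q C p.1 p.2})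
    (k := fun n ω => (prepare L Q n ω.1).vmap fun ℓ =>
      (commitments L Q C (n, ω, ℓ), ((n, ω, ℓ) : Private)))
    h3 fun n _ o ho => goodCoins_of_mem L Q C ho
  exact h4.congr' fun n _ => rfl

/-! #### Third message -/

/-- The teleportation measurement, with outcomes `(u i, v i)`. -/
def bellMeasure (n : ℕ) : Eff (List (Bool × Bool)) :=
  Eff.traverse (fun i => (act (.gate (.CX (.wit, i) (.mem, qWidth L Q n + i)))).bind fun _ =>
    (act (.gate (.H (.wit, i)))).bind fun _ => (measure (.mem, qWidth L Q n + i)).bind fun u =>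
      (measure (.wit, i)).vmap fun v => (u, v)) (List.range (L.m n))

/-- The string `z = (x, u, v)`. -/
def selector (x : List Bool) (uv : List (Bool × Bool)) : List Bool :=
  x ++ uv.map Prod.fst ++ uv.map Prod.snd

/-- The opening of the `j`-th commitment. -/
def opening (st : Private) (j : ℕ) : List Bool × List Bool :=
  (slice (lLen L Q st.1) j st.2.2, slice (sLen L Q C st.1) j st.2.1.2.2)

def openAllData (st : Private) : Data :=
  enc ((st.2.1.1, st.2.1.2.1), (List.range (numLab L st.1)).map fun i =>
    (opening L Q C st (2 * i), opening L Q C st (2 * i + 1)))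

def openSomeData (st : Private) (z : List Bool) : Data :=
  enc ((List.range (numLab L st.1)).map fun i =>
    (z.getD i false, opening L Q C st (2 * i + (z.getD i false).toNat)))

/-- The second program of the prover, on the challenge, the instance, and the data that were kept. -/
def secondEff (a : (Bool × List Bool) × Private) : Eff Data :=
  if a.1.1 then (bellMeasure L Q a.2.1).vmap fun uv =>
    openSomeData L Q C a.2 (selector a.1.2 uv)
  else Eff.pure (openAllData L Q C a.2)

theorem pt_opening {α : Type} [ToData α] {s : Set α} {st : α → Private} {j : α → ℕ}
    (hst : PT s st) (hj : PT s j) : PT s fun a => opening L Q C (st a) (j a) := by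
  have hn := hst.fst'
  exact (PT.slice ((pt_lLen L Q).comp hn fun _ _ => trivial) hj hst.snd'.snd').prod
    (PT.slice ((pt_sLen L Q C).comp hn fun _ _ => trivial) hj hst.snd'.fst'.snd'.snd')

/-- The length condition makes `z = (x, u, v)` as long as the number of label pairs, so the default
value of `getD` is never reached. -/
theorem computes_secondEff :
    Computes {a : (Bool × List Bool) × Private | a.1.2.length = a.2.1} (secondEff L Q C) := by
  refine Computes.ite (PT.fst' (PT.fst _)) ?_ ?_
  · have h1 : Computes {a : (Bool × List Bool) × Private | a.1.2.length = a.2.1}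
        fun a => bellMeasure L Q a.2.1 := by
      have h : Computes Set.univ (bellMeasure L Q) := by
        have hi := PT.snd (Set.univ : Set (ℕ × ℕ))
        have hw : PT (Set.univ : Set (ℕ × ℕ)) fun p => qWidth L Q p.1 + p.2 :=
          ((pt_qWidth L Q).comp (PT.fst _) fun _ _ => trivial).add hi
        exact Computes.traverse (pt_m L).range (t := Set.univ)
          (f := fun n i => (act (.gate (.CX (.wit, i) (.mem, qWidth L Q n + i)))).bind fun _ =>
            (act (.gate (.H (.wit, i)))).bind fun _ =>
            (measure (.mem, qWidth L Q n + i)).bind fun u =>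
              (measure (.wit, i)).vmap fun v => (u, v))
          ((computes_CX .wit .mem hi hw).then ((computes_H .wit hi).then
            ((computes_measure .mem hw).prod (computes_measure .wit hi)))) fun _ _ _ _ => trivial
      exact h.comp (PT.fst' (PT.snd _)) fun _ _ => trivial
    have h2 : PT {p : ((Bool × List Bool) × Private) × List (Bool × Bool) |
        p.1.1.2.length = p.1.2.1 ∧ p.2.length = L.m p.1.2.1}
        fun p => openSomeData L Q C p.1.2 (selector p.1.1.2 p.2) := by
      have hz : PT {p : ((Bool × List Bool) × Private) × List (Bool × Bool) |
        p.1.1.2.length = p.1.2.1 ∧ p.2.length = L.m p.1.2.1} fun p => selector p.1.1.2 p.2 :=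
        ((PT.snd' (PT.fst' (PT.fst _))).append ((PT.snd _).map (f := fun _ (u : Bool × Bool) => u.1)
          (t := Set.univ) (PT.fst' (PT.snd _)) fun _ _ _ _ => trivial)).append
          ((PT.snd _).map (f := fun _ (u : Bool × Bool) => u.2)
          (t := Set.univ) (PT.snd' (PT.snd _)) fun _ _ _ _ => trivial)
      have hst : PT {p : ((Bool × List Bool) × Private) × List (Bool × Bool) |
        p.1.1.2.length = p.1.2.1 ∧ p.2.length = L.m p.1.2.1} fun p => p.1.2 := PT.snd' (PT.fst _)
      refine PT.map (f := fun p i => ((selector p.1.1.2 p.2).getD i false, opening L Q C p.1.2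
          (2 * i + ((selector p.1.1.2 p.2).getD i false).toNat)))
        (t := {q | (q.1.1.1.2.length = q.1.1.2.1 ∧ q.1.2.length = L.m q.1.1.2.1) ∧
          q.2 < numLab L q.1.1.2.1})
        (PT.range ((pt_numLab L).comp hst.fst' fun _ _ => trivial)) ?_ fun p hp i hi =>
          ⟨hp, List.mem_range.1 hi⟩
      have hb := PT.getD (PT.snd {q : (((Bool × List Bool) × Private) × List (Bool × Bool)) × ℕ |
          (q.1.1.1.2.length = q.1.1.2.1 ∧ q.1.2.length = L.m q.1.1.2.1) ∧
          q.2 < numLab L q.1.1.2.1}) (hz.comp (PT.fst _) fun _ h => h.1) false fun q hq => by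
        have h1 := hq.1.1
        have h2 := hq.1.2
        have h3 := hq.2
        rw [numLab_eq] at h3
        simp only [selector, List.length_append, List.length_map]
        omega
      refine hb.prod (pt_opening L Q C (hst.comp (PT.fst _) fun _ h => h.1)
        (((PT.const _ 2).mul (PT.snd _)).add ?_))
      exact (PT.ite hb (PT.const _ 1) (PT.const _ 0)).of_eq fun q _ => by
        cases (selector q.1.1.1.2 q.1.2).getD q.2 false <;> rfl
    exact (h1.keep.vmap (g := fun p : ((Bool × List Bool) × Private) × List (Bool × Bool) =>
      openSomeData L Q C p.1.2 (selector p.1.1.2 p.2)) h2 fun a ha o ho => by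
        obtain ⟨o', ho', rfl⟩ := Eff.mem_vmap.1 ho
        exact ⟨ha, by simpa using Eff.length_of_mem_traverse ho'⟩).mono (Set.sep_subset _ _) |>.congr'
      fun a _ => by rw [Eff.vmap_vmap]
  · refine PT.prod ((PT.fst' (PT.fst' (PT.snd' (PT.snd _)))).prod
      (PT.fst' (PT.snd' (PT.fst' (PT.snd' (PT.snd _))))))
      (PT.map (f := fun a i => (opening L Q C a.2 (2 * i), opening L Q C a.2 (2 * i + 1)))
        (t := Set.univ) (PT.range ((pt_numLab L).comp (PT.fst' (PT.snd _)) fun _ _ => trivial))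
        (PT.prod (pt_opening L Q C (PT.snd' (PT.fst _)) ((PT.const _ 2).mul (PT.snd _)))
          (pt_opening L Q C (PT.snd' (PT.fst _)) (((PT.const _ 2).mul (PT.snd _)).add
            (PT.const _ 1)))) fun _ _ _ _ => trivial)

end Programs

/-! ### Sums over branches -/

section Esum

variable {α β γ : Type} {E : Type} [AddCommMonoid E]

/-- Sum over the branches of a computation. -/
def esum (l : Eff β) (G : β → List QOp → E) : E := (l.map fun o => G o.1 o.2).sum

theorem esum_pure (b : β) (G : β → List QOp → E) : esum (Eff.pure b) G = G b [] := by
  simp [esum, Eff.pure]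

theorem esum_vmap (f : β → γ) (l : Eff β) (G : γ → List QOp → E) :
    esum (Eff.vmap f l) G = esum l fun b t => G (f b) t := by
  simp [esum, Eff.vmap, Function.comp_def]

theorem esum_bind (l : Eff β) (k : β → Eff γ) (G : γ → List QOp → E) :
    esum (Eff.bind l k) G = esum l fun b t => esum (k b) fun c t' => G c (t ++ t') := by
  induction l with
  | nil => rfl
  | cons o l ih =>
    have : Eff.bind (o :: l) k =
      ((k o.1).map fun o' => (o'.1, o.2 ++ o'.2)) ++ Eff.bind l k := rfl
    rw [this]
    simp only [esum, List.map_append, List.sum_append, List.map_cons, List.sum_cons] at ih ⊢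
    rw [ih]
    simp [Function.comp_def]

/-- If the trace of a branch is determined by the element and its result, then the branches of the
traversal correspond to the families `c` of results. -/
theorem esum_traverse [Fintype β] {f : α → Eff β} (tr : α → β → List QOp)
    (hf : ∀ (a : α) (G : β → List QOp → E), esum (f a) G = ∑ c, G c (tr a c))
    {k : ℕ} (g : Fin k → α) (G : List β → List QOp → E) :
    esum (Eff.traverse f (List.ofFn g)) G =
      ∑ c : Fin k → β, G (List.ofFn c) ((List.finRange k).flatMap fun i => tr (g i) (c i)) := by
  induction k generalizing G with
  | zero =>
    simp only [List.ofFn_zero, Eff.traverse, esum_pure, List.finRange_zero, List.flatMap_nil,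
      Finset.univ_unique, Finset.sum_singleton]
  | succ k ih =>
    rw [List.ofFn_succ, Eff.traverse, esum_bind, hf]
    simp only [esum_vmap, ih]
    rw [← (Fin.consEquiv fun _ => β).sum_comp, Fintype.sum_prod_type]
    refine Finset.sum_congr rfl fun c _ => Finset.sum_congr rfl fun cs _ => ?_
    simp [Fin.consEquiv, List.finRange_succ, List.flatMap_map]

theorem range_eq_ofFn (k : ℕ) : List.range k = List.ofFn fun i : Fin k => (i : ℕ) := by
  rw [List.ofFn_eq_map, List.map_coe_finRange_eq_range]

theorem replicate_eq_ofFn (k : ℕ) (a : α) : List.replicate k a = List.ofFn fun _ : Fin k => a := by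
  simp

theorem traverse_single (f : α → Eff β) (v : α → β) (tr : α → List QOp)
    (hf : ∀ a, f a = [(v a, tr a)]) (l : List α) :
    Eff.traverse f l = [(l.map v, l.flatMap tr)] := by
  induction l with
  | nil => rfl
  | cons a l ih => simp [Eff.traverse, ih, hf, Eff.bind, Eff.vmap]

end Esum

/-! ### Blocks of strings -/

/-- The concatenation of strings, in the order of the labels in `withLabels`. -/
def flatList {k l : ℕ} (s : Fin k → Bool → Fin l → Bool) : List Bool :=
  (List.ofFn fun i => List.ofFn (s i false) ++ List.ofFn (s i true)).flatten

theorem drop_flatten {α : Type} {d : ℕ} (L : List (List α)) (h : ∀ a ∈ L, a.length = d) (i : ℕ) :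
    L.flatten.drop (i * d) = (L.drop i).flatten := by
  induction i generalizing L with
  | zero => simp
  | succ i ih =>
    cases L with
    | nil => simp
    | cons a L =>
      have ha := h a (by simp)
      rw [List.flatten_cons, add_mul, one_mul, add_comm, ← List.drop_drop, List.drop_left' ha,
        ih L fun b hb => h b (by simp [hb]), List.drop_succ_cons]

theorem length_flatList {k l : ℕ} (s : Fin k → Bool → Fin l → Bool) :
    (flatList s).length = 2 * k * l := by
  simp only [flatList, List.length_flatten, List.map_ofFn]
  simp [Function.comp_def]
  ring

/-- The strings for index `i` occupy the blocks `2i` and `2i + 1`; flat lists of label or coin bits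
are addressed in this way by the programs. -/
theorem slice_flatList {k l : ℕ} (s : Fin k → Bool → Fin l → Bool) (i : Fin k) (b : Bool) :
    slice l (2 * i + b.toNat) (flatList s) = List.ofFn (s i b) := by
  have h1 : (flatList s).drop (i * (2 * l)) =
      (List.ofFn (s i false) ++ List.ofFn (s i true)) ++
        ((List.ofFn fun i => List.ofFn (s i false) ++ List.ofFn (s i true)).drop (i + 1)).flatten := by
    rw [flatList, drop_flatten (d := 2 * l)]
    · rw [List.drop_eq_getElem_cons (by simp), List.flatten_cons]
      simp
    · intro a ha
      obtain ⟨j, rfl⟩ := List.mem_ofFn.1 ha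
      simp; ring
  have h2 : (2 * i + b.toNat) * l = i * (2 * l) + b.toNat * l := by ring
  rw [slice, h2, ← List.drop_drop, h1]
  cases b
  · simp
  · simp

/-- The bits of the concatenation. -/
def flatBits {k l : ℕ} (s : Fin k → Bool → Fin l → Bool) : Fin (2 * k * l) → Bool :=
  fun j => (flatList s)[(j : ℕ)]'(by rw [length_flatList]; exact j.2)

theorem ofFn_flatBits {k l : ℕ} (s : Fin k → Bool → Fin l → Bool) :
    List.ofFn (flatBits s) = flatList s := by
  apply List.ext_getElem
  · simp [length_flatList]
  · intro i h1 h2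
    simp [flatBits]

/-- Slices recover the blocks, which gives injectivity, and both sides have the same number of
elements. Consequently one uniform flat string is the same as independent uniform strings `s_{i,b}`.
-/
theorem flatBits_bijective (k l : ℕ) :
    Function.Bijective (flatBits : (Fin k → Bool → Fin l → Bool) → _) := by
  rw [Fintype.bijective_iff_injective_and_card]
  refine ⟨fun s s' h => ?_, ?_⟩
  · have h' : flatList s = flatList s' := by rw [← ofFn_flatBits, h, ofFn_flatBits]
    funext i b
    have := slice_flatList s i b
    rw [h', slice_flatList] at this
    exact (List.ofFn_injective this).symm
  · simp only [Fintype.card_pi, Finset.prod_const, Finset.card_univ, Fintype.card_bool,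
      Fintype.card_fin, ← pow_mul]
    congr 1
    ring

theorem sum_flatBits {E : Type} [AddCommMonoid E] {k l : ℕ} (G : (Fin (2 * k * l) → Bool) → E) :
    ∑ c, G c = ∑ s : Fin k → Bool → Fin l → Bool, G (flatBits s) :=
  ((Equiv.ofBijective _ (flatBits_bijective k l)).sum_comp G).symm

/-! ### Actions on state vectors -/

section Update

variable {ι κ : Type}

/-- A controlled-not is an involution: as `i ≠ j`, the control bit is unchanged and the second
exclusive or undoes the first. -/
theorem xor_update_eq_iff [DecidableEq ι] {i j : ι} (hij : i ≠ j) (y y' : ι → Bool) :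
    y = Function.update y' j (xor (y' j) (y' i)) ↔
      y' = Function.update y j (xor (y j) (y i)) := by
  constructor <;>
  · rintro rfl
    ext k
    by_cases hk : k = j
    · subst hk; simp [Function.update_of_ne hij]
    · simp [Function.update_of_ne hk]

theorem extend_comp_self {f : κ → ι} (hf : f.Injective) (y : ι → Bool) :
    Function.extend f (y ∘ f) y = y := by
  ext i
  by_cases h : ∃ k, f k = i
  · obtain ⟨k, rfl⟩ := h
    rw [hf.extend_apply]; rfl
  · rw [Function.extend_apply' _ _ _ h]

theorem extend_comp {f : κ → ι} (hf : f.Injective) (z : κ → Bool) (y : ι → Bool) :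
    Function.extend f z y ∘ f = z := by
  ext k
  exact hf.extend_apply z y k

theorem extend_extend {f : κ → ι} (hf : f.Injective) (z z' : κ → Bool) (y : ι → Bool) :
    Function.extend f z' (Function.extend f z y) = Function.extend f z' y := by
  ext i
  by_cases h : ∃ k, f k = i
  · obtain ⟨k, rfl⟩ := h
    rw [hf.extend_apply, hf.extend_apply]
  · rw [Function.extend_apply' _ _ _ h, Function.extend_apply' _ _ _ h,
      Function.extend_apply' _ _ _ h]

theorem extend_update [DecidableEq ι] [DecidableEq κ] {f : κ → ι} (hf : f.Injective) (z : κ → Bool) (y : ι → Bool) (k : κ)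
    (b : Bool) : Function.extend f (Function.update z k b) y =
      Function.update (Function.extend f z y) (f k) b := by
  ext i
  by_cases h : ∃ k, f k = i
  · obtain ⟨k', rfl⟩ := h
    rw [hf.extend_apply]
    by_cases hk : k' = k
    · subst hk; simp
    · rw [Function.update_of_ne hk, Function.update_of_ne (hf.ne hk), hf.extend_apply]
  · rw [Function.extend_apply' _ _ _ h, Function.update_of_ne (fun h' => h ⟨k, h'.symm⟩),
      Function.extend_apply' _ _ _ h]

end Update

noncomputable section

section ActOn

variable {ι κ : Type} [Fintype κ] [DecidableEq κ]

/-- The operator `M` on the qubits `f`, applied to `ψ`. -/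
def actOn (f : κ → ι) (M : Op κ κ) (ψ : (ι → Bool) → ℂ) : (ι → Bool) → ℂ :=
  fun y => (M *ᵥ fun z => ψ (Function.extend f z y)) (y ∘ f)

theorem actOn_one {f : κ → ι} (hf : f.Injective) (ψ : (ι → Bool) → ℂ) : actOn f 1 ψ = ψ := by
  ext y
  rw [actOn, Matrix.one_mulVec, extend_comp_self hf]

theorem actOn_mul {f : κ → ι} (hf : f.Injective) (A B : Op κ κ) (ψ : (ι → Bool) → ℂ) :
    actOn f (A * B) ψ = actOn f A (actOn f B ψ) := by
  ext y
  simp only [actOn, ← Matrix.mulVec_mulVec, extend_comp hf, extend_extend hf]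

end ActOn

section Vectors

variable {ι κ : Type} [Fintype ι] [DecidableEq ι] [Fintype κ] [DecidableEq κ]

theorem onQubit_mulVec (u : Matrix Bool Bool ℂ) (i : ι) (ψ : (ι → Bool) → ℂ) (y : ι → Bool) :
    (onQubit u i *ᵥ ψ) y = ∑ b, u (y i) b * ψ (Function.update y i b) := by
  simp only [Matrix.mulVec, dotProduct, onQubit, Matrix.of_apply, ite_mul, zero_mul]
  rw [← Finset.sum_filter]
  symm
  refine Finset.sum_bij (fun b _ => Function.update y i b) (fun b _ => ?_) (fun b _ b' _ h => ?_)
    (fun y' hy' => ?_) fun b _ => by simp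
  · simp only [Finset.mem_filter, Finset.mem_univ, true_and]
    intro k hk
    rw [Function.update_of_ne hk]
  · simpa using congrFun h i
  · simp only [Finset.mem_filter, Finset.mem_univ, true_and] at hy'
    refine ⟨y' i, Finset.mem_univ _, ?_⟩
    ext k
    by_cases hk : k = i
    · subst hk; simp
    · rw [Function.update_of_ne hk, hy' k hk]

theorem CX_mulVec {i j : ι} (hij : i ≠ j) (ψ : (ι → Bool) → ℂ) (y : ι → Bool) :
    ((Gate.CX i j).mat *ᵥ ψ) y = ψ (Function.update y j (xor (y j) (y i))) := by
  rw [Gate.mat, if_neg hij]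
  simp only [Matrix.mulVec, dotProduct, Matrix.of_apply, xor_update_eq_iff hij y]
  rw [Finset.sum_eq_single (Function.update y j (xor (y j) (y i)))]
  · simp
  · intro y' _ h
    rw [if_neg h, zero_mul]
  · simp

theorem H_mulVec (i : ι) (ψ : (ι → Bool) → ℂ) (y : ι → Bool) :
    ((Gate.H i).mat *ᵥ ψ) y = (Real.sqrt 2 : ℂ)⁻¹ * (ψ (Function.update y i false) +
      (if y i then -1 else 1) * ψ (Function.update y i true)) := by
  rw [Gate.mat, onQubit_mulVec]
  rw [Fintype.sum_bool]
  cases h : y i <;> simp [div_eq_mul_inv] <;> ring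

theorem gatesMat_nil : gatesMat ([] : List (Gate ι)) = 1 := rfl

theorem foldl_mat_eq {X : Type} (F : X → Op ι ι) (l : List X) (M : Op ι ι) :
    l.foldl (fun U g => F g * U) M = l.foldl (fun U g => F g * U) 1 * M := by
  induction l generalizing M with
  | nil => simp
  | cons g l ih =>
    rw [List.foldl_cons, ih, List.foldl_cons, ih (F g * 1), mul_one, Matrix.mul_assoc]

theorem gatesMat_cons (g : Gate ι) (gs : List (Gate ι)) :
    gatesMat (g :: gs) = gatesMat gs * g.mat := by
  rw [gatesMat, List.foldl_cons, foldl_mat_eq, mul_one]; rfl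

theorem gatesMat_append (gs gs' : List (Gate ι)) :
    gatesMat (gs ++ gs') = gatesMat gs' * gatesMat gs := by
  rw [gatesMat, List.foldl_append, foldl_mat_eq]; rfl

theorem traceMat_nil (a : QAddr → Option ι) : traceMat a [] = 1 := rfl

theorem traceMat_cons (a : QAddr → Option ι) (o : QOp) (l : List QOp) :
    traceMat a (o :: l) = traceMat a l * o.mat a := by
  rw [traceMat, List.foldl_cons, foldl_mat_eq, mul_one]; rfl

theorem traceMat_append (a : QAddr → Option ι) (l l' : List QOp) :
    traceMat a (l ++ l') = traceMat a l' * traceMat a l := by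
  rw [traceMat, List.foldl_append, foldl_mat_eq]; rfl

theorem actOn_onQubit {f : κ → ι} (hf : f.Injective) (u : Matrix Bool Bool ℂ) (k : κ)
    (ψ : (ι → Bool) → ℂ) : actOn f (onQubit u k) ψ = onQubit u (f k) *ᵥ ψ := by
  ext y
  rw [actOn, onQubit_mulVec, onQubit_mulVec]
  simp only [extend_update hf, extend_comp_self hf, Function.comp_apply]

/-- Injectivity keeps distinct qubits distinct; the degenerate `CX i i` is the identity on both
sides. -/
theorem mat_map_mulVec {f : κ → ι} (hf : f.Injective) (g : Gate κ) (ψ : (ι → Bool) → ℂ) :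
    (g.map f).mat *ᵥ ψ = actOn f g.mat ψ := by
  cases g with
  | H i => exact (actOn_onQubit hf _ _ _).symm
  | S i => exact (actOn_onQubit hf _ _ _).symm
  | T i => exact (actOn_onQubit hf _ _ _).symm
  | CX i j =>
    by_cases hij : i = j
    · subst hij
      simp only [Gate.map, Gate.mat, if_true, Matrix.one_mulVec, actOn_one hf]
    · ext y
      rw [Gate.map, CX_mulVec (hf.ne hij), actOn, CX_mulVec hij, extend_update hf,
        extend_comp_self hf]
      rfl

theorem gatesMat_map_mulVec {f : κ → ι} (hf : f.Injective) (gs : List (Gate κ))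
    (ψ : (ι → Bool) → ℂ) : gatesMat (gs.map (Gate.map f)) *ᵥ ψ = actOn f (gatesMat gs) ψ := by
  induction gs generalizing ψ with
  | nil => rw [List.map_nil, gatesMat_nil, gatesMat_nil, Matrix.one_mulVec, actOn_one hf]
  | cons g gs ih =>
    rw [List.map_cons, gatesMat_cons, gatesMat_cons, ← Matrix.mulVec_mulVec, mat_map_mulVec hf, ih,
      actOn_mul hf]

end Vectors
end

noncomputable section

/-! ### The qubits of the prover -/

/-- The wires of the encoder, the halves `e₁`, the qubit for random bits, and the witness are
different qubits. -/
structure Layout (ι : Type) (W m : ℕ) where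
  wire : Fin W → ι
  half : Fin m → ι
  aux : ι
  wit : Fin m → ι
  wire_inj : wire.Injective
  half_inj : half.Injective
  wit_inj : wit.Injective
  wire_half : ∀ j i, wire j ≠ half i
  wire_aux : ∀ j, wire j ≠ aux
  wire_wit : ∀ j i, wire j ≠ wit i
  half_aux : ∀ i, half i ≠ aux
  half_wit : ∀ i j, half i ≠ wit j
  aux_wit : ∀ i, aux ≠ wit i

section EPR

variable {ι : Type} {W m : ℕ} (Λ : Layout ι W m)

/-- The state in which the pairs outside of `l` are (unnormalized) EPR pairs, and all other qubits
of the memory are zero. -/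
def eprVec (l : List (Fin m)) (z : Fin m → Bool) (y : ι → Bool) : ℂ :=
  open Classical in
  if (∀ i ∈ l, y (Λ.half i) = false) ∧
    (∀ j : Fin W, y (Λ.wire j) = if h : (j : ℕ) < m then
      (if ⟨j, h⟩ ∈ l then false else y (Λ.half ⟨j, h⟩)) else false) ∧
    y Λ.aux = false ∧ y ∘ Λ.wit = z then 1 else 0

/-- The creation of a pair read backwards: the amplitude at `y` comes from the string in which the
controlled-not is undone and the half is still zero. -/
theorem eprVec_step [DecidableEq ι] (hmW : m ≤ W) {i : Fin m} {l : List (Fin m)} (hi : i ∉ l) (z : Fin m → Bool)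
    (y : ι → Bool) :
    eprVec Λ (i :: l) z (Function.update (Function.update y (Λ.wire (i.castLE hmW))
      (xor (y (Λ.wire (i.castLE hmW))) (y (Λ.half i)))) (Λ.half i) false) = eprVec Λ l z y := by
  set w := Λ.wire (i.castLE hmW) with hw
  set y' := Function.update (Function.update y w (xor (y w) (y (Λ.half i)))) (Λ.half i) false
    with hy'
  have h1 : y' (Λ.half i) = false := by simp [hy']
  have h2 : ∀ k, k ≠ i → y' (Λ.half k) = y (Λ.half k) := by
    intro k hk
    rw [hy', Function.update_of_ne (Λ.half_inj.ne hk), Function.update_of_ne (Λ.wire_half _ _).symm]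
  have h3 : y' w = xor (y w) (y (Λ.half i)) := by
    rw [hy', Function.update_of_ne (Λ.wire_half _ _), Function.update_self]
  have h4 : ∀ j, j ≠ i.castLE hmW → y' (Λ.wire j) = y (Λ.wire j) := by
    intro j hj
    rw [hy', Function.update_of_ne (Λ.wire_half _ _), Function.update_of_ne (Λ.wire_inj.ne hj)]
  have h5 : y' Λ.aux = y Λ.aux := by
    rw [hy', Function.update_of_ne (Λ.half_aux _).symm, Function.update_of_ne (Λ.wire_aux _).symm]
  have h6 : y' ∘ Λ.wit = y ∘ Λ.wit := by
    ext k
    simp only [Function.comp_apply]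
    rw [hy', Function.update_of_ne (Λ.half_wit _ _).symm,
      Function.update_of_ne (Λ.wire_wit _ _).symm]
  unfold eprVec
  congr 1
  rw [h5, h6]
  simp only [List.forall_mem_cons, h1, true_and]
  refine propext (and_congr (forall₂_congr fun k hk => ?_) (and_congr_left fun _ =>
    forall_congr' fun j => ?_))
  · rw [h2 k (fun h => hi (h ▸ hk))]
  · by_cases hj : j = i.castLE hmW
    · subst hj
      have him : ((i.castLE hmW : Fin W) : ℕ) < m := i.2
      have hii : (⟨(i.castLE hmW : Fin W), him⟩ : Fin m) = i := rfl
      rw [← hw, h3, dif_pos him, dif_pos him, hii, if_pos (by simp), if_neg hi]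
      cases y w <;> cases y (Λ.half i) <;> simp
    · rw [h4 j hj]
      by_cases hjm : (j : ℕ) < m
      · have hne : (⟨j, hjm⟩ : Fin m) ≠ i := fun h => hj (by ext; simp [← h])
        rw [dif_pos hjm, dif_pos hjm, h2 _ hne]
        simp [hne]
      · rw [dif_neg hjm, dif_neg hjm]

theorem eprVec_nil (z : Fin m → Bool) (y : ι → Bool) :
    eprVec Λ [] z y =
      if y ∘ Λ.wire = padZero W (y ∘ Λ.half) ∧ y Λ.aux = false ∧ y ∘ Λ.wit = z then 1 else 0 := by
  unfold eprVec
  congr 1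
  simp [funext_iff, padZero]

/-- Applied to one half of maximally entangled pairs, an operator becomes a vector whose amplitudes
are its matrix entries: the wires give the row and the remaining halves give the column. -/
theorem actOn_eprVec (M : Op (Fin W) (Fin W)) (z : Fin m → Bool) (y : ι → Bool) :
    actOn Λ.wire M (eprVec Λ [] z) y =
      if y Λ.aux = false ∧ y ∘ Λ.wit = z then M (y ∘ Λ.wire) (padZero W (y ∘ Λ.half)) else 0 := by
  have h1 : ∀ x, Function.extend Λ.wire x y ∘ Λ.half = y ∘ Λ.half := fun x => by
    ext i
    exact Function.extend_apply' _ _ _ fun ⟨j, hj⟩ => Λ.wire_half _ _ hj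
  have h2 : ∀ x, Function.extend Λ.wire x y Λ.aux = y Λ.aux := fun x =>
    Function.extend_apply' _ _ _ fun ⟨j, hj⟩ => Λ.wire_aux _ hj
  have h3 : ∀ x, Function.extend Λ.wire x y ∘ Λ.wit = y ∘ Λ.wit := fun x => by
    ext i
    exact Function.extend_apply' _ _ _ fun ⟨j, hj⟩ => Λ.wire_wit _ _ hj
  simp only [actOn, Matrix.mulVec, dotProduct, eprVec_nil, extend_comp Λ.wire_inj, h1, h2, h3]
  split_ifs with h
  · simp [h]
  · refine Finset.sum_eq_zero fun x _ => ?_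
    rw [if_neg (fun h' => h h'.2), mul_zero]

end EPR

/-! ### The building blocks of the program as operators on state vectors. -/

section Trace

variable {ι : Type} [Fintype ι] [DecidableEq ι] {a : QAddr → Option ι}

theorem mat_H {q : QAddr} {i : ι} (h : a q = some i) : (QOp.gate (.H q)).mat a = (Gate.H i).mat := by
  simp [QOp.mat, Gate.resolve, h]

theorem mat_S {q : QAddr} {i : ι} (h : a q = some i) : (QOp.gate (.S q)).mat a = (Gate.S i).mat := by
  simp [QOp.mat, Gate.resolve, h]

theorem mat_CX {q q' : QAddr} {i j : ι} (h : a q = some i) (h' : a q' = some j) :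
    (QOp.gate (.CX q q')).mat a = (Gate.CX i j).mat := by
  simp [QOp.mat, Gate.resolve, h, h']

theorem proj_mulVec {q : QAddr} {i : ι} (h : a q = some i) (b : Bool) (ψ : (ι → Bool) → ℂ)
    (y : ι → Bool) : ((QOp.proj q b).mat a *ᵥ ψ) y = if y i = b then ψ y else 0 := by
  simp [QOp.mat, h, Matrix.mulVec_diagonal]

theorem S_mulVec (i : ι) (ψ : (ι → Bool) → ℂ) (y : ι → Bool) :
    ((Gate.S i).mat *ᵥ ψ) y = (if y i then Complex.I else 1) * ψ y := by
  rw [Gate.mat, onQubit_mulVec, Fintype.sum_bool]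
  have h : Function.update y i (y i) = y := Function.update_eq_self i y
  cases hi : y i <;> rw [hi] at h <;> simp [h]

/-- `1 / √2` -/
abbrev rt : ℂ := (Real.sqrt 2 : ℂ)⁻¹

theorem rt_sq : rt * rt = 1 / 2 := by
  rw [rt, ← mul_inv, ← Complex.ofReal_mul, Real.mul_self_sqrt (by norm_num)]
  norm_num

/-- The actions of `sampleBit` with the given result. -/
def sampleTrace (i : ℕ) : Bool → List QOp
  | false => [.gate (.H (.mem, i)), .proj (.mem, i) false]
  | true => [.gate (.H (.mem, i)), .proj (.mem, i) true, .gate (.H (.mem, i)),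
      .gate (.S (.mem, i)), .gate (.S (.mem, i)), .gate (.H (.mem, i))]

/-- On a zero qubit, a Hadamard gate gives both outcomes the amplitude `1/√2`. After outcome 1 the
gates `H S S H = H Z H = X` reset the qubit, so either branch multiplies the whole vector by the
same scalar. -/
theorem sampleTrace_mulVec {i : ℕ} {q : ι} (h : a (.mem, i) = some q) (b : Bool)
    {ψ : (ι → Bool) → ℂ} (hψ : ∀ y, y q = true → ψ y = 0) :
    traceMat a (sampleTrace i b) *ᵥ ψ = rt • ψ := by
  ext y
  have hy : Function.update y q (y q) = y := Function.update_eq_self q y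
  have h1 : ψ (Function.update y q true) = 0 := hψ _ (by simp)
  cases b
  · simp only [sampleTrace, traceMat_cons, traceMat_nil, Matrix.one_mul, ← Matrix.mulVec_mulVec,
      proj_mulVec h, mat_H h, H_mulVec, Pi.smul_apply, smul_eq_mul]
    cases hq : y q
    · rw [hq] at hy
      simp [hy, h1]
    · simp [hψ y hq]
  · simp only [sampleTrace, traceMat_cons, traceMat_nil, Matrix.one_mul, ← Matrix.mulVec_mulVec,
      proj_mulVec h, mat_H h, mat_S h, H_mulVec, S_mulVec, Pi.smul_apply, smul_eq_mul,
      Function.update_self, Function.update_idem, h1]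
    have h2 := rt_sq
    have h3 := Complex.I_mul_I
    cases hq : y q
    · rw [hq] at hy
      simp only [hy, Bool.false_eq_true, reduceIte]
      linear_combination (ψ y) * rt * h2 * 2 - ψ y * rt * rt * rt * h3
    · simp only [hψ y hq, Bool.false_eq_true, if_true, if_false]
      linear_combination (ψ (Function.update y q false)) * rt * rt * rt * h3

theorem traceMat_flatMap_smul {X : Type} (l : List X) (tr : X → List QOp) (c : ℂ)
    {ψ : (ι → Bool) → ℂ} (h : ∀ x ∈ l, traceMat a (tr x) *ᵥ ψ = c • ψ) :
    traceMat a (l.flatMap tr) *ᵥ ψ = c ^ l.length • ψ := by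
  induction l with
  | nil => simp [traceMat_nil]
  | cons x l ih =>
    rw [List.flatMap_cons, traceMat_append, ← Matrix.mulVec_mulVec, h x (by simp),
      Matrix.mulVec_smul, ih fun x hx => h x (by simp [hx]), smul_smul, List.length_cons, pow_succ']

theorem readTrace_mulVec {X : Type} (l : List X) (q : X → QAddr) (b : X → Bool) (p : X → ι)
    (h : ∀ x, a (q x) = some (p x)) (ψ : (ι → Bool) → ℂ) (y : ι → Bool) :
    (traceMat a (l.flatMap fun x => [.proj (q x) (b x)]) *ᵥ ψ) y =
      if ∀ x ∈ l, y (p x) = b x then ψ y else 0 := by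
  induction l generalizing ψ with
  | nil => simp [traceMat_nil]
  | cons x l ih =>
    rw [List.flatMap_cons, traceMat_append, ← Matrix.mulVec_mulVec, ih, traceMat_cons, traceMat_nil,
      Matrix.one_mul, proj_mulVec (h x)]
    simp only [List.forall_mem_cons]
    by_cases h1 : y (p x) = b x <;> by_cases h2 : ∀ x ∈ l, y (p x) = b x <;> simp [h1, h2]

variable {W m : ℕ} (Λ : Layout ι W m)

theorem gatesTrace_mulVec (ha : ∀ j : Fin W, a (.mem, j) = some (Λ.wire j))
    (gs : List (Gate (Fin W))) (ψ : (ι → Bool) → ℂ) :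
    traceMat a ((gs.map (Gate.map Fin.val)).flatMap fun g =>
      [.gate (g.map fun i => (QReg.mem, i))]) *ᵥ ψ = actOn Λ.wire (gatesMat gs) ψ := by
  rw [← gatesMat_map_mulVec Λ.wire_inj]
  congr 1
  induction gs with
  | nil => rfl
  | cons g gs ih =>
    rw [List.map_cons, List.flatMap_cons, traceMat_append, ih, List.map_cons, gatesMat_cons,
      traceMat_cons, traceMat_nil, Matrix.one_mul]
    congr 1
    cases g <;> simp [QOp.mat, Gate.resolve, Gate.map, ha]

/-- Induction over the pairs still to be created; each contributes `1/√2` from its Hadamard gate. -/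
theorem eprTrace_mulVec (hmW : m ≤ W) (ha : ∀ j : Fin W, a (.mem, j) = some (Λ.wire j))
    (hb : ∀ i : Fin m, a (.mem, W + i) = some (Λ.half i)) (z : Fin m → Bool) (l : List (Fin m))
    (hl : l.Nodup) :
    traceMat a (l.flatMap fun i : Fin m => [.gate (.H (.mem, W + i)),
      .gate (.CX (.mem, W + i) (.mem, i))]) *ᵥ eprVec Λ l z = rt ^ l.length • eprVec Λ [] z := by
  induction l with
  | nil => simp [traceMat_nil]
  | cons i l ih =>
    have hi : i ∉ l := (List.nodup_cons.1 hl).1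
    have h1 : traceMat a [.gate (.H (.mem, W + i)), .gate (.CX (.mem, W + i) (.mem, i))] *ᵥ
        eprVec Λ (i :: l) z = rt • eprVec Λ l z := by
      ext y
      have ha' : a (.mem, (i : ℕ)) = some (Λ.wire (i.castLE hmW)) := ha (i.castLE hmW)
      rw [traceMat_cons, traceMat_cons, traceMat_nil, Matrix.one_mul, ← Matrix.mulVec_mulVec,
        mat_H (hb i), mat_CX (hb i) ha', CX_mulVec (Λ.wire_half _ _).symm, H_mulVec,
        eprVec_step Λ hmW hi, Pi.smul_apply, smul_eq_mul]
      -- The other summand of the Hadamard gate vanishes, because half `i` starts as zero.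
      have : eprVec Λ (i :: l) z (Function.update (Function.update y (Λ.wire (i.castLE hmW))
          (xor (y (Λ.wire (i.castLE hmW))) (y (Λ.half i)))) (Λ.half i) true) = 0 := by
        rw [eprVec, if_neg]
        intro h
        simpa using h.1 i (by simp)
      rw [this, mul_zero, add_zero]
    rw [List.flatMap_cons, traceMat_append, ← Matrix.mulVec_mulVec, h1, Matrix.mulVec_smul,
      ih (List.nodup_cons.1 hl).2, smul_smul, List.length_cons, pow_succ']

/-- The state after the teleportation measurements with outcomes `u i`, `v i` of the pairs outside
of `l`, up to the normalization. -/
def bellVec (Φ : (Fin W → Bool) → (Fin m → Bool) → Bool → ℂ) (z u v : Fin m → Bool)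
    (l : List (Fin m)) (y : ι → Bool) : ℂ :=
  open Classical in
  if ∀ i, if i ∈ l then y (Λ.wit i) = z i else y (Λ.half i) = u i ∧ y (Λ.wit i) = v i then
    Φ (y ∘ Λ.wire) (fun i => if i ∈ l then y (Λ.half i) else xor (y (Λ.half i)) (z i)) (y Λ.aux)
  else 0

/-- For a witness in the basis state `z`, the controlled-not replaces the half `e` by `e ⊕ z`, so
outcome `u` selects the amplitude at `e = u ⊕ z`. The Hadamard gate followed by outcome `v`
contributes `1/√2` and the sign `(-1)^(v z)`. The amplitude `Φ` is arbitrary, and the pairs are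
treated one at a time. -/
theorem bellTrace_mulVec (Φ : (Fin W → Bool) → (Fin m → Bool) → Bool → ℂ) (z u v : Fin m → Bool)
    (hb : ∀ i : Fin m, a (.mem, W + i) = some (Λ.half i))
    (hc : ∀ i : Fin m, a (.wit, i) = some (Λ.wit i)) (l : List (Fin m)) (hl : l.Nodup) :
    traceMat a (l.flatMap fun i : Fin m => [.gate (.CX (.wit, i) (.mem, W + i)), .gate (.H (.wit, i)),
      .proj (.mem, W + i) (u i), .proj (.wit, i) (v i)]) *ᵥ bellVec Λ Φ z u v l =
    (rt ^ l.length * (l.map fun i => if v i && z i then (-1 : ℂ) else 1).prod) •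
      bellVec Λ Φ z u v [] := by
  induction l with
  | nil => simp [traceMat_nil]
  | cons i l ih =>
    have hi : i ∉ l := (List.nodup_cons.1 hl).1
    have h1 : traceMat a [.gate (.CX (.wit, i) (.mem, W + i)), .gate (.H (.wit, i)),
        .proj (.mem, W + i) (u i), .proj (.wit, i) (v i)] *ᵥ bellVec Λ Φ z u v (i :: l) =
        (rt * if v i && z i then (-1 : ℂ) else 1) • bellVec Λ Φ z u v l := by
      ext y
      simp only [traceMat_cons, traceMat_nil, Matrix.one_mul, ← Matrix.mulVec_mulVec,
        proj_mulVec (hb i), proj_mulVec (hc i), mat_H (hc i), mat_CX (hc i) (hb i), H_mulVec,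
        CX_mulVec (Λ.half_wit i i).symm, Pi.smul_apply, smul_eq_mul, Function.update_self,
        Function.update_of_ne (Λ.half_wit i i)]
      -- The Hadamard gate sums over the earlier value `b` of the witness bit. That value was `z i`,
      -- so one summand survives.
      have key : ∀ b, bellVec Λ Φ z u v (i :: l) (Function.update (Function.update y (Λ.wit i) b)
          (Λ.half i) (xor (y (Λ.half i)) b)) = if b = z i then
            (if ∀ k, k ≠ i → if k ∈ l then y (Λ.wit k) = z k else
              y (Λ.half k) = u k ∧ y (Λ.wit k) = v k then
              Φ (y ∘ Λ.wire) (fun k => if k ∈ l then y (Λ.half k) else xor (y (Λ.half k)) (z k))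
                (y Λ.aux)
            else 0) else 0 := by
        intro b
        set y' := Function.update (Function.update y (Λ.wit i) b)
          (Λ.half i) (xor (y (Λ.half i)) b) with hy'
        have e1 : y' (Λ.wit i) = b := by
          rw [hy', Function.update_of_ne (Λ.half_wit _ _).symm, Function.update_self]
        have e2 : y' (Λ.half i) = xor (y (Λ.half i)) b := by simp [hy']
        have e3 : ∀ k, k ≠ i → y' (Λ.wit k) = y (Λ.wit k) := fun k hk => by
          rw [hy', Function.update_of_ne (Λ.half_wit _ _).symm,
            Function.update_of_ne (Λ.wit_inj.ne hk)]
        have e4 : ∀ k, k ≠ i → y' (Λ.half k) = y (Λ.half k) := fun k hk => by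
          rw [hy', Function.update_of_ne (Λ.half_inj.ne hk),
            Function.update_of_ne (Λ.half_wit _ _)]
        have e5 : y' ∘ Λ.wire = y ∘ Λ.wire := by
          ext j
          simp only [Function.comp_apply]
          rw [hy', Function.update_of_ne (Λ.wire_half _ _), Function.update_of_ne (Λ.wire_wit _ _)]
        have e6 : y' Λ.aux = y Λ.aux := by
          rw [hy', Function.update_of_ne (Λ.half_aux _).symm, Function.update_of_ne (Λ.aux_wit _)]
        unfold bellVec
        by_cases hbz : b = z i
        · rw [if_pos hbz, e5, e6]
          have hf : (fun k => if k ∈ i :: l then y' (Λ.half k) else xor (y' (Λ.half k)) (z k)) =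
              fun k => if k ∈ l then y (Λ.half k) else xor (y (Λ.half k)) (z k) := by
            ext k
            by_cases hk : k = i
            · subst hk; simp [hi, e2, hbz]
            · simp [hk, e4 k hk]
          rw [hf]
          refine if_congr ⟨fun h k hk => ?_, fun h k => ?_⟩ rfl rfl
          · have := h k
            simpa [hk, e3 k hk, e4 k hk] using this
          · by_cases hk : k = i
            · subst hk; simp [e1, hbz]
            · have := h k hk
              simpa [hk, e3 k hk, e4 k hk] using this
        · rw [if_neg hbz, if_neg]
          intro h
          have := h i
          rw [if_pos (by simp), e1] at this
          exact hbz this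
      rw [key, key]
      unfold bellVec
      by_cases h2 : ∀ k, k ≠ i → if k ∈ l then y (Λ.wit k) = z k else
          y (Λ.half k) = u k ∧ y (Λ.wit k) = v k
      · have h3 : (∀ k, if k ∈ l then y (Λ.wit k) = z k else
            y (Λ.half k) = u k ∧ y (Λ.wit k) = v k) ↔ y (Λ.half i) = u i ∧ y (Λ.wit i) = v i := by
          constructor
          · intro h
            have := h i
            rwa [if_neg hi] at this
          · intro h k
            by_cases hk : k = i
            · subst hk; rwa [if_neg hi]
            · exact h2 k hk
        rw [if_pos h2]
        simp only [h3]
        by_cases h4 : y (Λ.wit i) = v i <;> by_cases h5 : y (Λ.half i) = u i <;>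
          cases hz : z i <;> simp [h4, h5]
      · have h3 : ¬ (∀ k, if k ∈ l then y (Λ.wit k) = z k else
            y (Λ.half k) = u k ∧ y (Λ.wit k) = v k) := fun h => h2 fun k _ => h k
        rw [if_neg h2, if_neg h3]
        simp
    rw [List.flatMap_cons, traceMat_append, ← Matrix.mulVec_mulVec, h1, Matrix.mulVec_smul,
      ih (List.nodup_cons.1 hl).2, smul_smul, List.length_cons, List.map_cons, List.prod_cons]
    congr 1
    ring

end Trace
end

noncomputable section

/-- The qubits of the prover: the wires of the encoder start with the message qubits. -/
def layout {h W : ℕ} (m : ℕ) (hW : h ≤ W) : Layout (Qubits h (W - h + m + 1) m) W m where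
  wire j := if hj : (j : ℕ) < h then .inl ⟨j, hj⟩ else .inr (.inl ⟨j - h, by omega⟩)
  half i := .inr (.inl ⟨W - h + i, by omega⟩)
  aux := .inr (.inl ⟨W - h + m, by omega⟩)
  wit i := .inr (.inr i)
  wire_inj i j hij := by
    dsimp only at hij
    ext
    split_ifs at hij with h1 h2 h2 <;> simp at hij <;> omega
  half_inj i j hij := by simp at hij; omega
  wit_inj i j hij := by simpa using hij
  wire_half i j hij := by
    split_ifs at hij with h1
    simp at hij; omega
  wire_aux i hij := by
    split_ifs at hij with h1
    simp at hij; omega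
  wire_wit i j hij := by
    split_ifs at hij with h1
    simp at hij
  half_aux i hij := by simp at hij; omega
  half_wit i j hij := by simp at hij
  aux_wit i hij := by simp at hij

/-! ### Addresses of the qubits, the initial state and the partial trace. -/

section Layout

variable {h W m : ℕ} (hW : h ≤ W)

theorem addrFirst_wire (j : Fin W) :
    addrFirst h (W - h + m + 1) m (.mem, j) = some ((layout m hW).wire j) := by
  simp only [addrFirst, layout]
  split_ifs <;> first | rfl | omega

theorem addrFirst_half (i : Fin m) :
    addrFirst h (W - h + m + 1) m (.mem, W + i) = some ((layout m hW).half i) := by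
  simp only [addrFirst, layout]
  rw [dif_neg (by omega), dif_pos (by omega)]
  simp only [Option.some.injEq, Sum.inr.injEq, Sum.inl.injEq, Fin.mk.injEq]
  omega

theorem addrFirst_aux :
    addrFirst h (W - h + m + 1) m (.mem, W + m) = some (layout m hW).aux := by
  simp only [addrFirst, layout]
  rw [dif_neg (by omega), dif_pos (by omega)]
  simp only [Option.some.injEq, Sum.inr.injEq, Sum.inl.injEq, Fin.mk.injEq]
  omega

theorem addrSecond_half (i : Fin m) :
    addrSecond h (W - h + m + 1) m (.mem, W + i) = some ((layout m hW).half i) := by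
  simp only [addrSecond, layout]
  rw [if_neg (by omega), dif_pos (by omega)]
  simp only [Option.some.injEq, Sum.inr.injEq, Sum.inl.injEq, Fin.mk.injEq]
  omega

theorem addrSecond_wit (i : Fin m) :
    addrSecond h (W - h + m + 1) m (.wit, i) = some ((layout m hW).wit i) := by
  simp only [addrSecond, layout]
  rw [dif_pos i.2]

theorem startIso_eq (y : Qubits h (W - h + m + 1) m → Bool) (z : Fin m → Bool) :
    startIso h (W - h + m + 1) m y z = eprVec (layout m hW) (List.finRange m) z y := by
  simp only [startIso, Matrix.of_apply, eprVec, List.mem_finRange, if_true]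
  refine if_congr ⟨fun ⟨h1, h2, h3⟩ => ⟨fun i _ => h2 _, fun j => ?_, h2 _, funext h3⟩,
    fun ⟨h1, h2, h3, h4⟩ => ⟨fun i => ?_, fun i => ?_, fun i => congrFun h4 i⟩⟩ rfl rfl
  · simp only [layout]
    split_ifs <;> first | exact h1 _ | exact h2 _
  · have := h2 ⟨i, by omega⟩
    simp only [layout] at this
    rw [dif_pos i.2] at this
    simpa using this
  -- A private qubit is a remaining wire of the encoder, the scratch qubit, or a first half of a
  -- pair.
  · have hi := i.2
    by_cases hi1 : (i : ℕ) < W - h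
    · have := h2 ⟨h + i, by omega⟩
      simp only [layout] at this
      rw [dif_neg (by omega)] at this
      simpa using this
    · by_cases hi2 : (i : ℕ) = W - h + m
      · rw [← h3]
        congr 3
        ext
        exact hi2
      · rw [← h1 ⟨i - (W - h), by omega⟩ trivial]
        simp only [layout]
        congr 3
        ext
        simp only; omega

theorem reduce_inl {k : ℕ} {κ : Type} [Fintype κ] [DecidableEq κ] (M : Op (Fin k ⊕ κ) (Fin k ⊕ κ))
    (a a' : Fin k → Bool) :
    reduce (fun i => Sum.inl i) M a a' = ∑ s : κ → Bool, M (Sum.elim a s) (Sum.elim a' s) := by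
  have h1 : ∀ y : Fin k ⊕ κ → Bool, (∑ y' : Fin k ⊕ κ → Bool,
      if y ∘ (fun i => Sum.inl i) = a ∧ y' ∘ (fun i => Sum.inl i) = a' ∧
        ∀ i, i ∉ Set.range (fun i : Fin k => (Sum.inl i : Fin k ⊕ κ)) → y i = y' i
      then M y y' else 0) =
      if y ∘ (fun i => Sum.inl i) = a then M y (Sum.elim a' (y ∘ Sum.inr)) else 0 := by
    intro y
    rw [Finset.sum_eq_single (Sum.elim a' (y ∘ Sum.inr))]
    · refine if_congr ⟨fun h => h.1, fun h => ⟨h, rfl, fun i hi => ?_⟩⟩ rfl rfl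
      cases i with
      | inl i => exact absurd ⟨i, rfl⟩ hi
      | inr i => rfl
    · intro y' _ hy'
      rw [if_neg]
      rintro ⟨-, h2, h3⟩
      refine hy' (funext fun i => ?_)
      cases i with
      | inl i => exact congrFun h2 i
      | inr i => exact (h3 (Sum.inr i) (by simp)).symm
    · simp
  simp only [reduce, Matrix.of_apply]
  refine (Finset.sum_congr rfl fun y _ => h1 y).trans ?_
  symm
  refine Finset.sum_of_injOn (Sum.elim a) ?_ (by simp) ?_ ?_
  · intro s _ s' _ h
    exact funext fun i => congrFun h (Sum.inr i)
  · intro y _ hy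
    rw [if_neg]
    rintro rfl
    exact hy ⟨y ∘ Sum.inr, by simp, Sum.elim_comp_inl_inr y⟩
  · intro s _
    exact (if_pos rfl).symm

end Layout

theorem rt_pow (m : ℕ) : rt ^ m = (Real.sqrt (2 ^ m) : ℂ)⁻¹ := by
  rw [rt, inv_pow]
  congr 1
  rw [Real.sqrt_eq_rpow, Real.sqrt_eq_rpow, ← Real.rpow_natCast, ← Complex.ofReal_pow,
    ← Real.rpow_natCast, ← Real.rpow_mul (by norm_num), ← Real.rpow_mul (by norm_num), mul_comm]

theorem conj_rt_pow (R : ℕ) : (starRingEnd ℂ) (rt ^ R) = rt ^ R := by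
  simp [rt]

theorem rt_pow_mul_self (R : ℕ) : rt ^ R * rt ^ R = ((2 ^ R : ℕ) : ℂ)⁻¹ := by
  rw [← mul_pow, rt_sq]; simp

/-! ### Amplitudes of the encoder in terms of `F̂₀`. -/

section Encoder

variable (L : QMAProblem) (Q : QREScheme) (n : ℕ) (r : List Bool)

theorem hLen_add_le : hLen L Q n + 2 * numLab L n * lLen L Q n ≤ qWidth L Q n :=
  Q.width_out n (protF L n) (protF_wf L n)

theorem hLen_le : hLen L Q n ≤ qWidth L Q n := (Nat.le_add_right _ _).trans (hLen_add_le L Q n)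

theorem m_le : L.m n ≤ qWidth L Q n := Q.width_in n (protF L n) (protF_wf L n)

theorem QREScheme.hat_apply (sec : ℕ) (F : QCircuit) (y : Fin (Q.hatLen sec F) → Bool)
    (e : Fin F.qin → Bool) :
    Q.hat sec F r y e = gatesMat (Q.U sec F r) (withLabels _ y (Q.lab sec F r)) (padZero _ e) := by
  simp [QREScheme.hat, Matrix.mul_apply, labelIso, zeroIso]

theorem withLabels_castLE {k₀ k κ N : ℕ} (hN : k₀ ≤ N) (y : Fin k₀ → Bool)
    (lab : Fin k → Bool → Fin κ → Bool) : withLabels N y lab ∘ Fin.castLE hN = y := by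
  ext j
  simp [withLabels]

theorem withLabels_add {k₀ k κ N : ℕ} (y : Fin k₀ → Bool) (lab : Fin k → Bool → Fin κ → Bool)
    (j : ℕ) (hj : k₀ + j < N) : withLabels N y lab ⟨k₀ + j, hj⟩ = (flatList lab).getD j false := by
  simp [withLabels, flatList]

/-- The labels. -/
abbrev labels : Fin (numLab L n) → Bool → Fin (lLen L Q n) → Bool := Q.lab n (protF L n) r

/-- The amplitude of the encoder, in terms of the quantum part of the encoding. -/
def encAmp (x : Fin (qWidth L Q n) → Bool) (e : Fin (L.m n) → Bool) : ℂ :=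
  open Classical in
  if x = withLabels _ (x ∘ Fin.castLE (hLen_le L Q n)) (labels L Q n r) then
    Q.hat n (protF L n) r (x ∘ Fin.castLE (hLen_le L Q n)) e else 0

/-- By `structured` the amplitude vanishes unless the output has the form `(y₀, labels, 0)`; on such
strings it is an entry of `hat`. -/
theorem encoder_apply (hr : r.length = rLen L Q n) (x : Fin (qWidth L Q n) → Bool)
    (e : Fin (L.m n) → Bool) :
    gatesMat (Q.U n (protF L n) r) x (padZero _ e) = encAmp L Q n r x e := by
  unfold encAmp
  split_ifs with h
  · exact (congrArg (fun x' => gatesMat (Q.U n (protF L n) r) x' (padZero _ e)) h).trans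
      (QREScheme.hat_apply Q r n (protF L n) _ e).symm
  · by_contra h'
    obtain ⟨y₀, rfl⟩ := Q.structured n (protF L n) (protF_wf L n) r hr e x h'
    exact h (by rw [withLabels_castLE])

/-- The private qubits after the encoder, if the remaining halves of the EPR pairs hold `e`. -/
def privBits (e : Fin (L.m n) → Bool) :
    Fin (qWidth L Q n - hLen L Q n + L.m n + 1) → Bool := fun i =>
  if (i : ℕ) < qWidth L Q n - hLen L Q n then (flatList (labels L Q n r)).getD i false else
    if h : (i : ℕ) - (qWidth L Q n - hLen L Q n) < L.m n then e ⟨_, h⟩ else false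

theorem wire_elim (y₀ : Fin (hLen L Q n) → Bool)
    (p : Fin (qWidth L Q n - hLen L Q n + L.m n + 1) → Bool) (t : Fin (L.m n) → Bool) :
    (Sum.elim y₀ (Sum.elim p t) ∘ (layout (L.m n) (hLen_le L Q n)).wire) ∘
      Fin.castLE (hLen_le L Q n) = y₀ := by
  ext j
  simp [layout]

/-- The condition on labels and zeroes concerns exactly the wires beyond `F̂₀`, which are the first
private qubits; the message qubits are unrestricted. -/
theorem encAmp_elim (y₀ : Fin (hLen L Q n) → Bool)
    (p : Fin (qWidth L Q n - hLen L Q n + L.m n + 1) → Bool) (t e : Fin (L.m n) → Bool) :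
    encAmp L Q n r (Sum.elim y₀ (Sum.elim p t) ∘ (layout (L.m n) (hLen_le L Q n)).wire) e =
      if ∀ i : Fin (qWidth L Q n - hLen L Q n + L.m n + 1),
          (i : ℕ) < qWidth L Q n - hLen L Q n → p i = (flatList (labels L Q n r)).getD i false then
        Q.hat n (protF L n) r y₀ e else 0 := by
  unfold encAmp
  rw [wire_elim]
  refine if_congr ⟨fun h i hi => ?_, fun h => ?_⟩ rfl rfl
  · have hj : hLen L Q n + i < qWidth L Q n := by omega
    have := congrFun h ⟨hLen L Q n + i, hj⟩
    rw [withLabels_add] at this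
    rw [← this]
    simp [layout]
  · ext j
    by_cases hj : (j : ℕ) < hLen L Q n
    · have : withLabels (qWidth L Q n) y₀ (labels L Q n r) j = y₀ ⟨j, hj⟩ := by
        simp [withLabels, hj]
      rw [this]
      simp [layout, hj]
    · obtain ⟨i, hi⟩ : ∃ i, (j : ℕ) = hLen L Q n + i := ⟨j - hLen L Q n, by omega⟩
      have hj' : j = ⟨hLen L Q n + i, hi ▸ j.2⟩ := Fin.ext hi
      have hj2 := j.2
      have := h ⟨i, by omega⟩ (by dsimp only; omega)
      rw [hj', withLabels_add, ← this]
      simp [layout]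

end Encoder
end

noncomputable section

/-! ### Branches of the prover's programs -/

/-- The actions of `sampleBits` with the given result. -/
def sampleBitsTrace (i : ℕ) {k : ℕ} (c : Fin k → Bool) : List QOp :=
  (List.finRange k).flatMap fun j => sampleTrace i (c j)

section Sums

variable {E : Type} [AddCommMonoid E]

theorem esum_sampleBits (i k : ℕ) (G : List Bool → List QOp → E) :
    esum (sampleBits i k) G = ∑ c : Fin k → Bool, G (List.ofFn c) (sampleBitsTrace i c) := by
  rw [sampleBits, replicate_eq_ofFn, esum_traverse (tr := fun _ b => sampleTrace i b)]
  · rfl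
  · intro _ G
    simp [esum, sampleBit, sampleTrace, add_comm]

theorem esum_singleton {β : Type} (b : β) (t : List QOp) (G : β → List QOp → E) :
    esum [(b, t)] G = G b t := by
  simp [esum]

theorem esum_measure (q : QAddr) (G : Bool → List QOp → E) :
    esum (measure q) G = ∑ b, G b [.proj q b] := by
  simp [esum, measure, add_comm]

variable (L : QMAProblem) (Q : QREScheme) (C : CommitScheme)

/-- The actions of `prepare` if the labels are read as `ℓ`. -/
def prepareTrace (n : ℕ) (r : List Bool) (ℓ : Fin (2 * numLab L n * lLen L Q n) → Bool) :
    List QOp :=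
  ((List.finRange (L.m n)).flatMap fun i => [.gate (.H (.mem, qWidth L Q n + i)),
      .gate (.CX (.mem, qWidth L Q n + i) (.mem, i))]) ++
    (((encoderGates L Q n r).flatMap fun g => [.gate (g.map fun i => (QReg.mem, i))]) ++
    (List.finRange _).flatMap fun j => [.proj (.mem, hLen L Q n + j) (ℓ j)])

theorem esum_prepare (n : ℕ) (r : List Bool) (G : List Bool → List QOp → E) :
    esum (prepare L Q n r) G = ∑ ℓ, G (List.ofFn ℓ) (prepareTrace L Q n r ℓ) := by
  rw [prepare, esum_bind, makeEPR, traverse_single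
    (f := fun i => (act (.gate (.H (.mem, qWidth L Q n + i)))).bind fun _ =>
      act (.gate (.CX (.mem, qWidth L Q n + i) (.mem, i)))) (v := fun _ => ())
    (tr := fun i => [.gate (.H (.mem, qWidth L Q n + i)),
      .gate (.CX (.mem, qWidth L Q n + i) (.mem, i))]) (hf := fun i => rfl)]
  rw [esum_singleton, esum_bind, applyEncoder, traverse_single (f := applyGate) (v := fun _ => ())
    (tr := fun g => [.gate (g.map fun i => (QReg.mem, i))]) (hf := fun g => rfl)]
  rw [esum_singleton, readLabels, range_eq_ofFn, esum_traverse
    (tr := fun j b => [.proj (.mem, hLen L Q n + j) b])]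
  · rw [← List.map_coe_finRange_eq_range, List.flatMap_map]
    rfl
  · intro j G
    exact esum_measure _ _

/-- The actions of the first program. -/
def firstTrace (n : ℕ) (r : Fin (rLen L Q n) → Bool) (s₀ : Fin (s₀Len L Q C n) → Bool)
    (s : Fin (2 * numLab L n * sLen L Q C n) → Bool)
    (ℓ : Fin (2 * numLab L n * lLen L Q n) → Bool) : List QOp :=
  (sampleBitsTrace (scratch L Q n) r ++ (sampleBitsTrace (scratch L Q n) s₀ ++
    sampleBitsTrace (scratch L Q n) s)) ++ prepareTrace L Q n (List.ofFn r) ℓ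

theorem esum_firstEff (n : ℕ)
    (G : (List Bool × List (List Bool × List Bool)) × Private → List QOp → E) :
    esum (firstEff L Q C n) G = ∑ r, ∑ s₀, ∑ s, ∑ ℓ,
      G (commitments L Q C (n, (List.ofFn r, List.ofFn s₀, List.ofFn s), List.ofFn ℓ),
        (n, (List.ofFn r, List.ofFn s₀, List.ofFn s), List.ofFn ℓ))
        (firstTrace L Q C n r s₀ s ℓ) := by
  rw [firstEff, esum_bind, sampleCoins, esum_bind, esum_sampleBits]
  refine Finset.sum_congr rfl fun r _ => ?_
  rw [esum_vmap, esum_bind, esum_sampleBits]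
  refine Finset.sum_congr rfl fun s₀ _ => ?_
  rw [esum_vmap, esum_sampleBits]
  refine Finset.sum_congr rfl fun s _ => ?_
  rw [esum_vmap, esum_prepare]
  rfl

/-- The actions of the teleportation measurement. -/
def bellTrace (n : ℕ) (u v : Fin (L.m n) → Bool) : List QOp :=
  (List.finRange (L.m n)).flatMap fun i : Fin (L.m n) => [.gate (.CX (.wit, i) (.mem, qWidth L Q n + i)),
    .gate (.H (.wit, i)), .proj (.mem, qWidth L Q n + i) (u i), .proj (.wit, i) (v i)]

theorem esum_bellMeasure (n : ℕ) (G : List (Bool × Bool) → List QOp → E) :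
    esum (bellMeasure L Q n) G = ∑ u, ∑ v,
      G (List.ofFn fun i => (u i, v i)) (bellTrace L Q n u v) := by
  rw [bellMeasure, range_eq_ofFn, esum_traverse
    (tr := fun i c => [.gate (.CX (.wit, i) (.mem, qWidth L Q n + i)),
    .gate (.H (.wit, i)), .proj (.mem, qWidth L Q n + i) c.1, .proj (.wit, i) c.2])]
  · rw [← (Equiv.arrowProdEquivProdArrow (Fin (L.m n)) (fun _ => Bool) (fun _ => Bool)).symm.sum_comp,
      Fintype.sum_prod_type]
    rfl
  · intro i G
    simp only [esum_bind, esum_vmap, esum_measure, Fintype.sum_prod_type]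
    simp [act, esum]

end Sums

/-! ### States of the branches -/

section States

variable (L : QMAProblem) (Q : QREScheme) (C : CommitScheme) (n : ℕ)

theorem sampleBitsTrace_mulVec {ι : Type} [Fintype ι] [DecidableEq ι] {a : QAddr → Option ι}
    {i : ℕ} {q : ι} (h : a (.mem, i) = some q) {k : ℕ} (c : Fin k → Bool) {ψ : (ι → Bool) → ℂ}
    (hψ : ∀ y, y q = true → ψ y = 0) : traceMat a (sampleBitsTrace i c) *ᵥ ψ = rt ^ k • ψ := by
  rw [sampleBitsTrace, traceMat_flatMap_smul _ _ rt fun j _ => sampleTrace_mulVec h (c j) hψ,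
    List.length_finRange]

/-- The qubits of the prover. -/
abbrev Λ : Layout (Qubits (hLen L Q n) (qWidth L Q n - hLen L Q n + L.m n + 1) (L.m n))
    (qWidth L Q n) (L.m n) := layout (L.m n) (hLen_le L Q n)

/-- The number of random bits. -/
abbrev numCoins : ℕ := rLen L Q n + s₀Len L Q C n + 2 * numLab L n * sLen L Q C n

/-- After the encoder the state is supported on strings that contain the true labels, so reading `ℓ`
either leaves it unchanged or annihilates it. -/
theorem prepareTrace_mulVec (r : List Bool) (hr : r.length = rLen L Q n)
    (ℓ : Fin (2 * numLab L n * lLen L Q n) → Bool) (z : Fin (L.m n) → Bool) :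
    traceMat (addrFirst (hLen L Q n) (qWidth L Q n - hLen L Q n + L.m n + 1) (L.m n))
      (prepareTrace L Q n r ℓ) *ᵥ eprVec (Λ L Q n) (List.finRange _) z =
    if ℓ = flatBits (labels L Q n r) then fun y =>
      if y (Λ L Q n).aux = false ∧ y ∘ (Λ L Q n).wit = z then
        rt ^ L.m n * encAmp L Q n r (y ∘ (Λ L Q n).wire) (y ∘ (Λ L Q n).half) else 0
    else 0 := by
  have hw := addrFirst_wire (m := L.m n) (hLen_le L Q n)
  have hlt : ∀ j : Fin (2 * numLab L n * lLen L Q n), hLen L Q n + j < qWidth L Q n := fun j => by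
    have := hLen_add_le L Q n
    have := j.2
    omega
  rw [prepareTrace, traceMat_append, traceMat_append, ← Matrix.mulVec_mulVec,
    eprTrace_mulVec (Λ L Q n) (m_le L Q n) hw (addrFirst_half (hLen_le L Q n)) z _
      (List.nodup_finRange _), ← Matrix.mulVec_mulVec, Matrix.mulVec_smul, Matrix.mulVec_smul,
    encoderGates, gatesTrace_mulVec (Λ L Q n) hw]
  ext y
  rw [Pi.smul_apply, smul_eq_mul, readTrace_mulVec (List.finRange _) _ ℓ
    (fun j => (Λ L Q n).wire ⟨hLen L Q n + j, hlt j⟩) (fun j => hw ⟨_, hlt j⟩), actOn_eprVec,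
    List.length_finRange]
  rw [show gatesMat (Q.U n (protF L n) r) (y ∘ (Λ L Q n).wire) (padZero _ (y ∘ (Λ L Q n).half)) = _
    from encoder_apply L Q n r hr _ _]
  -- Where the amplitude is nonzero the label wires spell the true labels, so the condition of the
  -- reading no longer depends on `y`.
  have key : encAmp L Q n r (y ∘ (Λ L Q n).wire) (y ∘ (Λ L Q n).half) ≠ 0 →
      ((∀ j ∈ List.finRange _, y ((Λ L Q n).wire ⟨hLen L Q n + j, hlt j⟩) = ℓ j) ↔
        ℓ = flatBits (labels L Q n r)) := by
    intro h
    have h1 : y ∘ (Λ L Q n).wire = withLabels _ ((y ∘ (Λ L Q n).wire) ∘ Fin.castLE (hLen_le L Q n))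
        (labels L Q n r) := by
      by_contra h'
      exact h (if_neg h')
    have h2 : ∀ j : Fin (2 * numLab L n * lLen L Q n),
        y ((Λ L Q n).wire ⟨hLen L Q n + j, hlt j⟩) = flatBits (labels L Q n r) j := by
      intro j
      have := congrFun h1 ⟨hLen L Q n + j, hlt j⟩
      rw [withLabels_add] at this
      rw [← Function.comp_apply (f := y), this, flatBits]
      rw [List.getD_eq_getElem?_getD, List.getElem?_eq_getElem (by rw [length_flatList]; exact j.2)]
      rfl
    simp only [h2, List.mem_finRange, forall_true_left, funext_iff, eq_comm]
  by_cases h0 : encAmp L Q n r (y ∘ (Λ L Q n).wire) (y ∘ (Λ L Q n).half) = 0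
  · rw [h0]
    split_ifs <;> simp_all
  · simp only [key h0]
    split_ifs with h1 h2 <;> simp_all

/-- The scratch qubit is zero in the initial state, and sampling only rescales that state. The coins
thus contribute a scalar and leave the preparation unaffected. -/
theorem firstTrace_mulVec (r : Fin (rLen L Q n) → Bool) (s₀ : Fin (s₀Len L Q C n) → Bool)
    (s : Fin (2 * numLab L n * sLen L Q C n) → Bool)
    (ℓ : Fin (2 * numLab L n * lLen L Q n) → Bool) (z : Fin (L.m n) → Bool) :
    traceMat (addrFirst (hLen L Q n) (qWidth L Q n - hLen L Q n + L.m n + 1) (L.m n))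
      (firstTrace L Q C n r s₀ s ℓ) *ᵥ eprVec (Λ L Q n) (List.finRange _) z =
    rt ^ numCoins L Q C n • if ℓ = flatBits (labels L Q n (List.ofFn r)) then fun y =>
      if y (Λ L Q n).aux = false ∧ y ∘ (Λ L Q n).wit = z then
        rt ^ L.m n * encAmp L Q n (List.ofFn r) (y ∘ (Λ L Q n).wire) (y ∘ (Λ L Q n).half) else 0
    else 0 := by
  have haux : addrFirst (hLen L Q n) (qWidth L Q n - hLen L Q n + L.m n + 1) (L.m n)
      (.mem, scratch L Q n) = some (Λ L Q n).aux := addrFirst_aux (m := L.m n) (hLen_le L Q n)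
  have hψ : ∀ y, y (Λ L Q n).aux = true → eprVec (Λ L Q n) (List.finRange _) z y = 0 := by
    intro y hy
    rw [eprVec, if_neg]
    rintro ⟨-, -, h, -⟩
    rw [hy] at h
    exact absurd h (by simp)
  rw [firstTrace, traceMat_append, traceMat_append, traceMat_append, ← Matrix.mulVec_mulVec,
    ← Matrix.mulVec_mulVec, ← Matrix.mulVec_mulVec, sampleBitsTrace_mulVec haux r hψ]
  simp only [Matrix.mulVec_smul]
  rw [sampleBitsTrace_mulVec haux s₀ hψ]
  simp only [Matrix.mulVec_smul]
  rw [sampleBitsTrace_mulVec haux s hψ]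
  simp only [Matrix.mulVec_smul]
  rw [prepareTrace_mulVec L Q n _ List.length_ofFn ℓ z, smul_smul, smul_smul, ← pow_add, ← pow_add]

end States
end

noncomputable section

/-! ### Partial traces of branch operators. -/

section Reduce

variable {k m : ℕ} {κ : Type} [Fintype κ] [DecidableEq κ]

theorem mul_mul_conjTranspose_apply {α β γ : Type} [Fintype β] (K : Matrix α β ℂ) (K' : Matrix γ β ℂ)
    (w : Matrix β β ℂ) (y : α) (y' : γ) :
    (K * w * K'ᴴ) y y' = ∑ z, ∑ z', K y z * w z z' * (starRingEnd ℂ) (K' y' z') := by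
  simp only [Matrix.mul_apply, Finset.sum_mul, Matrix.conjTranspose_apply]
  rw [Finset.sum_comm]
  rfl

/-- If all qubits outside the message end in one basis state, the partial trace has a single term
and is a plain conjugation. -/
theorem reduce_of_single {K : Op (Fin k ⊕ κ) (Fin m)} {s₁ : κ → Bool} {c : ℂ}
    {T : Op (Fin k) (Fin m)}
    (hK : ∀ a s z, K (Sum.elim a s) z = if s = s₁ then c * T a z else 0) (w : Op (Fin m) (Fin m)) :
    reduce (fun i => Sum.inl i) (K * w * Kᴴ) =
      (c * (starRingEnd ℂ) c) • (T * w * Tᴴ) := by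
  ext a a'
  rw [reduce_inl, Finset.sum_eq_single s₁]
  · rw [mul_mul_conjTranspose_apply, Matrix.smul_apply, mul_mul_conjTranspose_apply, smul_eq_mul,
      Finset.mul_sum]
    refine Finset.sum_congr rfl fun z _ => ?_
    rw [Finset.mul_sum]
    refine Finset.sum_congr rfl fun z' _ => ?_
    rw [hK, hK, if_pos rfl, if_pos rfl, map_mul]
    ring
  · intro s _ hs
    rw [mul_mul_conjTranspose_apply]
    refine Finset.sum_eq_zero fun z _ => Finset.sum_eq_zero fun z' _ => ?_
    rw [hK, if_neg hs, zero_mul, zero_mul]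
  · simp

/-- An untouched witness register contributes its trace when it is discarded, while the private
qubits remain as the index of a mixture. -/
theorem reduce_of_keep {p : ℕ} {K : Op (Fin k ⊕ Fin p ⊕ Fin m) (Fin m)} {c : ℂ}
    {g : (Fin p → Bool) → (Fin k → Bool) → ℂ}
    (hK : ∀ a s t z, K (Sum.elim a (Sum.elim s t)) z = if t = z then c * g s a else 0)
    (w : Op (Fin m) (Fin m)) :
    reduce (fun i => Sum.inl i) (K * w * Kᴴ) =
      (c * (starRingEnd ℂ) c * w.trace) •
        Matrix.of fun a a' => ∑ s, g s a * (starRingEnd ℂ) (g s a') := by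
  ext a a'
  rw [reduce_inl, ← (Equiv.sumArrowEquivProdArrow (Fin p) (Fin m) Bool).symm.sum_comp,
    Fintype.sum_prod_type]
  simp only [Matrix.smul_apply, Matrix.of_apply, smul_eq_mul, Finset.mul_sum]
  refine Finset.sum_congr rfl fun s _ => ?_
  rw [Matrix.trace, Finset.mul_sum, Finset.sum_mul]
  refine Finset.sum_congr rfl fun t _ => ?_
  change (K * w * Kᴴ) (Sum.elim a (Sum.elim s t)) (Sum.elim a' (Sum.elim s t)) = _
  rw [mul_mul_conjTranspose_apply, Finset.sum_eq_single t, Finset.sum_eq_single t]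
  · rw [hK, hK, if_pos rfl, if_pos rfl, map_mul, Matrix.diag_apply]
    ring
  · intro z _ hz
    rw [hK a' s t z, if_neg (Ne.symm hz), map_zero, mul_zero]
  · simp
  · intro z _ hz
    refine Finset.sum_eq_zero fun z' _ => ?_
    rw [hK, if_neg (Ne.symm hz), zero_mul, zero_mul]
  · simp

end Reduce

/-! ### The state of the message at the end of each branch. -/

section BranchStates

variable (L : QMAProblem) (Q : QREScheme) (C : CommitScheme) (n : ℕ)

theorem eq_privBits_iff (r : List Bool) (e : Fin (L.m n) → Bool)
    (p : Fin (qWidth L Q n - hLen L Q n + L.m n + 1) → Bool) :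
    p = privBits L Q n r e ↔
      (∀ i : Fin (qWidth L Q n - hLen L Q n + L.m n + 1), (i : ℕ) < qWidth L Q n - hLen L Q n →
        p i = (flatList (labels L Q n r)).getD i false) ∧
      (∀ i : Fin (L.m n), p ⟨qWidth L Q n - hLen L Q n + i, by omega⟩ = e i) ∧
      p ⟨qWidth L Q n - hLen L Q n + L.m n, by omega⟩ = false := by
  constructor
  · rintro rfl
    refine ⟨fun i hi => by rw [privBits, if_pos hi], fun i => ?_, ?_⟩
    · simp [privBits]
    · simp [privBits]
  · rintro ⟨h1, h2, h3⟩
    ext i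
    rw [privBits]
    split_ifs with h4 h5
    · exact h1 i h4
    · rw [← h2]
      congr 1
      ext
      simp only; omega
    · rw [← h3]
      congr 1
      ext
      simp only; omega

/-- The Bell vector forces `e = z ⊕ u`, so one term of the sum remains, with the two normalizations
of the Bell state and of the EPR pairs. -/
theorem teleport_apply (r : Fin (rLen L Q n) → Bool) (u v : Fin (L.m n) → Bool)
    (y : Fin (hLen L Q n) → Bool) (z : Fin (L.m n) → Bool) :
    teleport L Q n r u v y z = rt ^ L.m n * (∏ i, if v i && z i then (-1 : ℂ) else 1) *
      (rt ^ L.m n * Q.hat n (protF L n) (List.ofFn r) y fun i => xor (z i) (u i)) := by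
  simp only [teleport, Matrix.of_apply, bell, sharedState]
  rw [Finset.sum_eq_single fun i => xor (z i) (u i)]
  · rw [if_pos rfl, ← rt_pow, map_mul, conj_rt_pow, map_prod]
    congr 2
    refine Finset.prod_congr rfl fun i _ => ?_
    split_ifs <;> simp
  · intro e _ he
    rw [if_neg he]
    simp
  · simp

/-- The operator of a branch. -/
abbrev branchOp (t₁ t₂ : List QOp) :
    Op (Qubits (hLen L Q n) (qWidth L Q n - hLen L Q n + L.m n + 1) (L.m n)) (Fin (L.m n)) :=
  traceMat (addrSecond _ _ _) t₂ * traceMat (addrFirst _ _ _) t₁ * startIso _ _ _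

theorem branchOp_apply (t₁ t₂ : List QOp)
    (y : Qubits (hLen L Q n) (qWidth L Q n - hLen L Q n + L.m n + 1) (L.m n) → Bool)
    (z : Fin (L.m n) → Bool) :
    branchOp L Q n t₁ t₂ y z = (traceMat (addrSecond _ _ _) t₂ *ᵥ
      (traceMat (addrFirst _ _ _) t₁ *ᵥ eprVec (Λ L Q n) (List.finRange _) z)) y := by
  have : (fun y => startIso (hLen L Q n) (qWidth L Q n - hLen L Q n + L.m n + 1) (L.m n) y z) =
      eprVec (Λ L Q n) (List.finRange _) z := funext fun y => startIso_eq (hLen_le L Q n) y z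
  rw [← this, Matrix.mulVec_mulVec]
  rfl

variable (r : Fin (rLen L Q n) → Bool) (s₀ : Fin (s₀Len L Q C n) → Bool)
  (s : Fin (2 * numLab L n * sLen L Q C n) → Bool)

theorem branchOp_wrong_labels {ℓ : Fin (2 * numLab L n * lLen L Q n) → Bool}
    (hℓ : ℓ ≠ flatBits (labels L Q n (List.ofFn r))) (t₂ : List QOp) :
    branchOp L Q n (firstTrace L Q C n r s₀ s ℓ) t₂ = 0 := by
  ext y z
  rw [branchOp_apply, firstTrace_mulVec, if_neg hℓ, smul_zero, Matrix.mulVec_zero]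
  rfl

/-- On challenge 0 the witness stays untouched and contributes its trace 1; discarding the halves
`e₁` yields the sum over `e`. The coins contribute `1/√2` twice each, in the operator and its
adjoint, hence the factor `2^(-numCoins)`. -/
theorem reduce_openAll (w : Op (Fin (L.m n)) (Fin (L.m n))) (hw : w.trace = 1) :
    let K := branchOp L Q n (firstTrace L Q C n r s₀ s (flatBits (labels L Q n (List.ofFn r)))) []
    reduce (fun i => Sum.inl i) (K * w * Kᴴ) =
      ((2 ^ numCoins L Q C n : ℕ) : ℂ)⁻¹ • Matrix.of fun y y' =>
        ∑ e, sharedState L Q n r e y * (starRingEnd ℂ) (sharedState L Q n r e y') := by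
  intro K
  classical
  -- The private string must be the one determined by its own bits at the positions of the halves.
  have hK : ∀ a p t z, K (Sum.elim a (Sum.elim p t)) z = if t = z then rt ^ numCoins L Q C n *
      (if p = privBits L Q n (List.ofFn r)
        (fun i : Fin (L.m n) => p ⟨qWidth L Q n - hLen L Q n + i, by omega⟩) then
        sharedState L Q n r (fun i : Fin (L.m n) => p ⟨qWidth L Q n - hLen L Q n + i, by omega⟩) a else 0)
      else 0 := by
    intro a p t z
    refine (branchOp_apply L Q n _ _ _ z).trans ?_
    rw [firstTrace_mulVec, traceMat_nil, Matrix.one_mulVec, if_pos rfl,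
      Pi.smul_apply, smul_eq_mul, encAmp_elim]
    have h1 : Sum.elim a (Sum.elim p t) (Λ L Q n).aux =
        p ⟨qWidth L Q n - hLen L Q n + L.m n, by omega⟩ := rfl
    have h2 : Sum.elim a (Sum.elim p t) ∘ (Λ L Q n).wit = t := rfl
    have h3 : Sum.elim a (Sum.elim p t) ∘ (Λ L Q n).half =
        fun i : Fin (L.m n) => p ⟨qWidth L Q n - hLen L Q n + i, by omega⟩ := rfl
    rw [h1, h2, h3]
    simp only [eq_privBits_iff, implies_true, true_and, sharedState, ← rt_pow]
    by_cases hz : t = z <;> by_cases h4 : p ⟨qWidth L Q n - hLen L Q n + L.m n, by omega⟩ = false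
    · rw [if_pos ⟨h4, hz⟩, if_pos hz]
      simp only [h4, and_true]
      split_ifs <;> simp
    · rw [if_neg (fun h => h4 h.1), if_pos hz, if_neg (fun h => h4 h.2)]
    · rw [if_neg (fun h => hz h.2), if_neg hz, mul_zero]
    · rw [if_neg (fun h => hz h.2), if_neg hz, mul_zero]
  rw [reduce_of_keep hK w, hw, mul_one, conj_rt_pow, rt_pow_mul_self]
  congr 1
  ext y y'
  simp only [Matrix.of_apply]
  have hp : ∀ e : Fin (L.m n) → Bool, (fun i : Fin (L.m n) => privBits L Q n (List.ofFn r) e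
      ⟨qWidth L Q n - hLen L Q n + i, by omega⟩) = e := fun e =>
    funext ((eq_privBits_iff L Q n _ e _).1 rfl).2.1
  symm
  -- Only the strings `privBits e` contribute, so the sum over private strings becomes the sum over
  -- `e`.
  refine Finset.sum_of_injOn (privBits L Q n (List.ofFn r)) ?_ (by simp) ?_ ?_
  · intro e _ e' _ h
    rw [← hp e, h, hp]
  · intro p _ h
    rw [if_neg (fun h' => h ⟨_, by simp, h'.symm⟩), zero_mul]
  · intro e _
    rw [hp, if_pos rfl, if_pos rfl]

/-- After the Bell measurement everything outside the message is in a known basis state: labels,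
zeroes, `u` on the halves and `v` on the witness. Hence `reduce_of_single` applies. -/
theorem reduce_openSome (w : Op (Fin (L.m n)) (Fin (L.m n))) (u v : Fin (L.m n) → Bool) :
    let K := branchOp L Q n (firstTrace L Q C n r s₀ s (flatBits (labels L Q n (List.ofFn r))))
      (bellTrace L Q n u v)
    reduce (fun i => Sum.inl i) (K * w * Kᴴ) = ((2 ^ numCoins L Q C n : ℕ) : ℂ)⁻¹ •
      (teleport L Q n r u v * w * (teleport L Q n r u v)ᴴ) := by
  intro K
  classical
  set Φ : (Fin (qWidth L Q n) → Bool) → (Fin (L.m n) → Bool) → Bool → ℂ := fun x e b =>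
    if b = false then rt ^ L.m n * encAmp L Q n (List.ofFn r) x e else 0 with hΦ
  have hK : ∀ a t z, K (Sum.elim a t) z =
      if t = Sum.elim (privBits L Q n (List.ofFn r) u) v then
        rt ^ numCoins L Q C n * teleport L Q n r u v a z else 0 := by
    intro a t z
    obtain ⟨p, t, rfl⟩ : ∃ p t', t = Sum.elim p t' := ⟨t ∘ Sum.inl, t ∘ Sum.inr,
      (Sum.elim_comp_inl_inr t).symm⟩
    -- The state left by the first program is the case of `bellVec` in which no pair has been
    -- measured yet.
    have h0 : (fun y : Qubits (hLen L Q n) (qWidth L Q n - hLen L Q n + L.m n + 1) (L.m n) → Bool =>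
        if y (Λ L Q n).aux = false ∧ y ∘ (Λ L Q n).wit = z then
        rt ^ L.m n * encAmp L Q n (List.ofFn r) (y ∘ (Λ L Q n).wire) (y ∘ (Λ L Q n).half) else 0) =
        bellVec (Λ L Q n) Φ z u v (List.finRange _) := by
      ext y
      simp only [bellVec, List.mem_finRange, if_true, hΦ]
      by_cases h1 : y ∘ (Λ L Q n).wit = z
      · rw [if_pos (show ∀ i, y ((Λ L Q n).wit i) = z i from fun i => congrFun h1 i)]
        simp only [h1, and_true]
        rfl
      · rw [if_neg (fun h => h1 h.2),
          if_neg (show ¬ ∀ i, y ((Λ L Q n).wit i) = z i from fun h => h1 (funext h))]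
    refine (branchOp_apply L Q n _ _ _ z).trans ?_
    rw [firstTrace_mulVec, if_pos rfl, h0, Matrix.mulVec_smul, bellTrace,
      bellTrace_mulVec (Λ L Q n) Φ z u v (addrSecond_half (hLen_le L Q n))
        (addrSecond_wit (hLen_le L Q n)) _ (List.nodup_finRange _), Pi.smul_apply, Pi.smul_apply,
      smul_eq_mul, smul_eq_mul, List.length_finRange, teleport_apply,
      show ((List.finRange (L.m n)).map fun i => if v i && z i then (-1 : ℂ) else 1).prod =
        ∏ i, if v i && z i then (-1 : ℂ) else 1 by
        rw [← List.ofFn_eq_map, List.prod_ofFn], bellVec]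
    simp only [List.not_mem_nil, if_false, hΦ, encAmp_elim]
    have h1 : Sum.elim a (Sum.elim p t) (Λ L Q n).aux =
        p ⟨qWidth L Q n - hLen L Q n + L.m n, by omega⟩ := rfl
    have h2 : ∀ i, Sum.elim a (Sum.elim p t) ((Λ L Q n).wit i) = t i := fun i => rfl
    have h3 : ∀ i, Sum.elim a (Sum.elim p t) ((Λ L Q n).half i) =
        p ⟨qWidth L Q n - hLen L Q n + i, by omega⟩ := fun i => rfl
    simp only [h1, h2, h3]
    have h4 : Sum.elim p t = Sum.elim (privBits L Q n (List.ofFn r) u) v ↔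
        p = privBits L Q n (List.ofFn r) u ∧ t = v := by
      constructor
      · intro h
        exact ⟨by rw [← Sum.elim_comp_inl p t, h, Sum.elim_comp_inl],
          by rw [← Sum.elim_comp_inr p t, h, Sum.elim_comp_inr]⟩
      · rintro ⟨rfl, rfl⟩
        rfl
    simp only [h4, eq_privBits_iff]
    by_cases h5 : ∀ i : Fin (L.m n), p ⟨qWidth L Q n - hLen L Q n + i, by omega⟩ = u i
    · simp only [h5, true_and]
      have h7 : (fun i => xor (u i) (z i)) = fun i => xor (z i) (u i) :=
        funext fun i => Bool.xor_comm _ _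
      by_cases h6 : t = v
      · subst h6
        simp only [implies_true, if_true, true_and, and_true]
        by_cases h8 : p ⟨qWidth L Q n - hLen L Q n + L.m n, by omega⟩ = false
        · simp only [h8, if_true, and_true]
          split_ifs
          · exact congrArg (fun f => rt ^ numCoins L Q C n *
              (rt ^ L.m n * (∏ i, if (t i && z i) = true then (-1 : ℂ) else 1) *
                (rt ^ L.m n * Q.hat n (protF L n) (List.ofFn r) a f))) h7
          · simp
        · rw [if_neg h8, if_neg (fun h => h8 h.2), mul_zero, mul_zero]
      · rw [if_neg (fun h => h6 (funext h)), if_neg (fun h => h6 h.2), mul_zero, mul_zero]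
    · rw [if_neg (fun h => h5 fun i => (h i).1), if_neg (fun h => h5 h.1.2.1), mul_zero, mul_zero]
  rw [reduce_of_single hK w, conj_rt_pow, rt_pow_mul_self]

end BranchStates
end

noncomputable section

/-! ### The honest prover as a program -/

/-- A variant of `Runs.seq` in which variable `0` is overwritten between the phases and the values
and traces of both phases remain visible, as the notion of an honest prover requires. -/
theorem Runs.exists_two_phase {β E : Type} [AddCommMonoid E] {c d : Cmd} {σ : Store} {T T' : ℕ}
    {e : Data} {out : Eff β} {g : β → Store} {k : β → Eff Data}
    (h : Runs id c σ T (Eff.vmap g out))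
    (h' : ∀ o ∈ out, Runs result d (Function.update (g o.1) 0 e) T' (k o.1)) :
    ∃ (bs : List Branch) (f : Branch → List Branch), Exec c σ bs ∧
      (∀ b₁ ∈ bs, Exec d (Function.update b₁.store 0 e) (f b₁)) ∧
      (∀ b₁ ∈ bs, ∀ b₂ ∈ f b₁, b₁.time + b₂.time ≤ T + T') ∧
      ∀ G : Data → List QOp → Data → List QOp → E,
        (bs.map fun b₁ => ((f b₁).map fun b₂ =>
          G (b₁.store 0) b₁.trace (b₂.store 0) b₂.trace).sum).sum =
        esum out fun b t => esum (k b) fun d' t' => G (g b 0) t d' t' := by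
  classical
  obtain ⟨bs, h₁, h₂, h₃⟩ := h
  have hl : ∀ b : Branch, ∃ l, b ∈ bs → Exec d (Function.update b.store 0 e) l := by
    intro b
    by_cases hb : b ∈ bs
    · have : (b.store, b.trace) ∈ Eff.vmap g out := h₂ ▸ List.mem_map_of_mem hb
      obtain ⟨o, ho, h₄⟩ := Eff.mem_vmap.1 this
      obtain ⟨l, hl, -⟩ := h' o ho
      simp only [Prod.mk.injEq] at h₄
      exact ⟨l, fun _ => h₄.1 ▸ hl⟩
    · exact ⟨[], fun h => absurd h hb⟩
  choose f hf using hl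
  have key : ∀ b ∈ bs, ∀ o ∈ out, b.store = g o.1 →
      (f b).map (fun b => (result b.store, b.trace)) = k o.1 ∧ ∀ b' ∈ f b, b'.time ≤ T' := by
    intro b hb o ho hbo
    obtain ⟨l, hl, h₄⟩ := h' o ho
    obtain rfl := (hf b hb).unique (hbo ▸ hl)
    exact h₄
  refine ⟨bs, f, h₁, hf, fun b₁ hb₁ b₂ hb₂ => ?_, fun G => ?_⟩
  · have : (b₁.store, b₁.trace) ∈ Eff.vmap g out := h₂ ▸ List.mem_map_of_mem hb₁
    obtain ⟨o, ho, h₄⟩ := Eff.mem_vmap.1 this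
    simp only [Prod.mk.injEq] at h₄
    exact add_le_add (h₃ _ hb₁) ((key b₁ hb₁ o ho h₄.1).2 _ hb₂)
  · clear h₁ h₃ hf h'
    induction bs generalizing out with
    | nil => cases out with
      | nil => rfl
      | cons => simp [Eff.vmap] at h₂
    | cons b bs ih => cases out with
      | nil => simp [Eff.vmap] at h₂
      | cons o out =>
        simp only [Eff.vmap, List.map_cons, List.cons.injEq, Prod.mk.injEq] at h₂
        have h₅ := ih h₂.2 fun b hb o ho => key b (by simp [hb]) o (by simp [ho])
        simp only [esum, List.map_cons, List.sum_cons] at h₅ ⊢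
        rw [h₅, ← (key b (by simp) o (by simp) h₂.1.1).1, ← h₂.1.1, ← h₂.1.2, List.map_map]
        rfl

variable (L : QMAProblem) (Q : QREScheme) (C : CommitScheme)

theorem size_challenge_le (ch : Bool) (x : List Bool) : (enc (ch, x)).size ≤ 4 * x.length + 5 := by
  have hb : ∀ b : Bool, (enc b).size ≤ 3 := by
    intro b; cases b
    · exact (by decide : Data.nil.size ≤ 3)
    · exact (by decide : (Data.cons .nil .nil).size ≤ 3)
  have := size_list_le (l := x) (B := 3) fun a _ => hb a
  have := hb ch
  rw [size_pair]
  omega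

theorem exists_prover : ∃ (P : Prover) (p : Polynomial ℕ),
    (∀ n, P.priv n = qWidth L Q n - hLen L Q n + L.m n + 1) ∧
    ∀ {E : Type} [AddCommMonoid E] (ch : Bool) (x : List Bool),
      ∃ (bs : List Branch) (f : Branch → List Branch), Exec P.first (initStore (enc x.length)) bs ∧
      (∀ b₁ ∈ bs, Exec P.second (Function.update b₁.store 0 (enc (ch, x))) (f b₁)) ∧
      (∀ b₁ ∈ bs, ∀ b₂ ∈ f b₁, b₁.time + b₂.time ≤ p.eval x.length) ∧
      ∀ G : Data → List QOp → Data → List QOp → E,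
        (bs.map fun b₁ => ((f b₁).map fun b₂ =>
          G (b₁.store 0) b₁.trace (b₂.store 0) b₂.trace).sum).sum =
        esum (firstEff L Q C x.length) fun a t =>
          esum (secondEff L Q C ((ch, x), a.2)) fun d t' => G (enc a.1) t d t' := by
  obtain ⟨q, hq⟩ := (computes_firstEff L Q C).size
  obtain ⟨c₁, p₁, h₁⟩ := computes_firstEff L Q C
  obtain ⟨c₂, p₂, h₂⟩ := computes_secondEff L Q C
  -- `A` is the size of the unary instance length. `B` bounds the input of the second subroutine: at
  -- most `4n + 5` for challenge and instance, `q` for the private data, and one for the pairing.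
  set A : Polynomial ℕ := 2 * Polynomial.X + 1 with hA
  set B : Polynomial ℕ := q.comp A + 4 * Polynomial.X + 6 with hB
  -- The message is put into variable `0`, while variable `1` carries the private data to the second
  -- phase.
  refine ⟨⟨.seq (.call 1 c₁ 0) (.assign 0 (.hd 1)),
    .seq (.assign 1 (.tl 1)) (.seq (.assign 0 (.cons 0 1)) (.call 0 c₂ 0)),
    fun n => qWidth L Q n - hLen L Q n + L.m n + 1⟩,
    ((4 * p₁.comp A + 1 + 2 * A) + (1 + q.comp A)) + ((1 + q.comp A) + ((1 + B) +
      (4 * p₂.comp B + 1 + 2 * B))), fun n => rfl, fun {E} _ ch x => ?_⟩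
  have hAx : A.eval x.length = 2 * x.length + 1 := by simp [hA]
  have hBx : B.eval x.length = q.eval (2 * x.length + 1) + 4 * x.length + 6 := by
    simp [hB, Polynomial.eval_comp, hAx]
  set n := x.length with hn
  have hqn : ∀ o ∈ firstEff L Q C n, (enc o.1).size ≤ q.eval (2 * n + 1) := fun o ho => by
    simpa only [size_nat] using hq n trivial o ho
  have hst : ∀ o ∈ firstEff L Q C n, o.1.2.1 = n := by
    intro o ho
    obtain ⟨o₁, -, o₂, h₂, rfl⟩ := Eff.mem_bind.1 ho
    obtain ⟨o₃, -, rfl⟩ := Eff.mem_vmap.1 h₂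
    rfl
  have r₁ : Runs id (.seq (.call 1 c₁ 0) (.assign 0 (.hd 1))) (initStore (enc n))
      ((4 * p₁.eval (2 * n + 1) + 1 + 2 * (2 * n + 1)) + (1 + q.eval (2 * n + 1)))
      (Eff.vmap (fun a => Function.update (Function.update (initStore (enc n)) 1 (enc a)) 0
        (enc a.1)) (firstEff L Q C n)) := by
    rw [Eff.vmap_eq_bind]
    refine Runs.seq (runs_call h₁ trivial (initStore_zero _) (size_nat n).le) fun o ho => ?_
    have h := Runs.assign 0 (.hd 1) (Function.update (initStore (enc n)) 1 (enc o.1))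
    have he : (Expr.hd 1).eval (Function.update (initStore (enc n)) 1 (enc o.1)) = enc o.1.1 := by
      simp only [Expr.eval, Function.update_self]
      rfl
    rw [he] at h
    refine h.mono ?_
    have := hqn o ho
    rw [show (enc o.1).size = (enc o.1.1).size + (enc o.1.2).size + 1 from size_pair _ _] at this
    omega
  have r₂ : ∀ o ∈ firstEff L Q C n, Runs result
      (.seq (.assign 1 (.tl 1)) (.seq (.assign 0 (.cons 0 1)) (.call 0 c₂ 0)))
      (Function.update (Function.update (Function.update (initStore (enc n)) 1 (enc o.1)) 0
        (enc o.1.1)) 0 (enc (ch, x)))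
      ((1 + q.eval (2 * n + 1)) + ((1 + B.eval n) + (4 * p₂.eval (B.eval n) + 1 + 2 * B.eval n)))
      (secondEff L Q C ((ch, x), o.1.2)) := by
    intro o ho
    have hs := hqn o ho
    rw [show (enc o.1).size = (enc o.1.1).size + (enc o.1.2).size + 1 from size_pair _ _] at hs
    have hs' := size_challenge_le ch x
    have hs'' := size_pair (ch, x) o.1.2
    set σ := Function.update (Function.update (Function.update (initStore (enc n)) 1 (enc o.1)) 0
        (enc o.1.1)) 0 (enc (ch, x)) with hσ
    have h3 := Runs.assign 1 (.tl 1) σ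
    have e3 : (Expr.tl 1).eval σ = enc o.1.2 := by
      simp only [Expr.eval, hσ]
      rfl
    rw [e3] at h3
    have h4 := Runs.assign 0 (.cons 0 1) (Function.update σ 1 (enc o.1.2))
    have e4 : (Expr.cons 0 1).eval (Function.update σ 1 (enc o.1.2)) = enc ((ch, x), o.1.2) := by
      simp only [Expr.eval, hσ]
      rfl
    rw [e4] at h4
    refine (h3.mono (by omega)).seq_pure ((h4.mono (by omega)).seq_pure ?_)
    have h5 := (runs_call (x := 0) (y := 0) h₂ (a := ((ch, x), o.1.2)) (by
        change x.length = o.1.2.1; rw [hst o ho]) (σ := Function.update (Function.update σ 1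
        (enc o.1.2)) 0 (enc ((ch, x), o.1.2))) (by simp) (N := B.eval n) (by omega)).view
        (v := result)
    simp only [Eff.vmap_vmap, result, Function.update_self] at h5
    rwa [show Eff.vmap (fun b : Data => enc b) (secondEff L Q C ((ch, x), o.1.2)) =
      secondEff L Q C ((ch, x), o.1.2) from List.map_id _] at h5
  obtain ⟨bs, f, h5, h6, h7, h8⟩ := Runs.exists_two_phase (E := E) (k := fun a => secondEff L Q C ((ch, x), a.2)) r₁ r₂
  refine ⟨bs, f, h5, h6, fun b₁ hb₁ b₂ hb₂ => (h7 b₁ hb₁ b₂ hb₂).trans ?_, h8⟩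
  simp [Polynomial.eval_comp, hAx]

end

/-! ### The messages of the program are those of the honest prover. -/

noncomputable section

theorem enc_ofFn_congr {α β : Type} [ToData α] [ToData β] {k : ℕ} {f : Fin k → α} {g : Fin k → β}
    (h : ∀ i, enc (f i) = enc (g i)) : enc (List.ofFn f) = enc (List.ofFn g) := by
  induction k with
  | zero => rfl
  | succ k ih => rw [List.ofFn_succ, List.ofFn_succ, enc_cons, enc_cons, h, ih fun i => h i.succ]

variable (L : QMAProblem) (Q : QREScheme) (C : CommitScheme) (n : ℕ)

/-- The private data of the prover. -/
def privateData (ω : Coins L Q C n) : Private :=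
  (n, (List.ofFn ω.1, List.ofFn ω.2.1, flatList ω.2.2), flatList (labels L Q n (List.ofFn ω.1)))

theorem opening_privateData (ω : Coins L Q C n) (i : Fin (numLab L n)) (b : Bool) :
    opening L Q C (privateData L Q C n ω) (2 * i + b.toNat) =
      (List.ofFn (labels L Q n (List.ofFn ω.1) i b), List.ofFn (ω.2.2 i b)) :=
  Prod.ext (slice_flatList _ _ _) (slice_flatList _ _ _)

theorem enc_commitments (ω : Coins L Q C n) :
    enc (commitments L Q C (privateData L Q C n ω)) = enc (firstMsg L Q C n ω) := by
  have h : ∀ (i : Fin (numLab L n)) b, labelCom L Q C (privateData L Q C n ω) (2 * i + b.toNat) =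
      (firstMsg L Q C n ω).2 i b := fun i b =>
    congrArg (fun a : List Bool × List Bool => C.com n a.1 a.2) (opening_privateData L Q C n ω i b)
  refine congrArg (Data.cons _) ?_
  change enc ((List.range (numLab L n)).map _) = _
  rw [range_eq_ofFn, List.map_ofFn]
  refine enc_ofFn_congr fun i => ?_
  exact congrArg₂ (fun a b => enc (a, b)) (h i false) (h i true)

theorem openAllData_privateData (ω : Coins L Q C n) :
    openAllData L Q C (privateData L Q C n ω) = enc (Response.openAll (L := L) (Q := Q) ω.1
      (List.ofFn ω.2.1) (Q.lab n (protF L n) (List.ofFn ω.1)) fun i b => List.ofFn (ω.2.2 i b)) := by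
  refine congrArg (Data.cons _) ?_
  change enc ((List.range (numLab L n)).map _) = _
  rw [range_eq_ofFn, List.map_ofFn]
  refine enc_ofFn_congr fun i => ?_
  exact congrArg₂ (fun a b => enc (a, b)) (opening_privateData L Q C n ω i false)
    (opening_privateData L Q C n ω i true)

theorem openSomeData_privateData (ω : Coins L Q C n) (x : List Bool) (u v : Fin (L.m n) → Bool) :
    openSomeData L Q C (privateData L Q C n ω) (selector x (List.ofFn fun i => (u i, v i))) =
      enc (Response.openSome (L := L) (Q := Q) (concatInput L n x u v)
        (fun i => Q.lab n (protF L n) (List.ofFn ω.1) i (concatInput L n x u v i))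
        fun i => List.ofFn (ω.2.2 i (concatInput L n x u v i))) := by
  change enc ((List.range (numLab L n)).map _) = _
  rw [range_eq_ofFn, List.map_ofFn]
  refine enc_ofFn_congr fun i => ?_
  have hz : (selector x (List.ofFn fun i => (u i, v i))).getD i false =
      concatInput L n x u v i := by
    simp only [selector, List.map_ofFn, concatInput, strInput]
    rfl
  simp only [Function.comp_apply, hz]
  exact congrArg (fun a => enc (concatInput L n x u v i, a)) (opening_privateData L Q C n ω i _)

theorem card_coins : Fintype.card (Coins L Q C n) = 2 ^ numCoins L Q C n := by
  simp only [Fintype.card_prod, Fintype.card_pi, Finset.prod_const, Finset.card_univ,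
    Fintype.card_bool, Fintype.card_fin, ← pow_mul, numCoins, pow_add, mul_assoc]
  congr 3
  ring

/-- Branches with a wrong reading of the labels do not contribute. -/
theorem esum_firstEff_of_labels {E : Type} [AddCommMonoid E]
    (G : (List Bool × List (List Bool × List Bool)) × Private → List QOp → E)
    (hG : ∀ r s₀ s ℓ, ℓ ≠ flatBits (labels L Q n (List.ofFn r)) →
      G (commitments L Q C (n, (List.ofFn r, List.ofFn s₀, List.ofFn s), List.ofFn ℓ),
        (n, (List.ofFn r, List.ofFn s₀, List.ofFn s), List.ofFn ℓ))
        (firstTrace L Q C n r s₀ s ℓ) = 0) :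
    esum (firstEff L Q C n) G = ∑ ω : Coins L Q C n,
      G (commitments L Q C (privateData L Q C n ω), privateData L Q C n ω)
        (firstTrace L Q C n ω.1 ω.2.1 (flatBits ω.2.2)
          (flatBits (labels L Q n (List.ofFn ω.1)))) := by
  rw [esum_firstEff, Fintype.sum_prod_type]
  refine Finset.sum_congr rfl fun r _ => ?_
  rw [Fintype.sum_prod_type]
  refine Finset.sum_congr rfl fun s₀ _ => ?_
  rw [sum_flatBits]
  refine Finset.sum_congr rfl fun s _ => ?_
  rw [Finset.sum_eq_single (flatBits (labels L Q n (List.ofFn r)))]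
  · rw [ofFn_flatBits, ofFn_flatBits]
    rfl
  · exact fun ℓ _ h => hG r s₀ _ ℓ h
  · simp

theorem branchState_eq (w : Op (Fin (L.m n)) (Fin (L.m n))) {p : ℕ}
    (hp : p = qWidth L Q n - hLen L Q n + L.m n + 1) (b₁ b₂ : Branch) :
    branchState (hLen L Q n) p w b₁ b₂ = reduce (fun i => .inl i)
      (branchOp L Q n b₁.trace b₂.trace * w * (branchOp L Q n b₁.trace b₂.trace)ᴴ) := by
  subst hp
  rfl

open Classical in
-- Branches with the true labels correspond to coins, and on challenge 1 also to the outcomes `(u,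
-- v)`. The messages agree as encodings and the weighted states by `reduce_openAll` and
-- `reduce_openSome`; all other branches have operator zero.
theorem exists_isHonestInTime : ∃ (P : Prover) (p : Polynomial ℕ), ∀ (x : List Bool)
    (w : Op (Fin (L.m x.length)) (Fin (L.m x.length))), w.trace = 1 →
      P.IsHonestInTime L Q C (p.eval x.length) x w := by
  obtain ⟨P, p, hpriv, hP⟩ := exists_prover L Q C
  refine ⟨P, p, fun x w hw ch => ?_⟩
  obtain ⟨bs, f, h₁, h₂, h₃, h₄⟩ := hP
    (E := Op (Fin (hLen L Q x.length)) (Fin (hLen L Q x.length))) ch x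
  refine ⟨bs, f, h₁, h₂, h₃, fun d₁ d₂ => ?_⟩
  -- The state of a branch depends only on the traces, so dummy stores and times may be inserted.
  refine (h₄ fun a t d t' => if a = d₁ ∧ d = d₂ then branchState (hLen L Q x.length)
    (P.priv x.length) w ⟨fun _ => .nil, t, 0⟩ ⟨fun _ => .nil, t', 0⟩ else 0).trans ?_
  simp only [branchState_eq L Q x.length w (hpriv x.length)]
  cases ch
  · simp only [secondEff, Bool.false_eq_true, if_false, esum_pure]
    rw [esum_firstEff_of_labels]
    · simp only [enc_commitments, openAllData_privateData, honest, Multiset.map_map]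
      refine Finset.sum_congr rfl fun ω _ => ?_
      refine if_congr Iff.rfl ?_ rfl
      rw [reduce_openAll L Q C x.length ω.1 ω.2.1 (flatBits ω.2.2) w hw, card_coins]
    · intro r s₀ s ℓ hℓ
      rw [branchOp_wrong_labels L Q C x.length r s₀ s hℓ]
      split_ifs
      · ext; simp [reduce]
      · rfl
  · simp only [secondEff, if_true, esum_vmap, esum_bellMeasure]
    rw [esum_firstEff_of_labels]
    · simp only [enc_commitments, honest, Multiset.map_map]
      refine Eq.trans ?_ (Fintype.sum_prod_type _).symm
      refine Finset.sum_congr rfl fun ω _ => ?_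
      refine Eq.trans ?_ (Fintype.sum_prod_type _).symm
      refine Finset.sum_congr rfl fun u _ => Finset.sum_congr rfl fun v _ => ?_
      refine if_congr ?_ ?_ rfl
      · rw [← openSomeData_privateData]
        rfl
      · refine (reduce_openSome L Q C x.length ω.1 ω.2.1 (flatBits ω.2.2) w u v).trans ?_
        rw [card_coins]
    · intro r s₀ s ℓ hℓ
      refine Finset.sum_eq_zero fun u _ => Finset.sum_eq_zero fun v _ => ?_
      rw [branchOp_wrong_labels L Q C x.length r s₀ s hℓ]
      split_ifs
      · ext; simp [reduce]
      · rfl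

end

noncomputable section

/-! ### Gates are unitary -/

section Unitary

variable {ι : Type} [Fintype ι] [DecidableEq ι]

theorem onQubit_mul (u v : Matrix Bool Bool ℂ) (i : ι) :
    onQubit u i * onQubit v i = onQubit (u * v) i := by
  refine Matrix.mulVec_injective (funext fun ψ => funext fun y => ?_)
  rw [← Matrix.mulVec_mulVec]
  simp only [onQubit_mulVec, Function.update_self, Function.update_idem, Matrix.mul_apply,
    Finset.mul_sum, Finset.sum_mul]
  rw [Finset.sum_comm]
  simp only [mul_assoc]

theorem onQubit_one (i : ι) : onQubit 1 i = 1 := by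
  refine Matrix.mulVec_injective (funext fun ψ => funext fun y => ?_)
  rw [onQubit_mulVec, Matrix.one_mulVec, Finset.sum_eq_single (y i)]
  · simp
  · intro b _ hb
    rw [Matrix.one_apply_ne (Ne.symm hb), zero_mul]
  · simp

theorem conjTranspose_onQubit (u : Matrix Bool Bool ℂ) (i : ι) :
    (onQubit u i)ᴴ = onQubit uᴴ i := by
  ext y y'
  simp only [Matrix.conjTranspose_apply, onQubit, Matrix.of_apply, eq_comm (a := y' _)]
  split_ifs <;> simp

theorem onQubit_unitary {u : Matrix Bool Bool ℂ} (hu : uᴴ * u = 1) (i : ι) :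
    (onQubit u i)ᴴ * onQubit u i = 1 := by
  rw [conjTranspose_onQubit, onQubit_mul, hu, onQubit_one]

theorem Gate.mat_unitary (g : Gate ι) : g.matᴴ * g.mat = 1 := by
  cases g with
  | H i =>
    refine onQubit_unitary ?_ i
    have h : (Real.sqrt 2 : ℂ) * Real.sqrt 2 = 2 := by
      rw [← Complex.ofReal_mul, Real.mul_self_sqrt (by norm_num)]
      norm_num
    have h0 : (Real.sqrt 2 : ℂ) ≠ 0 := fun h' => by rw [h', mul_zero] at h; norm_num at h
    ext a b
    cases a <;> cases b <;> simp [Matrix.mul_apply] <;> field_simp <;>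
      first | ring1 | linear_combination (-1 : ℂ) * h
  | S i =>
    refine onQubit_unitary ?_ i
    rw [Matrix.diagonal_conjTranspose, Matrix.diagonal_mul_diagonal, Matrix.diagonal_eq_one]
    ext a
    cases a <;> simp
  | T i =>
    refine onQubit_unitary ?_ i
    rw [Matrix.diagonal_conjTranspose, Matrix.diagonal_mul_diagonal, Matrix.diagonal_eq_one]
    ext a
    cases a
    · simp
    · simp only [Pi.star_apply, if_true, Pi.one_apply]
      rw [Complex.star_def, ← Complex.exp_conj, ← Complex.exp_add]
      simp [show (starRingEnd ℂ) 4 = 4 from map_ofNat _ 4]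
  | CX i j =>
    by_cases hij : i = j
    · simp [Gate.mat, hij]
    · have h : ((Gate.CX i j).mat : Op ι ι)ᴴ = (Gate.CX i j).mat := by
        rw [Gate.mat, if_neg hij]
        ext y y'
        simp only [Matrix.conjTranspose_apply, Matrix.of_apply, xor_update_eq_iff hij y]
        split_ifs <;> simp
      rw [h]
      refine Matrix.mulVec_injective (funext fun ψ => funext fun y => ?_)
      rw [← Matrix.mulVec_mulVec, CX_mulVec hij, CX_mulVec hij, Matrix.one_mulVec]
      congr 1
      simp [Function.update_of_ne hij]

theorem gatesMat_unitary (gs : List (Gate ι)) : (gatesMat gs)ᴴ * gatesMat gs = 1 := by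
  induction gs with
  | nil => simp [gatesMat_nil]
  | cons g gs ih =>
    rw [gatesMat_cons, Matrix.conjTranspose_mul, Matrix.mul_assoc, ← Matrix.mul_assoc _ _ g.mat,
      ih, Matrix.one_mul, g.mat_unitary]

end Unitary

/-! ### Removing the quantum one-time pad -/

/-- The operator `∏ X^u Z^v`. -/
def pauli {m : ℕ} (u v : Fin m → Bool) : Op (Fin m) (Fin m) := Matrix.of fun a z =>
  if a = (fun i => xor (z i) (u i)) then ∏ i, if v i && z i then (-1 : ℂ) else 1 else 0

section Pad

variable {ι : Type} [Fintype ι] [DecidableEq ι]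

/-- Conjugating the target of a controlled-not by Hadamard gates turns the controlled `X` into a
controlled `Z`. -/
theorem CZ_mulVec {i j : ι} (hij : i ≠ j) (ψ : (ι → Bool) → ℂ) (y : ι → Bool) :
    ((Gate.H j).mat *ᵥ ((Gate.CX i j).mat *ᵥ ((Gate.H j).mat *ᵥ ψ))) y =
      (if y i && y j then (-1 : ℂ) else 1) * ψ y := by
  have h := rt_sq
  have hy : ψ y = ψ (Function.update y j (y j)) := by rw [Function.update_eq_self]
  rw [H_mulVec, CX_mulVec hij, CX_mulVec hij, H_mulVec, H_mulVec, hy]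
  simp only [Function.update_self, Function.update_idem, ne_eq, hij, not_false_eq_true,
    Function.update_of_ne]
  cases h1 : y i <;> cases h2 : y j <;> simp <;>
    first
      | linear_combination 2 * h * ψ (Function.update y j true)
      | linear_combination 2 * h * ψ (Function.update y j false)
      | linear_combination (-2) * h * ψ (Function.update y j true)

/-- Here `y'` is the preimage of `y` under the controlled `X` gates. Describing it by equations, and
not by a formula, lets it vary in the induction; the signs are those of the controlled `Z` gates,
which act before the `X` gates. -/
theorem padGates_mulVec {m : ℕ} {w u v : Fin m → ι} (hw : w.Injective)
    (hwu : ∀ i j, w i ≠ u j) (hwv : ∀ i j, w i ≠ v j) (ψ : (ι → Bool) → ℂ) {l : List (Fin m)}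
    (hl : l.Nodup) {y y' : ι → Bool} (h₁ : ∀ i ∈ l, y' (w i) = xor (y (w i)) (y (u i)))
    (h₂ : ∀ k, (∀ i ∈ l, k ≠ w i) → y' k = y k) :
    (gatesMat (l.flatMap fun i => [Gate.H (w i), .CX (v i) (w i), .H (w i), .CX (u i) (w i)]) *ᵥ ψ)
      y = (l.map fun i => if y' (v i) && y' (w i) then (-1 : ℂ) else 1).prod * ψ y' := by
  induction l generalizing ψ y' with
  | nil =>
    have : y' = y := funext fun k => h₂ k (by simp)
    simp [gatesMat_nil, this]
  | cons i l ih =>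
    rw [List.nodup_cons] at hl
    have hu : ∀ j, y' (u j) = y (u j) := fun j => h₂ _ fun i _ => (hwu i j).symm
    have hv : ∀ j, y' (v j) = y (v j) := fun j => h₂ _ fun i _ => (hwv i j).symm
    -- The gates of the tail act last and do not change qubit `w i`, so their preimage has that bit
    -- as in `y`.
    rw [List.flatMap_cons, gatesMat_append, ← Matrix.mulVec_mulVec,
      ih _ hl.2 (y' := Function.update y' (w i) (y (w i))) (fun j hj => ?_) (fun k hk => ?_)]
    · simp only [gatesMat_cons, gatesMat_nil, one_mul, ← Matrix.mulVec_mulVec]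
      rw [CX_mulVec (hwu i i).symm, CZ_mulVec (hwv i i).symm]
      have h3 : Function.update (Function.update y' (w i) (y (w i))) (w i)
          (xor (Function.update y' (w i) (y (w i)) (w i))
            (Function.update y' (w i) (y (w i)) (u i))) = y' := by
        rw [Function.update_idem, Function.update_self, Function.update_of_ne (hwu i i).symm, hu,
          ← h₁ i (by simp), Function.update_eq_self]
      rw [h3, List.map_cons, List.prod_cons]
      have h4 : (l.map fun j => if Function.update y' (w i) (y (w i)) (v j) &&
          Function.update y' (w i) (y (w i)) (w j) then (-1 : ℂ) else 1) =
          l.map fun j => if y' (v j) && y' (w j) then (-1 : ℂ) else 1 := by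
        refine List.map_congr_left fun j hj => ?_
        rw [Function.update_of_ne (hwv i j).symm, Function.update_of_ne (hw.ne ?_)]
        rintro rfl
        exact hl.1 hj
      rw [h4]
      ring
    · have hji : j ≠ i := by
        rintro rfl
        exact hl.1 hj
      rw [Function.update_of_ne (hw.ne hji), h₁ j (by simp [hj])]
    · by_cases hki : k = w i
      · rw [hki, Function.update_self]
      · rw [Function.update_of_ne hki]
        exact h₂ k fun j hj => by
          rcases List.mem_cons.1 hj with rfl | hj
          · exact hki
          · exact hk j hj

end Pad

/-! ### Acceptance -/

section Reduce

variable {ι κ : Type} [Fintype ι] [DecidableEq ι] [Fintype κ] [DecidableEq κ]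

theorem reduce_get_true (l : List ι) (M : Op ι ι) :
    reduce l.get M (fun _ => true) (fun _ => true) = ∑ y : ι → Bool, ∑ y' : ι → Bool,
      if (∀ k ∈ l, y k = true) ∧ (∀ k ∈ l, y' k = true) ∧ ∀ k ∉ l, y k = y' k
      then M y y' else 0 := by
  have h : ∀ y : ι → Bool, y ∘ l.get = (fun _ => true) ↔ ∀ k ∈ l, y k = true := fun y => by
    simp only [funext_iff, Function.comp_apply, List.forall_mem_iff_get]
  have h' : ∀ k, k ∈ Set.range l.get ↔ k ∈ l := fun k => by rw [Set.range_list_get]; rfl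
  simp only [reduce, Matrix.of_apply, h, h']

theorem sum_extend {f : κ → ι} (hf : f.Injective) (y₀ : ι → Bool) {g : (ι → Bool) → ℂ}
    (hg : ∀ y, g y ≠ 0 → y = Function.extend f (y ∘ f) y₀) :
    ∑ y, g y = ∑ x, g (Function.extend f x y₀) := by
  symm
  refine Finset.sum_of_injOn (fun x => Function.extend f x y₀) ?_ (by simp) ?_ (fun _ _ => rfl)
  · intro x _ x' _ h
    rw [← extend_comp hf x y₀, ← extend_comp hf x' y₀]
    exact congrArg (· ∘ f) h
  · intro y _ hy
    by_contra h
    exact hy ⟨y ∘ f, by simp, (hg y h).symm⟩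

/-- The qubits outside `f` hold fixed values and are discarded. -/
theorem reduce_get_map {f : κ → ι} (hf : f.Injective) (y₀ : ι → Bool) {M : Op ι ι} {N : Op κ κ}
    (hM : ∀ y y', M y y' ≠ 0 → y = Function.extend f (y ∘ f) y₀ ∧
      y' = Function.extend f (y' ∘ f) y₀)
    (hN : ∀ x x', M (Function.extend f x y₀) (Function.extend f x' y₀) = N x x') (l : List κ) :
    reduce (l.map f).get M (fun _ => true) (fun _ => true) =
      reduce l.get N (fun _ => true) (fun _ => true) := by
  rw [reduce_get_true, reduce_get_true]
  rw [sum_extend hf y₀]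
  · refine Finset.sum_congr rfl fun x _ => ?_
    rw [sum_extend hf y₀]
    · refine Finset.sum_congr rfl fun x' _ => ?_
      have h1 : ∀ x : κ → Bool, (∀ k ∈ l.map f, Function.extend f x y₀ k = true) ↔
          ∀ k ∈ l, x k = true := fun x => by
        simp only [List.forall_mem_map, hf.extend_apply]
      have h2 : (∀ k ∉ l.map f, Function.extend f x y₀ k = Function.extend f x' y₀ k) ↔
          ∀ k ∉ l, x k = x' k := by
        constructor
        · intro h k hk
          simpa only [hf.extend_apply] using h (f k) (by rwa [List.mem_map_of_injective hf])
        · intro h k hk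
          by_cases hk' : ∃ j, f j = k
          · obtain ⟨j, rfl⟩ := hk'
            rw [hf.extend_apply, hf.extend_apply]
            exact h j fun hj => hk (List.mem_map_of_mem hj)
          · rw [Function.extend_apply' _ _ _ hk', Function.extend_apply' _ _ _ hk']
      simp only [h1, h2, hN]
    · intro y hy
      exact (hM _ y fun h => hy (by rw [h, ite_self])).2
  · intro y hy
    obtain ⟨y', -, hy'⟩ := Finset.exists_ne_zero_of_sum_ne_zero hy
    exact (hM y y' fun h => hy' (by rw [h, ite_self])).1

end Reduce

end

noncomputable section

theorem append_append_apply {p q r : ℕ} (a : Fin p → Bool) (z : Fin q → Bool) (k : Fin (p + q + r)) :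
    Fin.append (Fin.append a z) (fun _ : Fin r => false) k =
      if h : (k : ℕ) < p then a ⟨k, h⟩ else if h' : (k : ℕ) - p < q then z ⟨k - p, h'⟩ else false := by
  induction k using Fin.addCases with
  | left k =>
    rw [Fin.append_left]
    induction k using Fin.addCases with
    | left k => simp
    | right k => simp
  | right k =>
    rw [Fin.append_right, dif_neg (by simp; omega), dif_neg (by simp; omega)]

theorem pauli_mul_apply {p : ℕ} {ι : Type} (A : Op ι (Fin p)) (u v : Fin p → Bool) (y : ι → Bool)
    (a : Fin p → Bool) : (A * pauli u v) y a =
      A y (fun i => xor (a i) (u i)) * ∏ i, if v i && a i then (-1 : ℂ) else 1 := by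
  rw [Matrix.mul_apply, Finset.sum_eq_single fun i => xor (a i) (u i)]
  · simp [pauli]
  · intro b _ hb
    simp [pauli, hb]
  · simp

/-! ### The padded circuit decrypts and then verifies. -/

section PadCircuit

variable (V : QCircuit) {c : Fin V.cin → Bool} {u v : Fin V.qin → Bool}
  {z : Fin (V.cin + 2 * V.qin) → Bool}

theorem extend_eq_extend_iff {ι κ : Type} {f : κ → ι} (hf : f.Injective) (x x' : κ → Bool)
    (y y₀ : ι → Bool) : Function.extend f x y = Function.extend f x' y₀ ↔
      x = x' ∧ y = Function.extend f (y ∘ f) y₀ := by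
  constructor
  · intro h
    refine ⟨by rw [← extend_comp hf x y, h, extend_comp hf], ?_⟩
    conv_lhs => rw [← extend_comp_self hf y]
    rw [← extend_extend hf x (y ∘ f) y, h, extend_extend hf]
  · rintro ⟨rfl, h⟩
    rw [h, extend_extend hf]

/-- The input of the padded circuit, in terms of the input of the circuit. -/
theorem append_eq_extend (hc : ∀ i : Fin V.cin, z ⟨i, by omega⟩ = c i) (a : Fin V.qin → Bool) :
    Fin.append (Fin.append a z) (fun _ : Fin V.anc => false) = Function.extend (shiftWire V)
      (Fin.append (Fin.append a c) fun _ => false)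
      (Fin.append (Fin.append (fun _ => false) z) fun _ => false) := by
  ext k
  by_cases hk : ∃ j, shiftWire V j = k
  · obtain ⟨j, rfl⟩ := hk
    rw [(shiftWire_injective V).extend_apply, append_append_apply, append_append_apply]
    by_cases h1 : (j : ℕ) < V.qin
    · have h2 : (shiftWire V j : ℕ) = j := by rw [shiftWire, if_pos (by omega)]
      simp only [h2, h1, dif_pos]
    · by_cases h3 : (j : ℕ) < V.qin + V.cin
      · have h2 : (shiftWire V j : ℕ) = j := by rw [shiftWire, if_pos h3]
        simp only [h2]
        rw [dif_neg h1, dif_neg h1, dif_pos (by omega), dif_pos (by omega), ← hc]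
      · have h2 : (shiftWire V j : ℕ) = j + 2 * V.qin := by rw [shiftWire, if_neg h3]
        simp only [h2]
        rw [dif_neg (by omega), dif_neg (by omega), dif_neg h1, dif_neg (by omega)]
  · rw [Function.extend_apply' _ _ _ hk, append_append_apply, append_append_apply]
    have : ¬ (k : ℕ) < V.qin := fun h => hk ⟨⟨k, by omega⟩, by
      unfold shiftWire
      rw [if_pos (by dsimp only; omega)]⟩
    rw [dif_neg this, dif_neg this]

/-- The isometry that adjoins the classical input of the padded circuit. -/
def padIso (z : Fin (V.cin + 2 * V.qin) → Bool) :
    Op (Fin (V.qin + (V.cin + 2 * V.qin) + V.anc)) (Fin V.qin) := Matrix.of fun y a =>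
  if y = Fin.append (Fin.append a z) (fun _ => false) then 1 else 0

/-- The gates that remove the pad. -/
def unpadGates : List (Gate (Fin (V.qin + (V.cin + 2 * V.qin) + V.anc))) :=
  (List.finRange V.qin).flatMap fun i : Fin V.qin => [.H ⟨i, by omega⟩,
    .CX ⟨V.qin + V.cin + V.qin + i, by omega⟩ ⟨i, by omega⟩, .H ⟨i, by omega⟩,
    .CX ⟨V.qin + V.cin + i, by omega⟩ ⟨i, by omega⟩]

/-- The identity `X^u Z^v X^u Z^v = (-1)^(u·v)`: up to this sign the pad is its own inverse. -/
theorem unpadGates_mul_padIso (hu : ∀ i : Fin V.qin, z ⟨V.cin + i, by omega⟩ = u i)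
    (hv : ∀ i : Fin V.qin, z ⟨V.cin + V.qin + i, by omega⟩ = v i) :
    gatesMat (unpadGates V) * (padIso V z * pauli u v) =
      (∏ i, if v i && u i then (-1 : ℂ) else 1) • padIso V z := by
  ext y a
  set y' : Fin (V.qin + (V.cin + 2 * V.qin) + V.anc) → Bool := fun k =>
    if h : (k : ℕ) < V.qin then xor (y k) (y ⟨V.qin + V.cin + k, by omega⟩) else y k with hy'
  refine (padGates_mulVec (ι := Fin (V.qin + (V.cin + 2 * V.qin) + V.anc))
    (w := fun i : Fin V.qin => ⟨i, by omega⟩)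
    (u := fun i : Fin V.qin => ⟨V.qin + V.cin + i, by omega⟩)
    (v := fun i : Fin V.qin => ⟨V.qin + V.cin + V.qin + i, by omega⟩) (y' := y')
    (fun i j h => by simpa [Fin.ext_iff] using h) (fun i j h => by simp at h; omega)
    (fun i j h => by simp at h; omega) (fun y => (padIso V z * pauli u v) y a)
    (List.nodup_finRange _) (fun i _ => by simp [hy'])
    (fun k hk => dif_neg fun h => hk ⟨k, h⟩ (List.mem_finRange _) rfl)).trans ?_
  rw [pauli_mul_apply, Matrix.smul_apply, smul_eq_mul]
  simp only [padIso, Matrix.of_apply]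
  have hz : ∀ (a : Fin V.qin → Bool) (i : ℕ) (hi : i < V.cin + 2 * V.qin),
      Fin.append (Fin.append a z) (fun _ : Fin V.anc => false) ⟨V.qin + i, by omega⟩ = z ⟨i, hi⟩ := by
    intro a i hi
    rw [append_append_apply, dif_neg (by simp), dif_pos (by simpa using hi)]
    simp
  have ha : ∀ (a : Fin V.qin → Bool) (i : Fin V.qin),
      Fin.append (Fin.append a z) (fun _ : Fin V.anc => false) ⟨i, by omega⟩ = a i := by
    intro a i
    rw [append_append_apply, dif_pos i.2]
  -- Adding the control bits `u` to the quantum bits turns the input with `a` into the one with `a ⊕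
  -- u`; the control bits themselves are unaffected.
  have hiff : y' = Fin.append (Fin.append (fun i => xor (a i) (u i)) z) (fun _ => false) ↔
      y = Fin.append (Fin.append a z) (fun _ => false) := by
    have hu' : ∀ (a : Fin V.qin → Bool) (i : Fin V.qin),
        Fin.append (Fin.append a z) (fun _ : Fin V.anc => false)
          ⟨V.qin + V.cin + i, by omega⟩ = u i := by
      intro a i
      have := hz a (V.cin + i) (by omega)
      rw [hu] at this
      rw [← this]
      congr 2
      ring
    have hlo : ∀ (a a' : Fin V.qin → Bool) (k : Fin (V.qin + (V.cin + 2 * V.qin) + V.anc)),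
        ¬ (k : ℕ) < V.qin → Fin.append (Fin.append a z) (fun _ : Fin V.anc => false) k =
          Fin.append (Fin.append a' z) (fun _ : Fin V.anc => false) k := by
      intro a a' k hk
      rw [append_append_apply, append_append_apply, dif_neg hk, dif_neg hk]
    constructor
    · intro h
      ext k
      have h2 := congrFun h k
      by_cases hk : (k : ℕ) < V.qin
      · have h3 := congrFun h ⟨V.qin + V.cin + k, by omega⟩
        have h4 : y' ⟨V.qin + V.cin + k, by omega⟩ = y ⟨V.qin + V.cin + k, by omega⟩ :=
          dif_neg (by dsimp only; omega)
        rw [h4, hu' _ ⟨k, hk⟩] at h3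
        rw [ha _ ⟨k, hk⟩] at h2
        rw [ha _ ⟨k, hk⟩]
        simp only [hy', dif_pos hk, h3] at h2
        simpa using h2
      · rw [hlo _ _ _ hk, ← h2]
        exact (dif_neg hk : y' k = y k).symm
    · intro h
      ext k
      by_cases hk : (k : ℕ) < V.qin
      · simp only [hy', dif_pos hk]
        rw [h, ha _ ⟨k, hk⟩, ha _ ⟨k, hk⟩, hu' _ ⟨k, hk⟩]
      · rw [hlo _ a _ hk, ← h]
        exact dif_neg hk
  by_cases h : y = Fin.append (Fin.append a z) (fun _ => false)
  · have h' := hiff.2 h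
    rw [if_pos h', if_pos h, one_mul, mul_one, ← List.ofFn_eq_map, List.prod_ofFn,
      ← Finset.prod_mul_distrib]
    refine Finset.prod_congr rfl fun i _ => ?_
    have h3 := hz (fun i => xor (a i) (u i)) (V.cin + V.qin + i) (by omega)
    rw [hv, ← h'] at h3
    have h4 := ha (fun i => xor (a i) (u i)) i
    rw [← h'] at h4
    have h5 : y' ⟨V.qin + V.cin + V.qin + i, by omega⟩ = v i := by
      rw [← h3]; congr 2; ring
    rw [h4, h5]
    -- Bit by bit, `(-1)^(v(a ⊕ u)) (-1)^(va) = (-1)^(vu)`.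
    cases v i <;> cases a i <;> cases u i <;> simp
  · rw [if_neg h, if_neg (fun h' => h (hiff.1 h'))]
    simp

/-- After the pad is removed, the gates of `V` act on the shifted wires alone, while the wires of
`u` and `v` keep their fixed values and are discarded. The sign occurs together with its conjugate
and cancels. -/
theorem padCircuit_eval (hc : ∀ i : Fin V.cin, z ⟨i, by omega⟩ = c i)
    (hu : ∀ i : Fin V.qin, z ⟨V.cin + i, by omega⟩ = u i)
    (hv : ∀ i : Fin V.qin, z ⟨V.cin + V.qin + i, by omega⟩ = v i)
    (w : Op (Fin V.qin) (Fin V.qin)) :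
    (padCircuit V).eval z (pauli u v * w * (pauli u v)ᴴ) (fun _ => true) (fun _ => true) =
      V.eval c w (fun _ => true) (fun _ => true) := by
  set f := shiftWire V with hf
  have hfi : f.Injective := shiftWire_injective V
  set sgn : ℂ := ∏ i, if v i && u i then (-1 : ℂ) else 1 with hsgn
  have hss : sgn * (starRingEnd ℂ) sgn = 1 := by
    rw [hsgn, map_prod, ← Finset.prod_mul_distrib]
    refine Finset.prod_eq_one fun i _ => ?_
    split_ifs <;> simp
  set y₀ : Fin (V.qin + (V.cin + 2 * V.qin) + V.anc) → Bool :=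
    Fin.append (Fin.append (fun _ => false) z) fun _ => false with hy₀
  set K : Op (Fin (V.qin + (V.cin + 2 * V.qin) + V.anc)) (Fin V.qin) :=
    gatesMat (unpadGates V ++ V.gates.map (Gate.map f)) * (padIso V z * pauli u v) with hK
  -- Off the range of `shiftWire` the string must agree with `y₀`; on the range the amplitude is
  -- that of `V`, up to the sign.
  have hKa : ∀ y a, K y a = if y = Function.extend f (y ∘ f) y₀ then
      sgn * (gatesMat V.gates * V.inputIso c) (y ∘ f) a else 0 := by
    intro y a
    have h1 : K = gatesMat (V.gates.map (Gate.map f)) * (sgn • padIso V z) := by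
      rw [hK, ← unpadGates_mul_padIso V hu hv, gatesMat_append, Matrix.mul_assoc]
    have h2 : K y a = (gatesMat (V.gates.map (Gate.map f)) *ᵥ
        fun y => sgn * padIso V z y a) y := by
      rw [h1]; rfl
    rw [h2, gatesMat_map_mulVec hfi, actOn]
    have h3 : ∀ x, padIso V z (Function.extend f x y) a =
        if y = Function.extend f (y ∘ f) y₀ then V.inputIso c x a else 0 := by
      intro x
      have := extend_eq_extend_iff hfi x (Fin.append (Fin.append a c) fun _ => false) y y₀
      rw [← append_eq_extend V hc a] at this
      by_cases h : y = Function.extend f (y ∘ f) y₀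
      · rw [if_pos h]
        refine if_congr (this.trans (and_iff_left h)) rfl rfl
      · rw [if_neg h]
        exact if_neg fun h' => h (this.1 h').2
    simp only [h3]
    split_ifs with h
    · rw [Matrix.mul_apply, Matrix.mulVec, dotProduct, Finset.mul_sum]
      exact Finset.sum_congr rfl fun x _ => by ring
    · simp [Matrix.mulVec, dotProduct]
  have hE : (padCircuit V).eval z (pauli u v * w * (pauli u v)ᴴ) (fun _ => true) (fun _ => true) =
      reduce (V.out.map f).get (K * w * Kᴴ) (fun _ => true) (fun _ => true) := by
    have : K * w * Kᴴ = gatesMat (unpadGates V ++ V.gates.map (Gate.map f)) * (padIso V z *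
        (pauli u v * w * (pauli u v)ᴴ) * (padIso V z)ᴴ) *
        (gatesMat (unpadGates V ++ V.gates.map (Gate.map f)))ᴴ := by
      rw [hK]
      simp only [Matrix.conjTranspose_mul, Matrix.mul_assoc]
    rw [this]
    rfl
  rw [hE, QCircuit.eval, show gatesMat V.gates * (V.inputIso c * w * (V.inputIso c)ᴴ) *
    (gatesMat V.gates)ᴴ = (gatesMat V.gates * V.inputIso c) * w *
      (gatesMat V.gates * V.inputIso c)ᴴ by simp only [Matrix.conjTranspose_mul, Matrix.mul_assoc]]
  refine reduce_get_map hfi y₀ ?_ ?_ V.out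
  · intro y y' h
    rw [mul_mul_conjTranspose_apply] at h
    constructor
    · by_contra h'
      exact h (Finset.sum_eq_zero fun a _ => Finset.sum_eq_zero fun a' _ => by
        rw [hKa y, if_neg h', zero_mul, zero_mul])
    · by_contra h'
      exact h (Finset.sum_eq_zero fun a _ => Finset.sum_eq_zero fun a' _ => by
        rw [hKa y', if_neg h', map_zero, mul_zero])
  · intro x x'
    rw [mul_mul_conjTranspose_apply, mul_mul_conjTranspose_apply]
    refine Finset.sum_congr rfl fun a _ => Finset.sum_congr rfl fun a' _ => ?_
    rw [hKa, hKa, extend_comp hfi, extend_comp hfi, if_pos rfl, if_pos rfl, map_mul]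
    linear_combination ((gatesMat V.gates * V.inputIso c) x a * w a a' *
      (starRingEnd ℂ) ((gatesMat V.gates * V.inputIso c) x' a')) * hss

end PadCircuit
end

/-! ### Acceptance of the honest transcripts. -/

noncomputable section

theorem zeroIso_isometry {q N : ℕ} (h : q ≤ N) : (zeroIso q N)ᴴ * zeroIso q N = 1 := by
  ext z z'
  have hinj : padZero N z = padZero N z' → z = z' := fun h' => funext fun i => by
    have := congrFun h' ⟨i, by omega⟩
    simpa [padZero] using this
  rw [Matrix.mul_apply, Finset.sum_eq_single (padZero N z)]
  · by_cases hz : z = z'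
    · subst hz
      simp [zeroIso]
    · have hz' : padZero N z ≠ padZero N z' := fun h' => hz (hinj h')
      rw [Matrix.one_apply_ne hz]
      simp [zeroIso, hz']
  · intro y _ hy
    simp [zeroIso, hy]
  · simp

theorem Channel.apply_smul {ι κ : Type} [Fintype ι] [Fintype κ] [DecidableEq ι] [DecidableEq κ]
    (Φ : Channel ι κ) (c : ℂ) (ρ : Op ι ι) : Φ.apply (c • ρ) = c • Φ.apply ρ := by
  simp only [Channel.apply, Finset.smul_sum, Matrix.mul_smul, Matrix.smul_mul]

variable (L : QMAProblem) (Q : QREScheme) (C : CommitScheme)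

/-- The operator that maps `e₂` to `F̂₀`. -/
def hatOp (n : ℕ) (r : List Bool) : Op (Fin (hLen L Q n)) (Fin (L.m n)) := Q.hat n (protF L n) r

/-- The isometry that adjoins the labels and zeroes to `F̂₀`. -/
def labelOp (n : ℕ) (r : List Bool) : Op (Fin (qWidth L Q n)) (Fin (hLen L Q n)) :=
  labelIso (qWidth L Q n) (labels L Q n r)

/-- The operator `hat` is a compression of the encoder to the strings with the right labels and
zeroes. By `structured` this compression loses nothing, so adjoining the labels restores the full
output. -/
theorem labelOp_mul_hatOp (n : ℕ) (r : List Bool) (hr : r.length = rLen L Q n) :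
    labelOp L Q n r * hatOp L Q n r =
      gatesMat (Q.U n (protF L n) r) * zeroIso (L.m n) (qWidth L Q n) := by
  ext x e
  have h1 : (gatesMat (Q.U n (protF L n) r) * zeroIso (L.m n) (qWidth L Q n)) x e =
      encAmp L Q n r x e := by
    rw [← encoder_apply L Q n r hr, Matrix.mul_apply, Finset.sum_eq_single (padZero _ e)]
    · simp [zeroIso]
    · intro y _ hy
      simp [zeroIso, hy]
    · simp
  refine Eq.trans ?_ h1.symm
  rw [Matrix.mul_apply, Finset.sum_eq_single (x ∘ Fin.castLE (hLen_le L Q n))]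
  · simp only [labelOp, hatOp, labelIso, Matrix.of_apply, encAmp, ite_mul, one_mul, zero_mul]
  · intro y _ hy
    rw [labelOp, labelIso, Matrix.of_apply, if_neg, zero_mul]
    rintro rfl
    exact hy (withLabels_castLE _ _ _).symm
  · simp

/-- The check of an honest encoding succeeds. -/
theorem decode_sharedState (n : ℕ) (r : Fin (rLen L Q n) → Bool) (c : ℂ) :
    let A := (zeroIso (L.m n) (qWidth L Q n))ᴴ * (gatesMat (Q.U n (protF L n) (List.ofFn r)))ᴴ *
      labelOp L Q n (List.ofFn r)
    (A * (c • Matrix.of fun y y' => ∑ e, sharedState L Q n r e y *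
      (starRingEnd ℂ) (sharedState L Q n r e y')) * Aᴴ).trace = c := by
  intro A
  -- The inverse of the encoder meets the encoder, and what remains is the isometry that adjoins
  -- zeroes, composed with its adjoint.
  have hA : A * hatOp L Q n (List.ofFn r) = 1 := by
    rw [Matrix.mul_assoc, labelOp_mul_hatOp L Q n _ List.length_ofFn, Matrix.mul_assoc,
      ← Matrix.mul_assoc (gatesMat _)ᴴ, gatesMat_unitary, Matrix.one_mul]
    exact zeroIso_isometry (Q.width_in n (protF L n) (protF_wf L n))
  have hρ : (Matrix.of fun y y' => ∑ e, sharedState L Q n r e y *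
      (starRingEnd ℂ) (sharedState L Q n r e y')) =
      ((2 ^ L.m n : ℕ) : ℂ)⁻¹ • (hatOp L Q n (List.ofFn r) * (hatOp L Q n (List.ofFn r))ᴴ) := by
    ext y y'
    rw [Matrix.smul_apply, Matrix.mul_apply, Matrix.of_apply, smul_eq_mul, Finset.mul_sum]
    refine Finset.sum_congr rfl fun e _ => ?_
    rw [sharedState, sharedState, ← rt_pow, map_mul, conj_rt_pow, ← rt_pow_mul_self,
      Matrix.conjTranspose_apply]
    change rt ^ L.m n * hatOp L Q n (List.ofFn r) y e *
      (rt ^ L.m n * star (hatOp L Q n (List.ofFn r) y' e)) = _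
    ring
  rw [hρ, Matrix.mul_smul, Matrix.mul_smul, Matrix.smul_mul, Matrix.smul_mul, ← Matrix.mul_assoc, hA,
    Matrix.one_mul, ← Matrix.conjTranspose_mul, hA, Matrix.conjTranspose_one, Matrix.trace_smul,
    Matrix.trace_smul, Matrix.trace_one]
  simp

theorem verify_openAll (x : List Bool) (ω : Coins L Q C x.length) :
    verify L Q C x false (firstMsg L Q C _ ω,
      .openAll ω.1 (List.ofFn ω.2.1) (Q.lab _ _ (List.ofFn ω.1)) (fun i b => List.ofFn (ω.2.2 i b)),
      (Fintype.card (Coins L Q C x.length) : ℂ)⁻¹ • Matrix.of fun y y' =>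
        ∑ e, sharedState L Q _ ω.1 e y * (starRingEnd ℂ) (sharedState L Q _ ω.1 e y')) =
    (Fintype.card (Coins L Q C x.length) : ℝ)⁻¹ := by
  refine (if_pos ⟨rfl, fun _ _ => rfl⟩).trans ?_
  refine (congrArg Complex.re (decode_sharedState L Q x.length ω.1 _)).trans ?_
  rw [← Complex.ofReal_natCast, ← Complex.ofReal_inv, Complex.ofReal_re]

/-- Teleportation applies the encoder to the witness under the Pauli operator of the outcome. The
factor `2^(-m)` does not depend on the outcome, so all `4^m` outcomes enter with equal weight. -/
theorem teleport_eq (n : ℕ) (r : Fin (rLen L Q n) → Bool) (u v : Fin (L.m n) → Bool) :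
    teleport L Q n r u v = ((2 ^ L.m n : ℕ) : ℂ)⁻¹ •
      (hatOp L Q n (List.ofFn r) * pauli u v) := by
  ext y z
  rw [Matrix.smul_apply, pauli_mul_apply, ← rt_pow_mul_self, smul_eq_mul]
  refine (teleport_apply L Q n r u v y z).trans ?_
  rw [show (Q.hat n (protF L n) (List.ofFn r) y fun i => xor (z i) (u i)) =
    hatOp L Q n (List.ofFn r) y fun i => xor (z i) (u i) from rfl]
  ring

/-- Decoding after the teleportation gives the output of the verification circuit. -/
theorem decode_teleport (n : ℕ) (x : List Bool) (hx : x.length = n)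
    (w : Op (Fin (L.m n)) (Fin (L.m n))) (r : Fin (rLen L Q n) → Bool) (u v : Fin (L.m n) → Bool)
    (k : ℂ) :
    (Q.dec n (protF L n) fun i => Q.lab n (protF L n) (List.ofFn r) i
      (concatInput L n x u v i)).apply (k • (teleport L Q n r u v * w * (teleport L Q n r u v)ᴴ))
      (fun _ => true) (fun _ => true) =
    k * ((2 ^ L.m n : ℕ) : ℂ)⁻¹ * ((2 ^ L.m n : ℕ) : ℂ)⁻¹ *
      (L.circ n).eval (strInput x (L.circ n).cin) w (fun _ => true) (fun _ => true) := by
  set T := hatOp L Q n (List.ofFn r) with hT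
  set c : ℂ := ((2 ^ L.m n : ℕ) : ℂ)⁻¹ with hc
  have hcc : (starRingEnd ℂ) c = c := by rw [hc, map_inv₀, map_natCast]
  have h1 : teleport L Q n r u v * w * (teleport L Q n r u v)ᴴ =
      (c * c) • (T * (pauli u v * w * (pauli u v)ᴴ) * Tᴴ) := by
    rw [teleport_eq, ← hc, ← hT, Matrix.conjTranspose_smul, Matrix.conjTranspose_mul, Complex.star_def, hcc]
    simp only [Matrix.smul_mul, Matrix.mul_smul, smul_smul, Matrix.mul_assoc]
  have hlen : (L.circ n).cin = x.length := (L.cin_eq n).trans hx.symm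
  have hq : (L.circ n).qin = L.m n := rfl
  have h2 : (Q.dec n (protF L n) fun i => Q.lab n (protF L n) (List.ofFn r) i
      (concatInput L n x u v i)).apply (T * (pauli u v * w * (pauli u v)ᴴ) * Tᴴ)
      (fun _ => true) (fun _ => true) =
      (L.circ n).eval (strInput x (L.circ n).cin) w (fun _ => true) (fun _ => true) := by
    have h3 := Q.correct n (protF L n) (protF_wf L n) (List.ofFn r) List.length_ofFn
      (concatInput L n x u v) (pauli u v * w * (pauli u v)ᴴ)
    -- The side goals locate `x`, `u` and `v` within the concatenated classical input.
    refine (congrFun (congrFun h3 _) _).trans (padCircuit_eval (L.circ n) ?_ ?_ ?_ w)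
    · intro i
      have hi := i.2
      simp only [concatInput, strInput]
      rw [List.append_assoc, List.getD_append _ _ _ _ (by omega)]
    · intro i
      simp only [concatInput, strInput, hlen]
      rw [List.append_assoc, List.getD_append_right _ _ _ _ (by omega),
        List.getD_append _ _ _ _ (by simp)]
      simp
    · intro i
      simp only [concatInput, strInput, hlen]
      rw [List.append_assoc, List.getD_append_right _ _ _ _ (by omega),
        List.getD_append_right _ _ _ _ (by simp; omega),
        show x.length + (L.circ n).qin + (i : ℕ) - x.length - (List.ofFn u).length = i by
          rw [List.length_ofFn]; omega]
      simp
  rw [h1, Channel.apply_smul, Channel.apply_smul, Matrix.smul_apply, Matrix.smul_apply, h2,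
    smul_eq_mul, smul_eq_mul]
  ring

theorem verify_openSome (x : List Bool) (w : Op (Fin (L.m x.length)) (Fin (L.m x.length)))
    (ω : Coins L Q C x.length) (u v : Fin (L.m x.length) → Bool) :
    verify L Q C x true (firstMsg L Q C _ ω,
      .openSome (concatInput L x.length x u v)
        (fun i => Q.lab _ _ (List.ofFn ω.1) i (concatInput L x.length x u v i))
        (fun i => List.ofFn (ω.2.2 i (concatInput L x.length x u v i))),
      (Fintype.card (Coins L Q C x.length) : ℂ)⁻¹ • (teleport L Q x.length ω.1 u v * w *
        (teleport L Q x.length ω.1 u v)ᴴ)) =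
    (Fintype.card (Coins L Q C x.length) : ℝ)⁻¹ * ((2 ^ L.m x.length : ℕ) : ℝ)⁻¹ *
      ((2 ^ L.m x.length : ℕ) : ℝ)⁻¹ * (L.circ x.length).acceptProb x w := by
  refine (if_pos ⟨⟨u, v, rfl⟩, fun _ => rfl⟩).trans ?_
  refine (congrArg Complex.re (decode_teleport L Q x.length x rfl w ω.1 u v _)).trans ?_
  have h : (Fintype.card (Coins L Q C x.length) : ℂ)⁻¹ * ((2 ^ L.m x.length : ℕ) : ℂ)⁻¹ *
      ((2 ^ L.m x.length : ℕ) : ℂ)⁻¹ = ((Fintype.card (Coins L Q C x.length) : ℝ)⁻¹ *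
      ((2 ^ L.m x.length : ℕ) : ℝ)⁻¹ * ((2 ^ L.m x.length : ℕ) : ℝ)⁻¹ : ℝ) := by
    push_cast
    ring
  rw [h, Complex.re_ofReal_mul]
  rfl

/-- Challenge 0 is always passed, and challenge 1 is passed with the probability of the verification
circuit: in both cases the individual weights sum to one over coins and outcomes. -/
theorem acceptProb_eq (x : List Bool) (w : Op (Fin (L.m x.length)) (Fin (L.m x.length))) :
    acceptProb L Q C x w = (1 + (L.circ x.length).acceptProb x w) / 2 := by
  have hcard : (Fintype.card (Coins L Q C x.length) : ℝ) ≠ 0 := by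
    rw [card_coins]
    positivity
  have h0 : ((honest L Q C x w false).map (verify L Q C x false)).sum = 1 := by
    rw [honest, Multiset.map_map]
    refine (Finset.sum_congr rfl fun ω _ => verify_openAll L Q C x ω).trans ?_
    rw [Finset.sum_const, Finset.card_univ, nsmul_eq_mul, mul_inv_cancel₀ hcard]
  have h1 : ((honest L Q C x w true).map (verify L Q C x true)).sum =
      (L.circ x.length).acceptProb x w := by
    rw [honest, Multiset.map_map]
    refine (Finset.sum_congr rfl fun ω _ =>
      verify_openSome L Q C x w ω.1 ω.2.1 ω.2.2).trans ?_
    rw [Finset.sum_const, Finset.card_univ, nsmul_eq_mul, Fintype.card_prod (Coins L Q C x.length),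
      Fintype.card_prod (Fin (L.m x.length) → Bool), Fintype.card_fun, Fintype.card_bool,
      Fintype.card_fin]
    push_cast
    field_simp
  rw [acceptProb, h0, h1]

end
end ZKQMA

theorem lemma5p1 (L : ZKQMA.QMAProblem) (Q : ZKQMA.QREScheme) (C : ZKQMA.CommitScheme) :
    ∃ (μ : ℕ → ℝ) (P : ZKQMA.Prover) (p : Polynomial ℕ), ZKQMA.Negligible μ ∧
      ∀ x ∈ L.yes, ∀ w ∈ L.witnesses x,
        P.IsHonestInTime L Q C (p.eval x.length) x w ∧
        1 - μ x.length ≤ ZKQMA.acceptProb L Q C x w := by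
  obtain ⟨P, p, hP⟩ := ZKQMA.exists_isHonestInTime L Q C
  -- The rejection probability is half that of the verification circuit, since `1 - (1 + a) / 2 = (1
  -- - a) / 2`.
  refine ⟨fun n => L.err n * 2⁻¹, P, p, L.err_negl.mul_const 2⁻¹, fun x _ w hw =>
    ⟨hP x w hw.1.2, ?_⟩⟩
  rw [ZKQMA.acceptProb_eq]
  linarith [hw.2]
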